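/- **Setting.** Let $(E,g)$ be a compact connected $C^\infty$ Riemannian manifold with volume measure $dx$, let $V\in C^\infty(E)$ with $\int e^{-V}dx=1$, and put $d\mu=e^{-V}dx$, $L=\Delta_g-\nabla V\cdot\nabla$. Write $\mathcal A$ for the algebra of smooth real functions on $E$ and $\Gamma(u,v)=\tfrac12\big(L(uv)-u\,Lv-v\,Lu\big)$, $\Gamma(u)=\Gamma(u,u)$, for the carré du champ of $L$. A *Markov semigroup with generator $L$* is a family $(P_t)_{t\ge0}$, $P_tf(x)=\int f(y)\,p_t(x,dy)$, given by Markov probability kernels $p_t$ with $P_0=\mathrm{Id}$ and $P_{s+t}=P_sP_t$, reversible for $\mu$ (that is, $\int u\,P_tv\,d\mu=\int v\,P_tu\,d\mu$ for $u,v\in\mathcal A$), and such that $t^{-1}(P_tu-u)\to Lu$ in $L^2(\mu)$ as $t\to0^+$ for every $u\in\mathcal A$. Let $\mathcal F$ be the set of positive functions $f\in\mathcal A$ with $\int f\,d\mu=1$. For $f,g\in\mathcal F$, an admissible path between $f$ and $g$ is a couple $(\rho_s,h_s)_{s\in[0,1]}$ of smooth functions on $[0,1]\times E$ with $\rho_s\in\mathcal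 F$ for all $s\in[0,1]$, $\partial_s\rho_s+Lh_s=0$, $\rho_0=f$ and $\rho_1=g$. The Markov transportation distance is $$T_2(f\mu,g\mu)=\inf\Big(\int_0^1\int\frac{\Gamma(h_s)}{\rho_s}\,d\mu\,ds\Big)^{1/2},$$ where the infimum runs over all admissible paths between $f$ and $g$. **Proposition (Tensorization).** For $i\in\{1,\dots,N\}$ let $E_i$ be a compact connected Riemannian manifold with $V_i$, $\mu_i$, $L_i$, $\Gamma_i$, $\mathcal F_i$ and $T_{2,i}$ as above. On the product manifold $E=\prod_{i=1}^NE_i$ consider the measure $\mu=\bigotimes_{i=1}^N\mu_i$ and the operator $L=\bigoplus_{i=1}^NL_i$, that is $Lu=\sum_iL_iu$ where $L_i$ acts on the $i$-th variable. 1. If $(P^i_t)_{t\ge0}$ is a Markov semigroup with generator $L_i$ on $E_i$ for each $i$, then the product kernels $p_t(x,\cdot)=\bigotimes_{i=1}^Np^i_t(x_i,\cdot)$ define a Markov semigroup $P_t=\bigotimes_{i=1}^NP^i_t$ on $E$, reversible for $\mu$, with generator $L$. 2. The carré du champ of $L$ is $\Gamma=\bigoplus_{i=1}^N\Gamma_i$,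 that is $\Gamma(u,v)=\sum_i\Gamma_i(u,v)$ for smooth $u,v$ on $E$, where $\Gamma_i$ acts on the $i$-th variable. 3. Let $T_2$ be the Markov transportation distance on $E$ defined as above from $\mu$, $L$ and $\Gamma$. Then for all $f_i,g_i\in\mathcal F_i$, the densities $f(x)=\prod_{i=1}^Nf_i(x_i)$ and $g(x)=\prod_{i=1}^Ng_i(x_i)$ satisfy $$T_2^2(f\mu,g\mu)\ \ge\ \sum_{i=1}^NT_{2,i}^2(f_i\mu_i,g_i\mu_i).$$ -/

import Mathlib

open MeasureTheory ProbabilityTheory Set Filter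
open scoped Manifold ContDiff Topology ENNReal NNReal

namespace MarkovTransport

noncomputable section

/-! ### Riemannian geometry in charts: volume, Laplace–Beltrami operator -/

section Riemannian

/-- A `C^∞` Riemannian metric on a manifold `M` of dimension `n`. -/
abbrev Metric (n : ℕ) (M : Type*) [TopologicalSpace M]
    [ChartedSpace (EuclideanSpace ℝ (Fin n)) M] [IsManifold (𝓡 n) ∞ M] :=
  Bundle.ContMDiffRiemannianMetric (𝓡 n) ∞ (EuclideanSpace ℝ (Fin n))
    (fun x : M => TangentSpace (𝓡 n) x)

variable {n : ℕ} {M : Type*} [TopologicalSpace M]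
  [ChartedSpace (EuclideanSpace ℝ (Fin n)) M]

/-- The partial derivative `∂ᵢ u` of a function on `ℝⁿ`. -/
def partialDeriv (i : Fin n) (u : EuclideanSpace ℝ (Fin n) → ℝ)
    (y : EuclideanSpace ℝ (Fin n)) : ℝ :=
  fderiv ℝ u y (EuclideanSpace.single i 1)

variable [IsManifold (𝓡 n) ∞ M]

/-- The coordinate vector field `∂ᵢ` of the chart around `x`, at the point of coordinates `y`. -/
def coordVector (x : M) (y : EuclideanSpace ℝ (Fin n)) (i : Fin n) :
    TangentSpace (𝓡 n) ((extChartAt (𝓡 n) x).symm y) :=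
  mfderiv 𝓘(ℝ, EuclideanSpace ℝ (Fin n)) (𝓡 n) (extChartAt (𝓡 n) x).symm y
    (EuclideanSpace.single i (1 : ℝ))

/-- The matrix `g_{ij}` of the metric in the chart around `x`, at the point of coordinates `y`. -/
def metricMatrix (g : Metric n M) (x : M) (y : EuclideanSpace ℝ (Fin n)) :
    Matrix (Fin n) (Fin n) ℝ :=
  Matrix.of fun i j =>
    g.inner ((extChartAt (𝓡 n) x).symm y) (coordVector x y i) (coordVector x y j)

/-- The density `√(det g_{ij})` of the volume measure in the chart around `x`. -/
def sqrtDet (g : Metric n M) (x : M) (y : EuclideanSpace ℝ (Fin n)) : ℝ :=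
  Real.sqrt (metricMatrix g x y).det

/-- The volume measure carried by the domain of the chart around `x`: the image by the inverse
chart of `√(det g_{ij}) dy`. -/
def chartVolume [MeasurableSpace M] (g : Metric n M) (x : M) : Measure M :=
  ((volume.restrict (extChartAt (𝓡 n) x).target).withDensity
    (fun y => ENNReal.ofReal (sqrtDet g x y))).map (extChartAt (𝓡 n) x).symm

/-- The Riemannian volume measure. The measures `chartVolume g x` are the restrictions of one
measure to the chart domains, and that measure is their supremum (the least measure that
dominates all of them) since countably many chart domains cover the manifold. -/
def riemannianVolume [MeasurableSpace M] (g : Metric n M) : Measure M :=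
  ⨆ x : M, chartVolume g x

/-- The measure `e^{-V} dx`. -/
def weightedMeasure [MeasurableSpace M] (g : Metric n M) (V : M → ℝ) : Measure M :=
  (riemannianVolume g).withDensity (fun x => ENNReal.ofReal (Real.exp (-V x)))

/-- The Laplace–Beltrami operator,
`Δ_g f = (det g)^{-1/2} ∑ᵢ ∂ᵢ ((det g)^{1/2} ∑ⱼ g^{ij} ∂ⱼ f)` in the chart around the point. -/
def laplaceBeltrami (g : Metric n M) (f : M → ℝ) (x : M) : ℝ :=
  (sqrtDet g x (extChartAt (𝓡 n) x x))⁻¹ *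
    ∑ i, partialDeriv i
      (fun y => sqrtDet g x y *
        ∑ j, (metricMatrix g x y)⁻¹ i j * partialDeriv j (f ∘ (extChartAt (𝓡 n) x).symm) y)
      (extChartAt (𝓡 n) x x)

/-- The scalar product `∇u · ∇v = ∑_{i,j} g^{ij} ∂ᵢu ∂ⱼv` of two gradients. -/
def gradInner (g : Metric n M) (u v : M → ℝ) (x : M) : ℝ :=
  ∑ i, ∑ j, (metricMatrix g x (extChartAt (𝓡 n) x x))⁻¹ i j *
    partialDeriv i (u ∘ (extChartAt (𝓡 n) x).symm) (extChartAt (𝓡 n) x x) *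
    partialDeriv j (v ∘ (extChartAt (𝓡 n) x).symm) (extChartAt (𝓡 n) x x)

/-- The generator `L = Δ_g - ∇V · ∇`. -/
def diffusionGenerator (g : Metric n M) (V : M → ℝ) (f : M → ℝ) (x : M) : ℝ :=
  laplaceBeltrami g f x - gradInner g V f x

end Riemannian

/-! ### Markov semigroups and the Markov transportation distance -/

section Transport

variable {X H M : Type*} [NormedAddCommGroup X] [NormedSpace ℝ X] [TopologicalSpace H]
  (I : ModelWithCorners ℝ X H) [TopologicalSpace M] [ChartedSpace H M]

/-- The carré du champ `Γ(u, v) = ½ (L(uv) - u Lv - v Lu)` of an operator `L`. -/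
def carreDuChamp (L : (M → ℝ) → M → ℝ) (u v : M → ℝ) (x : M) : ℝ :=
  (1 / 2) * (L (fun y => u y * v y) x - u x * L v x - v x * L u x)

variable [MeasurableSpace M] (μ : Measure M) (L : (M → ℝ) → M → ℝ)

/-- The action `P_t f (x) = ∫ f(y) p_t(x, dy)` of a family of kernels on functions. -/
def act (P : ℝ≥0 → Kernel M M) (t : ℝ≥0) (f : M → ℝ) (x : M) : ℝ :=
  ∫ y, f y ∂(P t x)

/-- The Markov kernels `(P_t)` form a semigroup, reversible with respect to `μ`, whose
infinitesimal generator in `L²(μ)` is defined on the algebra of smooth functions and equal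
to `L` there. -/
structure IsMarkovSemigroup (P : ℝ≥0 → Kernel M M) : Prop where
  markov : ∀ t, IsMarkovKernel (P t)
  zero : P 0 = Kernel.id
  add : ∀ s t, P (s + t) = P s ∘ₖ P t
  reversible : ∀ u v : M → ℝ, ContMDiff I 𝓘(ℝ, ℝ) ∞ u → ContMDiff I 𝓘(ℝ, ℝ) ∞ v → ∀ t,
    ∫ x, u x * act P t v x ∂μ = ∫ x, v x * act P t u x ∂μ
  generator : ∀ u : M → ℝ, ContMDiff I 𝓘(ℝ, ℝ) ∞ u →
    MemLp (L u) 2 μ ∧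
    Tendsto (fun t : ℝ≥0 =>
      eLpNorm (fun x => (t : ℝ)⁻¹ * (act P t u x - u x) - L u x) 2 μ) (𝓝[>] 0) (𝓝 0)

/-- The set `𝓕` of smooth positive probability densities with respect to `μ`. -/
structure IsDensity (f : M → ℝ) : Prop where
  smooth : ContMDiff I 𝓘(ℝ, ℝ) ∞ f
  pos : ∀ x, 0 < f x
  integral_eq_one : ∫ x, f x ∂μ = 1

/-- `(ρ_s, h_s)_{s ∈ [0,1]}` is an admissible path between `f` and `g`: both functions are smooth
on `[0,1] × M`, each `ρ_s` is in `𝓕`, `∂_s ρ_s + L h_s = 0`, `ρ_0 = f` and `ρ_1 = g`. The values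
for `s` outside `[0,1]` play no role. -/
structure IsAdmissiblePath (f g : M → ℝ) (ρ h : ℝ → M → ℝ) : Prop where
  smooth_ρ : ContMDiffOn (𝓘(ℝ, ℝ).prod I) 𝓘(ℝ, ℝ) ∞
    (fun p : ℝ × M => ρ p.1 p.2) (Icc 0 1 ×ˢ univ)
  smooth_h : ContMDiffOn (𝓘(ℝ, ℝ).prod I) 𝓘(ℝ, ℝ) ∞
    (fun p : ℝ × M => h p.1 p.2) (Icc 0 1 ×ˢ univ)
  density : ∀ s ∈ Icc (0 : ℝ) 1, IsDensity I μ (ρ s)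
  continuity_eq : ∀ s ∈ Icc (0 : ℝ) 1, ∀ x,
    HasDerivWithinAt (fun r => ρ r x) (-(L (h s) x)) (Icc 0 1) s
  start_eq : ρ 0 = f
  end_eq : ρ 1 = g

/-- `φ(ρ, h) = ∫ Γ(h) / ρ dμ`. -/
def energy (ρ h : M → ℝ) : ℝ≥0∞ :=
  ∫⁻ x, ENNReal.ofReal (carreDuChamp L h h x / ρ x) ∂μ

/-- `Φ(ρ, h) = ∫_0^1 φ(ρ_s, h_s) ds`. -/
def pathAction (ρ h : ℝ → M → ℝ) : ℝ≥0∞ :=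
  ∫⁻ s in Icc (0 : ℝ) 1, energy μ L (ρ s) (h s)

/-- The Markov transportation distance `T₂(fμ, gμ)`. -/
def T2 (f g : M → ℝ) : ℝ≥0∞ :=
  ⨅ (ρ : ℝ → M → ℝ) (h : ℝ → M → ℝ) (_ : IsAdmissiblePath I μ L f g ρ h),
    pathAction μ L ρ h ^ (1 / 2 : ℝ)

end Transport

/-! ### Products -/

section Product

variable {ι : Type*} [Fintype ι] [DecidableEq ι] {E : ι → Type*}

/-- The partial function `y ↦ u(x_1, …, y, …, x_N)`, with `y` in the place `i`. -/
def slice (u : (∀ i, E i) → ℝ) (x : ∀ i, E i) (i : ι) (y : E i) : ℝ :=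
  u (Function.update x i y)

/-- The operator `⊕ L_i`: each `L_i` acts on the `i`-th variable. -/
def sumOperator (L : ∀ i, (E i → ℝ) → E i → ℝ) (u : (∀ i, E i) → ℝ) (x : ∀ i, E i) : ℝ :=
  ∑ i, L i (slice u x i) (x i)

/-- The bilinear operator `⊕ Γ_i`: each `Γ_i` acts on the `i`-th variable. -/
def sumBilinear (Γ : ∀ i, (E i → ℝ) → (E i → ℝ) → E i → ℝ) (u v : (∀ i, E i) → ℝ)
    (x : ∀ i, E i) : ℝ :=
  ∑ i, Γ i (slice u x i) (slice v x i) (x i)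

end Product

end

end MarkovTransport

set_option linter.unusedSectionVars false

namespace MarkovTransport

/-! ### The metric in a chart: smoothness and positivity. -/

section Riemannian

variable {n : ℕ} {M : Type*} [TopologicalSpace M]
  [ChartedSpace (EuclideanSpace ℝ (Fin n)) M] [IsManifold (𝓡 n) ∞ M]

/-! The transport inequality comes from averaging. Given an admissible path (ρ_s, h_s) on the
product, between product densities, integrate ρ_s and h_s over all variables except the i-th
(`marginal`). For j ≠ i the values of L_j have mean zero against μ_j, so averaging intertwines ⊕ L_j
with L_i (`integral_sumOperator`), and the averaged pair is an admissible path between f_i and g_i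
(`IsAdmissiblePath.marginal`). Since (ρ, h) ↦ Γ_i(h)/ρ is jointly convex, Jensen's inequality bounds
the energy of the i-th averaged path by ∫ Γ_i(h_s)/ρ_s dμ
(`IsDiffusion.carreDuChamp_integral_div_le`). Because Γ = ⊕ Γ_i, these bounds add up to the energy
of the original path (`sum_energy_marginal_le`); an infimum over paths concludes. The formula for Γ
itself is pure algebra.

For the semigroup, the kernel identities and reversibility are checked on boxes. The generator is
found by letting the variables move one at a time: if P^s moves the variables in s, then P^{s ∪ {k}}
u - u = P^s (P^{k} u - u) + (P^s u - u). After division by t, the first term tends to L_k u because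
P^s is an L² contraction that converges strongly to the identity. Convergence for a single variable
holds slice by slice, and passes to the product by dominated convergence, the domination being ‖P_t
u - u‖ ≤ t ‖Lu‖ (`IsMarkovSemigroup.eLpNorm_act_sub_le`).

Geometry enters only through `IsDiffusion`: in every chart L is a second order operator without
zeroth order term, with continuous coefficients and nonnegative leading part, and ∫ Lu dμ = 0. Since
L is defined at each point in the chart of that point, its invariance under change of chart has to
be proved; it follows from the weak form ∫ χ Lu dμ = -∫ ∇χ·∇u dμ, whose right-hand side involves no
choice of chart. -/

theorem isOpen_target (x : M) : IsOpen (extChartAt (𝓡 n) x).target := isOpen_extChartAt_target x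

theorem mdifferentiableAt_symm (x : M) {y : EuclideanSpace ℝ (Fin n)}
    (hy : y ∈ (extChartAt (𝓡 n) x).target) :
    MDifferentiableAt 𝓘(ℝ, EuclideanSpace ℝ (Fin n)) (𝓡 n) (extChartAt (𝓡 n) x).symm y :=
  ((contMDiffOn_extChartAt_symm (n := ∞) x).contMDiffAt
    ((isOpen_target x).mem_nhds hy)).mdifferentiableAt (by simp)

/-- The tangent map of the inverse chart is smooth, and it is applied here to a constant section. -/
theorem contMDiffOn_coordVector (x : M) (i : Fin n) :
    ContMDiffOn 𝓘(ℝ, EuclideanSpace ℝ (Fin n)) (𝓡 n).tangent ∞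
      (fun y => (⟨(extChartAt (𝓡 n) x).symm y, coordVector x y i⟩ : TangentBundle (𝓡 n) M))
      (extChartAt (𝓡 n) x).target := by
  have h1 := (contMDiffOn_extChartAt_symm (I := 𝓡 n) (n := ∞) x).contMDiffOn_tangentMapWithin
    (m := ∞) (by simp) (isOpen_target x).uniqueMDiffOn
  have h2 : ContMDiffOn 𝓘(ℝ, EuclideanSpace ℝ (Fin n)) 𝓘(ℝ, EuclideanSpace ℝ (Fin n)).tangent ∞
      (fun y => (⟨y, EuclideanSpace.single i (1 : ℝ)⟩ :
        TangentBundle 𝓘(ℝ, EuclideanSpace ℝ (Fin n)) (EuclideanSpace ℝ (Fin n))))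
      (extChartAt (𝓡 n) x).target := by
    intro y hy
    exact contMDiffWithinAt_vectorSpace_iff_contDiffWithinAt.2
      (contDiffWithinAt_const (c := EuclideanSpace.single i (1 : ℝ)))
  refine (h1.comp h2 (fun y hy => hy)).congr ?_
  intro y hy
  simp only [Function.comp_apply, tangentMapWithin, coordVector]
  rw [mfderivWithin_eq_mfderiv ((isOpen_target x).uniqueMDiffWithinAt hy)
    (mdifferentiableAt_symm x hy)]

theorem contDiffOn_metricMatrix (g : Metric n M) (x : M) (i j : Fin n) :
    ContDiffOn ℝ ∞ (fun y => metricMatrix g x y i j) (extChartAt (𝓡 n) x).target := by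
  rw [← contMDiffOn_iff_contDiffOn]
  intro y hy
  have h := ContMDiffWithinAt.clm_bundle_apply₂ (F₁ := EuclideanSpace ℝ (Fin n))
    (F₂ := EuclideanSpace ℝ (Fin n)) (F₃ := ℝ) (E₃ := fun _ : M => ℝ)
    (ψ := fun y => g.inner ((extChartAt (𝓡 n) x).symm y))
    (v := fun y => coordVector x y i) (w := fun y => coordVector x y j)
    ((g.contMDiff.comp_contMDiffOn (contMDiffOn_extChartAt_symm x)) y hy)
    (contMDiffOn_coordVector x i y hy) (contMDiffOn_coordVector x j y hy)
  rw [Bundle.contMDiffWithinAt_totalSpace] at h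
  simpa [metricMatrix] using h.2

/-- The chart derivative is injective. -/
theorem mfderiv_symm_injective (x : M) {y : EuclideanSpace ℝ (Fin n)}
    (hy : y ∈ (extChartAt (𝓡 n) x).target) :
    Function.Injective (mfderiv 𝓘(ℝ, EuclideanSpace ℝ (Fin n)) (𝓡 n)
      (extChartAt (𝓡 n) x).symm y) := by
  have h := mfderiv_extChartAt_comp_mfderivWithin_extChartAt_symm (I := 𝓡 n) hy
  simp only [modelWithCornersSelf_coe, range_id, mfderivWithin_univ] at h
  intro v w hvw
  have hv := DFunLike.congr_fun h v
  have hw := DFunLike.congr_fun h w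
  simp only [ContinuousLinearMap.comp_apply] at hv hw
  rw [hvw] at hv
  exact hv.symm.trans hw

theorem sum_smul_coordVector (x : M) (y : EuclideanSpace ℝ (Fin n)) (ξ : Fin n → ℝ) :
    ∑ i, ξ i • coordVector x y i =
      mfderiv 𝓘(ℝ, EuclideanSpace ℝ (Fin n)) (𝓡 n) (extChartAt (𝓡 n) x).symm y
        (WithLp.toLp 2 ξ) := by
  have : (WithLp.toLp 2 ξ : EuclideanSpace ℝ (Fin n)) =
      ∑ i, ξ i • EuclideanSpace.single i (1 : ℝ) := by
    ext k
    simp [Finset.sum_apply, Pi.single_apply]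
  rw [this]
  erw [map_sum]
  refine Finset.sum_congr rfl fun i _ => ?_
  erw [map_smul]
  rfl

/-- This is a Gram matrix, of vectors that are independent because the inverse chart has injective
derivative. -/
theorem posDef_metricMatrix (g : Metric n M) (x : M) {y : EuclideanSpace ℝ (Fin n)}
    (hy : y ∈ (extChartAt (𝓡 n) x).target) : (metricMatrix g x y).PosDef := by
  refine Matrix.PosDef.of_dotProduct_mulVec_pos ?_ ?_
  · ext i j
    exact g.symm _ _ _
  · intro ξ hξ
    have : star ξ ⬝ᵥ (metricMatrix g x y).mulVec ξ =
        g.inner ((extChartAt (𝓡 n) x).symm y) (∑ i, ξ i • coordVector x y i)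
          (∑ i, ξ i • coordVector x y i) := by
      simp only [map_sum, map_smul, sum_apply, dotProduct, Matrix.mulVec,
        metricMatrix, Matrix.of_apply, star_trivial, smul_apply, smul_eq_mul,
        Finset.mul_sum]
      rw [Finset.sum_comm]
      refine Finset.sum_congr rfl fun i _ => Finset.sum_congr rfl fun j _ => ?_
      ring
    rw [this]
    apply g.pos
    rw [sum_smul_coordVector]
    intro h0
    apply hξ
    have := mfderiv_symm_injective x hy (h0.trans (map_zero _).symm)
    exact (WithLp.toLp_eq_zero 2).1 this

end Riemannian
noncomputable section

/-! ### Change of charts: metric, volume density and gradients. -/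

section Transition

variable {n : ℕ} {M : Type*} [TopologicalSpace M]
  [ChartedSpace (EuclideanSpace ℝ (Fin n)) M] [IsManifold (𝓡 n) ∞ M]

/-- The transition map from the chart around `x` to the chart around `x'`. -/
def transition (x x' : M) : EuclideanSpace ℝ (Fin n) → EuclideanSpace ℝ (Fin n) :=
  extChartAt (𝓡 n) x' ∘ (extChartAt (𝓡 n) x).symm

/-- The domain of the transition map, in the chart around `x`. -/
def overlap (x x' : M) : Set (EuclideanSpace ℝ (Fin n)) :=
  (extChartAt (𝓡 n) x).target ∩ (extChartAt (𝓡 n) x).symm ⁻¹' (extChartAt (𝓡 n) x').source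

/-- The Jacobian matrix of the transition map. -/
def jacobian (x x' : M) (y : EuclideanSpace ℝ (Fin n)) : Matrix (Fin n) (Fin n) ℝ :=
  Matrix.of fun k i => fderiv ℝ (transition x x') y (EuclideanSpace.single i 1) k

theorem isOpen_overlap (x x' : M) : IsOpen (overlap (n := n) x x') :=
  (continuousOn_extChartAt_symm x).isOpen_inter_preimage (isOpen_target x)
    (isOpen_extChartAt_source x')

theorem contDiffOn_transition (x x' : M) :
    ContDiffOn ℝ ∞ (transition (n := n) x x') (overlap x x') := by
  rw [← contMDiffOn_iff_contDiffOn]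
  exact (contMDiffOn_extChartAt (I := 𝓡 n) (n := ∞) (x := x')).comp
    ((contMDiffOn_extChartAt_symm x).mono inter_subset_left)
    (fun y hy => by simpa [extChartAt_source] using hy.2)

theorem differentiableAt_transition {x x' : M} {y : EuclideanSpace ℝ (Fin n)}
    (hy : y ∈ overlap x x') : DifferentiableAt ℝ (transition (n := n) x x') y :=
  ((contDiffOn_transition x x').contDiffAt ((isOpen_overlap x x').mem_nhds hy)).differentiableAt
    (by simp)

theorem symm_transition {x x' : M} {y : EuclideanSpace ℝ (Fin n)} (hy : y ∈ overlap x x') :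
    (extChartAt (𝓡 n) x').symm (transition x x' y) = (extChartAt (𝓡 n) x).symm y :=
  (extChartAt (𝓡 n) x').left_inv hy.2

theorem transition_mem_target {x x' : M} {y : EuclideanSpace ℝ (Fin n)} (hy : y ∈ overlap x x') :
    transition x x' y ∈ (extChartAt (𝓡 n) x').target :=
  (extChartAt (𝓡 n) x').map_source hy.2

theorem transition_transition {x x' : M} {y : EuclideanSpace ℝ (Fin n)} (hy : y ∈ overlap x x') :
    transition x' x (transition x x' y) = y := by
  change extChartAt (𝓡 n) x ((extChartAt (𝓡 n) x').symm (transition x x' y)) = y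
  rw [symm_transition hy, (extChartAt (𝓡 n) x).right_inv hy.1]

theorem injOn_transition (x x' : M) : InjOn (transition (n := n) x x') (overlap x x') :=
  fun _ hy _ hz h => by rw [← transition_transition hy, h, transition_transition hz]

theorem euclidean_eq_sum (v : EuclideanSpace ℝ (Fin n)) :
    v = ∑ k, v k • EuclideanSpace.single k (1 : ℝ) := by
  ext k
  simp [Finset.sum_apply, Pi.single_apply]

theorem mfderiv_symm_eq {x x' : M} {y : EuclideanSpace ℝ (Fin n)} (hy : y ∈ overlap x x')
    (v : EuclideanSpace ℝ (Fin n)) :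
    (mfderiv 𝓘(ℝ, EuclideanSpace ℝ (Fin n)) (𝓡 n) (extChartAt (𝓡 n) x).symm y v :
      EuclideanSpace ℝ (Fin n)) =
    mfderiv 𝓘(ℝ, EuclideanSpace ℝ (Fin n)) (𝓡 n) (extChartAt (𝓡 n) x').symm (transition x x' y)
      (fderiv ℝ (transition x x') y v) := by
  have h1 : (extChartAt (𝓡 n) x).symm =ᶠ[𝓝 y]
      (extChartAt (𝓡 n) x').symm ∘ transition x x' := by
    filter_upwards [(isOpen_overlap x x').mem_nhds hy] with z hz using (symm_transition hz).symm
  have h2 := (mdifferentiableAt_symm x' (transition_mem_target hy)).hasMFDerivAt.comp y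
    (differentiableAt_transition hy).hasFDerivAt.hasMFDerivAt
  have h3 := (h2.congr_of_eventuallyEq h1).mfderiv
  exact DFunLike.congr_fun h3 v

theorem coordVector_eq_sum {x x' : M} {y : EuclideanSpace ℝ (Fin n)} (hy : y ∈ overlap x x')
    (i : Fin n) :
    (coordVector x y i : EuclideanSpace ℝ (Fin n)) =
      ∑ k, jacobian x x' y k i •
        (coordVector x' (transition x x' y) k : EuclideanSpace ℝ (Fin n)) := by
  have h := mfderiv_symm_eq hy (EuclideanSpace.single i (1 : ℝ))
  have h2 := sum_smul_coordVector x' (transition x x' y) (fun k => jacobian x x' y k i)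
  exact h.trans h2.symm

theorem bilinear_sum_sum {F : Type*} [NormedAddCommGroup F] [NormedSpace ℝ F]
    (B : F →L[ℝ] F →L[ℝ] ℝ) (J : Matrix (Fin n) (Fin n) ℝ) (w : Fin n → F) (i j : Fin n) :
    B (∑ k, J k i • w k) (∑ k, J k j • w k) =
      (J.transpose * (Matrix.of fun k l => B (w k) (w l)) * J) i j := by
  simp only [map_sum, map_smul, sum_apply, smul_apply, smul_eq_mul, Matrix.mul_apply,
    Matrix.transpose_apply, Finset.sum_mul, Finset.mul_sum, Matrix.of_apply]
  refine Finset.sum_congr rfl fun k _ => Finset.sum_congr rfl fun l _ => ?_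
  ring

theorem metricMatrix_eq (g : Metric n M) {x x' : M} {y : EuclideanSpace ℝ (Fin n)}
    (hy : y ∈ overlap x x') :
    metricMatrix g x y =
      (jacobian x x' y).transpose * metricMatrix g x' (transition x x' y) * jacobian x x' y := by
  ext i j
  -- All tangent spaces are definitionally ℝⁿ; giving the inner product a fixed type allows its base
  -- point to be rewritten.
  let G : M → EuclideanSpace ℝ (Fin n) →L[ℝ] EuclideanSpace ℝ (Fin n) →L[ℝ] ℝ := g.inner
  have h1 : metricMatrix g x y i j = G ((extChartAt (𝓡 n) x').symm (transition x x' y))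
      (coordVector x y i) (coordVector x y j) := by
    rw [symm_transition hy]; rfl
  rw [h1, coordVector_eq_sum hy, coordVector_eq_sum hy]
  exact bilinear_sum_sum _ _ _ _ _

theorem det_jacobian (x x' : M) (y : EuclideanSpace ℝ (Fin n)) :
    (jacobian x x' y).det = (fderiv ℝ (transition x x') y).det := by
  rw [ContinuousLinearMap.det, ← LinearMap.det_toMatrix (EuclideanSpace.basisFun (Fin n) ℝ).toBasis]
  congr 1

/-- The determinant of Jᵀ g' J is positive, so J cannot be singular. -/
theorem det_jacobian_ne_zero (g : Metric n M) {x x' : M} {y : EuclideanSpace ℝ (Fin n)}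
    (hy : y ∈ overlap x x') : (jacobian x x' y).det ≠ 0 := by
  have h := (posDef_metricMatrix g x hy.1).det_pos
  rw [metricMatrix_eq g hy] at h
  intro h0
  simp [h0] at h

/-- Here det g = (det J)² det g'. The factor |det J| is the one of the change of variables formula.
-/
theorem sqrtDet_eq (g : Metric n M) {x x' : M} {y : EuclideanSpace ℝ (Fin n)}
    (hy : y ∈ overlap x x') :
    sqrtDet g x y = |(fderiv ℝ (transition x x') y).det| * sqrtDet g x' (transition x x' y) := by
  rw [sqrtDet, metricMatrix_eq g hy, Matrix.det_mul, Matrix.det_mul, Matrix.det_transpose,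
    mul_comm _ (jacobian x x' y).det, ← mul_assoc, Real.sqrt_mul (mul_self_nonneg _),
    Real.sqrt_mul_self_eq_abs, det_jacobian, sqrtDet]

theorem sqrtDet_pos (g : Metric n M) (x : M) {y : EuclideanSpace ℝ (Fin n)}
    (hy : y ∈ (extChartAt (𝓡 n) x).target) : 0 < sqrtDet g x y :=
  Real.sqrt_pos.2 (posDef_metricMatrix g x hy).det_pos

theorem contDiffOn_det {X : Type*} [NormedAddCommGroup X] [NormedSpace ℝ X] {S : Set X}
    {A : X → Matrix (Fin n) (Fin n) ℝ} (hA : ∀ i j, ContDiffOn ℝ ∞ (fun y => A y i j) S) :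
    ContDiffOn ℝ ∞ (fun y => (A y).det) S := by
  simp only [Matrix.det_apply]
  refine ContDiffOn.sum fun σ _ => ContDiffOn.const_smul _ (contDiffOn_prod fun i _ => hA _ _)

/-- Cramer's rule: the entries of the inverse are quotients of determinants. -/
theorem contDiffOn_inv {X : Type*} [NormedAddCommGroup X] [NormedSpace ℝ X] {S : Set X}
    {A : X → Matrix (Fin n) (Fin n) ℝ} (hA : ∀ i j, ContDiffOn ℝ ∞ (fun y => A y i j) S)
    (h0 : ∀ y ∈ S, (A y).det ≠ 0) (i j : Fin n) :
    ContDiffOn ℝ ∞ (fun y => (A y)⁻¹ i j) S := by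
  simp only [Matrix.inv_def, Matrix.smul_apply, Ring.inverse_eq_inv', smul_eq_mul,
    Matrix.adjugate_apply]
  refine ((contDiffOn_det hA).inv h0).mul (contDiffOn_det fun k l => ?_)
  -- The adjugate entry is a determinant in which row `j` has been replaced by a constant vector.
  rcases eq_or_ne k j with rfl | h
  · simpa using contDiffOn_const
  · simpa [Matrix.updateRow_ne h] using hA k l

theorem contDiffOn_sqrtDet (g : Metric n M) (x : M) :
    ContDiffOn ℝ ∞ (sqrtDet g x) (extChartAt (𝓡 n) x).target :=
  (contDiffOn_det (contDiffOn_metricMatrix g x)).sqrt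
    fun _ hy => (posDef_metricMatrix g x hy).det_pos.ne'

theorem contDiffOn_metricMatrix_inv (g : Metric n M) (x : M) (i j : Fin n) :
    ContDiffOn ℝ ∞ (fun y => (metricMatrix g x y)⁻¹ i j) (extChartAt (𝓡 n) x).target :=
  contDiffOn_inv (contDiffOn_metricMatrix g x)
    (fun _ hy => (posDef_metricMatrix g x hy).det_pos.ne') i j

/-- The gradient of `u` in the chart around `x`. -/
def chartGrad (x : M) (u : M → ℝ) (y : EuclideanSpace ℝ (Fin n)) : Fin n → ℝ :=
  fun i => partialDeriv i (u ∘ (extChartAt (𝓡 n) x).symm) y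

theorem contDiffOn_comp_symm {u : M → ℝ} (hu : ContMDiff (𝓡 n) 𝓘(ℝ, ℝ) ∞ u) (x : M) :
    ContDiffOn ℝ ∞ (u ∘ (extChartAt (𝓡 n) x).symm) (extChartAt (𝓡 n) x).target :=
  contMDiffOn_iff_contDiffOn.1 (hu.comp_contMDiffOn (contMDiffOn_extChartAt_symm x))

theorem differentiableAt_comp_symm {u : M → ℝ} (hu : ContMDiff (𝓡 n) 𝓘(ℝ, ℝ) ∞ u) (x : M)
    {y : EuclideanSpace ℝ (Fin n)} (hy : y ∈ (extChartAt (𝓡 n) x).target) :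
    DifferentiableAt ℝ (u ∘ (extChartAt (𝓡 n) x).symm) y :=
  ((contDiffOn_comp_symm hu x).contDiffAt ((isOpen_target x).mem_nhds hy)).differentiableAt
    (by simp)

theorem chartGrad_eq {u : M → ℝ} (hu : ContMDiff (𝓡 n) 𝓘(ℝ, ℝ) ∞ u) {x x' : M}
    {y : EuclideanSpace ℝ (Fin n)} (hy : y ∈ overlap x x') :
    chartGrad x u y =
      (jacobian x x' y).transpose.mulVec (chartGrad x' u (transition x x' y)) := by
  ext i
  have h1 : u ∘ (extChartAt (𝓡 n) x).symm =ᶠ[𝓝 y]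
      (u ∘ (extChartAt (𝓡 n) x').symm) ∘ transition x x' := by
    filter_upwards [(isOpen_overlap x x').mem_nhds hy] with z hz
    simp only [Function.comp_apply, symm_transition hz]
  have h2 := (differentiableAt_comp_symm hu x' (transition_mem_target hy)).hasFDerivAt.comp y
    (differentiableAt_transition hy).hasFDerivAt
  rw [chartGrad, partialDeriv, (h2.congr_of_eventuallyEq h1).fderiv,
    ContinuousLinearMap.comp_apply, euclidean_eq_sum (fderiv ℝ (transition x x') y _)]
  simp [map_sum, Matrix.mulVec, dotProduct, jacobian, chartGrad, partialDeriv]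

/-- The scalar product of gradients, computed in the chart around `x`. -/
def chartGradInner (g : Metric n M) (x : M) (u v : M → ℝ) (y : EuclideanSpace ℝ (Fin n)) : ℝ :=
  chartGrad x u y ⬝ᵥ (metricMatrix g x y)⁻¹.mulVec (chartGrad x v y)

/-- Gradients transform by Jᵀ and the inverse metric by J⁻¹ on the left and its transpose on the
right, so the Jacobians cancel. -/
theorem chartGradInner_transition (g : Metric n M) {u v : M → ℝ}
    (hu : ContMDiff (𝓡 n) 𝓘(ℝ, ℝ) ∞ u) (hv : ContMDiff (𝓡 n) 𝓘(ℝ, ℝ) ∞ v) {x x' : M}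
    {y : EuclideanSpace ℝ (Fin n)} (hy : y ∈ overlap x x') :
    chartGradInner g x u v y = chartGradInner g x' u v (transition x x' y) := by
  have hJ : IsUnit (jacobian x x' y).det := (det_jacobian_ne_zero g hy).isUnit
  have hJt : IsUnit (jacobian x x' y).transpose.det := by rwa [Matrix.det_transpose]
  rw [chartGradInner, chartGradInner, metricMatrix_eq g hy, chartGrad_eq hu hy, chartGrad_eq hv hy,
    Matrix.mul_inv_rev, Matrix.mul_inv_rev, Matrix.mulVec_mulVec, Matrix.mul_assoc,
    Matrix.mul_assoc, Matrix.nonsing_inv_mul _ hJt, Matrix.mul_one, Matrix.mulVec_transpose,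
    ← Matrix.dotProduct_mulVec, Matrix.mulVec_mulVec, Matrix.mul_nonsing_inv_cancel_left _ _ hJ]

/-- `gradInner` is defined at each point in the chart around that point; invariance allows a single
chart to be used on its whole domain. -/
theorem gradInner_eq (g : Metric n M) {u v : M → ℝ} (hu : ContMDiff (𝓡 n) 𝓘(ℝ, ℝ) ∞ u)
    (hv : ContMDiff (𝓡 n) 𝓘(ℝ, ℝ) ∞ v) (x : M) {y : EuclideanSpace ℝ (Fin n)}
    (hy : y ∈ (extChartAt (𝓡 n) x).target) :
    gradInner g u v ((extChartAt (𝓡 n) x).symm y) = chartGradInner g x u v y := by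
  set p := (extChartAt (𝓡 n) x).symm y
  have h1 : y ∈ overlap x p := ⟨hy, mem_extChartAt_source p⟩
  rw [chartGradInner_transition g hu hv h1]
  have : transition x p y = extChartAt (𝓡 n) p p := rfl
  rw [this, chartGradInner, gradInner]
  simp only [dotProduct, Matrix.mulVec, chartGrad, Finset.mul_sum]
  refine Finset.sum_congr rfl fun i _ => Finset.sum_congr rfl fun j _ => ?_
  ring

end Transition

section Density

variable {n : ℕ} {M : Type*} [TopologicalSpace M]
  [ChartedSpace (EuclideanSpace ℝ (Fin n)) M] [IsManifold (𝓡 n) ∞ M]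

/-- The density of the weighted measure in the chart around `x`. -/
def chartDensity (g : Metric n M) (V : M → ℝ) (x : M) (y : EuclideanSpace ℝ (Fin n)) : ℝ :=
  sqrtDet g x y * Real.exp (-V ((extChartAt (𝓡 n) x).symm y))

theorem contDiffOn_chartDensity (g : Metric n M) {V : M → ℝ}
    (hV : ContMDiff (𝓡 n) 𝓘(ℝ, ℝ) ∞ V) (x : M) :
    ContDiffOn ℝ ∞ (chartDensity g V x) (extChartAt (𝓡 n) x).target :=
  (contDiffOn_sqrtDet g x).mul ((contDiffOn_comp_symm hV x).neg.exp)

theorem chartDensity_pos (g : Metric n M) (V : M → ℝ) (x : M) {y : EuclideanSpace ℝ (Fin n)}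
    (hy : y ∈ (extChartAt (𝓡 n) x).target) : 0 < chartDensity g V x y :=
  mul_pos (sqrtDet_pos g x hy) (Real.exp_pos _)

end Density

/-! ### The Riemannian volume and integration in a chart. -/

section Volume

variable {n : ℕ} {M : Type*} [TopologicalSpace M]
  [ChartedSpace (EuclideanSpace ℝ (Fin n)) M] [IsManifold (𝓡 n) ∞ M]
  [MeasurableSpace M] [BorelSpace M]

theorem measurableSet_inter_preimage {X Y : Type*} [TopologicalSpace X] [MeasurableSpace X]
    [OpensMeasurableSpace X] [TopologicalSpace Y] [MeasurableSpace Y] [BorelSpace Y] {f : X → Y}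
    {s : Set X} (hf : ContinuousOn f s) (hs : MeasurableSet s) {A : Set Y}
    (hA : MeasurableSet A) : MeasurableSet (s ∩ f ⁻¹' A) := by
  have h := (continuousOn_iff_continuous_domRestrict.1 hf).measurable hA
  have h2 := hs.subtype_image h
  convert h2 using 1
  ext x
  simp [and_comm]

/-- The inverse chart is continuous on the target only, whence measurability merely almost
everywhere for a measure carried by the target. -/
theorem aemeasurable_symm (g : Metric n M) (x : M) :
    AEMeasurable (extChartAt (𝓡 n) x).symm
      ((volume.restrict (extChartAt (𝓡 n) x).target).withDensity
        (fun y => ENNReal.ofReal (sqrtDet g x y))) :=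
  ((continuousOn_extChartAt_symm x).aemeasurable (isOpen_target x).measurableSet).mono_ac
    (withDensity_absolutelyContinuous _ _)

theorem chartVolume_apply (g : Metric n M) (x : M) {A : Set M} (hA : MeasurableSet A) :
    chartVolume g x A = ∫⁻ y in (extChartAt (𝓡 n) x).target ∩ (extChartAt (𝓡 n) x).symm ⁻¹' A,
      ENNReal.ofReal (sqrtDet g x y) := by
  have hm := measurableSet_inter_preimage (continuousOn_extChartAt_symm (I := 𝓡 n) x)
    (isOpen_target x).measurableSet hA
  have h0 := (aemeasurable_symm g x)
  rw [chartVolume, Measure.map_apply_of_aemeasurable h0 hA, withDensity_apply' ,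
    Measure.restrict_restrict' (isOpen_target x).measurableSet, inter_comm]

theorem chartVolume_inter_source (g : Metric n M) (x : M) {A : Set M} (hA : MeasurableSet A) :
    chartVolume g x (A ∩ (extChartAt (𝓡 n) x).source) = chartVolume g x A := by
  rw [chartVolume_apply g x (hA.inter (isOpen_extChartAt_source x).measurableSet),
    chartVolume_apply g x hA]
  congr 2
  ext y
  simp only [mem_inter_iff, mem_preimage, and_congr_right_iff, and_iff_left_iff_imp]
  exact fun hy _ => (extChartAt (𝓡 n) x).map_target hy

/-- Change of variables along the transition map, with `sqrtDet_eq` supplying the Jacobian. -/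
theorem chartVolume_compat (g : Metric n M) (x x' : M) {A : Set M} (hA : MeasurableSet A)
    (h1 : A ⊆ (extChartAt (𝓡 n) x).source) (h2 : A ⊆ (extChartAt (𝓡 n) x').source) :
    chartVolume g x A = chartVolume g x' A := by
  rw [chartVolume_apply g x hA, chartVolume_apply g x' hA]
  set S := (extChartAt (𝓡 n) x).target ∩ (extChartAt (𝓡 n) x).symm ⁻¹' A with hS
  have hSo : S ⊆ overlap x x' := fun y hy => ⟨hy.1, h2 hy.2⟩
  have hSm : MeasurableSet S := measurableSet_inter_preimage
    (continuousOn_extChartAt_symm (I := 𝓡 n) x) (isOpen_target x).measurableSet hA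
  have himg : (extChartAt (𝓡 n) x').target ∩ (extChartAt (𝓡 n) x').symm ⁻¹' A =
      transition x x' '' S := by
    ext z
    constructor
    · rintro ⟨hz, hzA⟩
      have hz' : z ∈ overlap x' x := ⟨hz, h1 hzA⟩
      refine ⟨transition x' x z, ⟨transition_mem_target hz', ?_⟩, transition_transition hz'⟩
      rw [mem_preimage, symm_transition hz']; exact hzA
    · rintro ⟨y, hy, rfl⟩
      refine ⟨transition_mem_target (hSo hy), ?_⟩
      rw [mem_preimage, symm_transition (hSo hy)]; exact hy.2
  rw [himg, lintegral_image_eq_lintegral_abs_det_fderiv_mul volume hSm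
    (fun y hy => (differentiableAt_transition (hSo hy)).hasFDerivAt.hasFDerivWithinAt)
    ((injOn_transition x x').mono hSo)]
  refine setLIntegral_congr_fun hSm fun y hy => ?_
  rw [sqrtDet_eq g (hSo hy), ENNReal.ofReal_mul (abs_nonneg _)]

variable [CompactSpace M] [Nonempty M]

theorem exists_countable_chart_cover :
    ∃ c : ℕ → M, ⋃ k, (extChartAt (𝓡 n) (c k)).source = univ := by
  obtain ⟨t, ht, hU⟩ := countable_cover_nhds_of_sigmaCompact
    (f := fun x : M => (extChartAt (𝓡 n) x).source) (fun x => extChartAt_source_mem_nhds x)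
  have hne : t.Nonempty := by
    by_contra h
    rw [not_nonempty_iff_eq_empty] at h
    simp [h] at hU
    exact (univ_nonempty (α := M)).ne_empty hU.symm
  obtain ⟨c, hc⟩ := ht.exists_eq_range hne
  refine ⟨c, ?_⟩
  rw [← hU, hc]
  simp

/-- The chart volumes are the restrictions of the Riemannian volume. -/
theorem restrict_riemannianVolume (g : Metric n M) (x : M) :
    (riemannianVolume g).restrict (extChartAt (𝓡 n) x).source = chartVolume g x := by
  obtain ⟨c, hc⟩ := exists_countable_chart_cover (n := n) (M := M)
  set D := disjointed fun k => (extChartAt (𝓡 n) (c k)).source with hD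
  have hDm : ∀ k, MeasurableSet (D k) := fun k =>
    MeasurableSet.disjointed (fun k => (isOpen_extChartAt_source (c k)).measurableSet) k
  have hDs : ∀ k, D k ⊆ (extChartAt (𝓡 n) (c k)).source := fun k => disjointed_le _ k
  have hDd : Pairwise (Function.onFun Disjoint D) := disjoint_disjointed _
  have hDu : ⋃ k, D k = univ := by rw [hD, iUnion_disjointed, hc]
  have key : ∀ (m : Measure M) {A : Set M}, MeasurableSet A → m A = ∑' k, m (A ∩ D k) := by
    intro m A hA
    rw [← measure_iUnion (fun i j hij => (hDd hij).mono inter_subset_right inter_subset_right)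
      (fun k => hA.inter (hDm k)), ← inter_iUnion, hDu, inter_univ]
  -- The chart volumes are glued along a countable partition subordinate to chart domains. The glued
  -- measure restricts to every chart volume, hence dominates their supremum; on each piece it is
  -- itself a chart volume, hence is dominated by the supremum.
  set ν : Measure M := Measure.sum fun k => (chartVolume g (c k)).restrict (D k) with hν
  have hνA : ∀ {A : Set M}, MeasurableSet A → ν A = ∑' k, chartVolume g (c k) (A ∩ D k) := by
    intro A hA
    rw [hν, Measure.sum_apply _ hA]
    exact tsum_congr fun k => Measure.restrict_apply hA
  have hres : ∀ x, ν.restrict (extChartAt (𝓡 n) x).source = chartVolume g x := by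
    intro x
    have hs := (isOpen_extChartAt_source (I := 𝓡 n) x).measurableSet
    ext A hA
    rw [Measure.restrict_apply hA, hνA (hA.inter hs), ← chartVolume_inter_source g x hA,
      key (chartVolume g x) (hA.inter hs)]
    refine tsum_congr fun k => chartVolume_compat g _ _ ((hA.inter hs).inter (hDm k))
      (inter_subset_right.trans (hDs k)) (inter_subset_left.trans inter_subset_right)
  have hle : riemannianVolume g ≤ ν := iSup_le fun x => (hres x).symm.le.trans Measure.restrict_le_self
  have hge : ν ≤ riemannianVolume g := by
    rw [Measure.le_iff]
    intro A hA
    rw [hνA hA, key (riemannianVolume g) hA]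
    refine ENNReal.tsum_le_tsum fun k => ?_
    exact (Measure.le_iff'.1 (le_iSup (fun x => chartVolume g x) (c k))) _
  rw [le_antisymm hle hge, hres]

theorem setIntegral_source (g : Metric n M) {V : M → ℝ} (hV : Continuous V) (x : M) (f : M → ℝ)
    (hf : AEStronglyMeasurable f (chartVolume g x)) :
    ∫ p in (extChartAt (𝓡 n) x).source, f p ∂(weightedMeasure g V) =
      ∫ y in (extChartAt (𝓡 n) x).target,
        chartDensity g V x y * f ((extChartAt (𝓡 n) x).symm y) := by
  have hT := (isOpen_target (n := n) x).measurableSet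
  have hexp : Measurable fun p => ENNReal.ofReal (Real.exp (-V p)) := by
    have := hV.measurable; fun_prop
  have hexpc : Continuous fun p => Real.exp (-V p) := by fun_prop
  rw [weightedMeasure, restrict_withDensity (isOpen_extChartAt_source x).measurableSet,
    restrict_riemannianVolume, integral_withDensity_eq_integral_toReal_smul hexp
      (ae_of_all _ fun _ => ENNReal.ofReal_lt_top)]
  rw [chartVolume, integral_map (aemeasurable_symm g x)]
  · rw [integral_withDensity_eq_integral_toReal_smul₀]
    · refine setIntegral_congr_fun hT fun y hy => ?_
      simp only [ENNReal.toReal_ofReal (sqrtDet_pos g x hy).le,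
        ENNReal.toReal_ofReal (Real.exp_pos _).le, smul_eq_mul, chartDensity]
      ring
    · exact ((contDiffOn_sqrtDet g x).continuousOn.aemeasurable hT).ennreal_ofReal
    · exact ae_of_all _ fun _ => ENNReal.ofReal_lt_top
  · exact (hexp.ennreal_toReal.aestronglyMeasurable).smul hf

theorem isProbabilityMeasure_weightedMeasure (g : Metric n M) {V : M → ℝ}
    (hV1 : ∫ x, Real.exp (-V x) ∂(riemannianVolume g) = 1) :
    IsProbabilityMeasure (weightedMeasure g V) := by
  -- A non-integrable function has integral 0 by convention, so the normalization forces
  -- integrability.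
  have hint : Integrable (fun x => Real.exp (-V x)) (riemannianVolume g) := by
    by_contra h
    rw [integral_undef h] at hV1
    exact zero_ne_one hV1
  constructor
  rw [weightedMeasure, withDensity_apply _ MeasurableSet.univ, Measure.restrict_univ,
    ← ofReal_integral_eq_lintegral_ofReal hint (ae_of_all _ fun _ => (Real.exp_pos _).le), hV1,
    ENNReal.ofReal_one]

end Volume

/-! ### Partial derivatives and integration by parts in ℝⁿ. -/

section Euclidean

variable {n : ℕ}

theorem contDiffOn_partialDeriv {S : Set (EuclideanSpace ℝ (Fin n))} (hS : IsOpen S)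
    {u : EuclideanSpace ℝ (Fin n) → ℝ} (hu : ContDiffOn ℝ ∞ u S) (i : Fin n) :
    ContDiffOn ℝ ∞ (partialDeriv i u) S :=
  (hu.fderiv_of_isOpen hS (by simp)).clm_apply contDiffOn_const

theorem differentiableAt_of_contDiffOn {X Y : Type*} [NormedAddCommGroup X] [NormedSpace ℝ X]
    [NormedAddCommGroup Y] [NormedSpace ℝ Y] {S : Set X} (hS : IsOpen S) {u : X → Y}
    (hu : ContDiffOn ℝ ∞ u S) {y : X} (hy : y ∈ S) : DifferentiableAt ℝ u y :=
  (hu.contDiffAt (hS.mem_nhds hy)).differentiableAt (by simp)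

theorem partialDeriv_mul (i : Fin n) {u v : EuclideanSpace ℝ (Fin n) → ℝ}
    {y : EuclideanSpace ℝ (Fin n)} (hu : DifferentiableAt ℝ u y) (hv : DifferentiableAt ℝ v y) :
    partialDeriv i (fun z => u z * v z) y = u y * partialDeriv i v y + v y * partialDeriv i u y := by
  simp only [partialDeriv]
  rw [fderiv_fun_mul hu hv]
  simp

theorem partialDeriv_add (i : Fin n) {u v : EuclideanSpace ℝ (Fin n) → ℝ}
    {y : EuclideanSpace ℝ (Fin n)} (hu : DifferentiableAt ℝ u y) (hv : DifferentiableAt ℝ v y) :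
    partialDeriv i (fun z => u z + v z) y = partialDeriv i u y + partialDeriv i v y := by
  simp only [partialDeriv]
  rw [fderiv_fun_add hu hv]
  simp

theorem partialDeriv_sum {ι : Type*} (s : Finset ι) (i : Fin n)
    {u : ι → EuclideanSpace ℝ (Fin n) → ℝ} {y : EuclideanSpace ℝ (Fin n)}
    (hu : ∀ k ∈ s, DifferentiableAt ℝ (u k) y) :
    partialDeriv i (fun z => ∑ k ∈ s, u k z) y = ∑ k ∈ s, partialDeriv i (u k) y := by
  simp only [partialDeriv]
  rw [fderiv_fun_sum hu]
  simp

theorem partialDeriv_congr (i : Fin n) {u v : EuclideanSpace ℝ (Fin n) → ℝ}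
    {y : EuclideanSpace ℝ (Fin n)} (h : u =ᶠ[𝓝 y] v) :
    partialDeriv i u y = partialDeriv i v y := by
  rw [partialDeriv, partialDeriv, h.fderiv_eq]

theorem tsupport_partialDeriv_subset (i : Fin n) (η : EuclideanSpace ℝ (Fin n) → ℝ) :
    tsupport (partialDeriv i η) ⊆ tsupport η := by
  refine closure_minimal (fun y hy => ?_) (isClosed_tsupport _)
  refine support_fderiv_subset ℝ ?_
  rw [Function.mem_support] at hy ⊢
  intro h0
  exact hy (by rw [partialDeriv, h0]; simp)

theorem continuous_mul_of_tsupport_subset {X : Type*} [TopologicalSpace X] {S : Set X}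
    (hS : IsOpen S) {η G : X → ℝ} (hη : Continuous η) (hs : tsupport η ⊆ S)
    (hG : ContinuousOn G S) : Continuous fun y => η y * G y := by
  refine continuous_of_tsupport fun y hy => ?_
  have hyS : y ∈ S := hs (closure_mono (fun z hz => left_ne_zero_of_mul hz) hy)
  exact hη.continuousAt.mul (hG.continuousAt (hS.mem_nhds hyS))

/-- `G` is controlled on `S` only, but every product with `η` or its derivatives vanishes off a
compact subset of `S`, so the integrals may be taken over the whole space. -/
theorem setIntegral_mul_partialDeriv {S : Set (EuclideanSpace ℝ (Fin n))} (hS : IsOpen S)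
    {η G : EuclideanSpace ℝ (Fin n) → ℝ} (hη : ContDiff ℝ ∞ η) (hc : HasCompactSupport η)
    (hs : tsupport η ⊆ S) (hG : ContDiffOn ℝ ∞ G S) (i : Fin n) :
    ∫ y in S, η y * partialDeriv i G y = -∫ y in S, partialDeriv i η y * G y := by
  have hdη : Continuous (partialDeriv i η) :=
    continuousOn_univ.1 (contDiffOn_partialDeriv isOpen_univ hη.contDiffOn i).continuousOn
  have hsd := (tsupport_partialDeriv_subset i η).trans hs
  have hcd : HasCompactSupport (partialDeriv i η) :=
    hc.of_isClosed_subset (isClosed_tsupport _) (tsupport_partialDeriv_subset i η)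
  have hint : ∀ {a b : EuclideanSpace ℝ (Fin n) → ℝ}, Continuous a → HasCompactSupport a →
      tsupport a ⊆ S → ContinuousOn b S → Integrable (fun y => a y * b y) volume := by
    intro a b ha hac has hb
    exact (continuous_mul_of_tsupport_subset hS ha has hb).integrable_of_hasCompactSupport
      hac.mul_right
  have hzero : ∀ {a b : EuclideanSpace ℝ (Fin n) → ℝ}, tsupport a ⊆ S →
      ∫ y in S, a y * b y = ∫ y, a y * b y := by
    intro a b ha
    refine setIntegral_eq_integral_of_forall_compl_eq_zero fun y hy => ?_
    rw [image_eq_zero_of_notMem_tsupport (fun h => hy (ha h)), zero_mul]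
  rw [hzero hs, hzero hsd]
  exact integral_mul_fderiv_eq_neg_fderiv_mul_of_integrable
    (hint hdη hcd hsd hG.continuousOn)
    (hint hη.continuous hc hs (contDiffOn_partialDeriv hS hG i).continuousOn)
    (hint hη.continuous hc hs hG.continuousOn)
    (fun y _ => (hη.differentiable (by simp)) y)
    (fun y hy => differentiableAt_of_contDiffOn hS hG (hs hy))

end Euclidean

/-! ### The generator in divergence form. -/

section Generator

variable {n : ℕ} {M : Type*} [TopologicalSpace M]
  [ChartedSpace (EuclideanSpace ℝ (Fin n)) M] [IsManifold (𝓡 n) ∞ M]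

/-- The flux `W ∑ⱼ g^{ij} ∂ⱼ u` in the chart around `x`, where `W` is the density of the weighted
measure. -/
def chartFlux (g : Metric n M) (V : M → ℝ) (x : M) (u : M → ℝ) (i : Fin n)
    (y : EuclideanSpace ℝ (Fin n)) : ℝ :=
  chartDensity g V x y * ∑ j, (metricMatrix g x y)⁻¹ i j * chartGrad x u y j

/-- The generator in the chart around `x`, in divergence form. -/
def chartGenerator (g : Metric n M) (V : M → ℝ) (x : M) (u : M → ℝ)
    (y : EuclideanSpace ℝ (Fin n)) : ℝ :=
  (chartDensity g V x y)⁻¹ * ∑ i, partialDeriv i (chartFlux g V x u i) y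

variable {g : Metric n M} {V : M → ℝ} {u v : M → ℝ}

theorem contDiffOn_chartGrad (hu : ContMDiff (𝓡 n) 𝓘(ℝ, ℝ) ∞ u) (x : M) (j : Fin n) :
    ContDiffOn ℝ ∞ (fun y => chartGrad x u y j) (extChartAt (𝓡 n) x).target :=
  contDiffOn_partialDeriv (isOpen_target x) (contDiffOn_comp_symm hu x) j

theorem contDiffOn_chartFlux (hV : ContMDiff (𝓡 n) 𝓘(ℝ, ℝ) ∞ V)
    (hu : ContMDiff (𝓡 n) 𝓘(ℝ, ℝ) ∞ u) (x : M) (i : Fin n) :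
    ContDiffOn ℝ ∞ (chartFlux g V x u i) (extChartAt (𝓡 n) x).target :=
  (contDiffOn_chartDensity g hV x).mul (ContDiffOn.sum fun j _ =>
    (contDiffOn_metricMatrix_inv g x i j).mul (contDiffOn_chartGrad hu x j))

theorem contDiffOn_chartGenerator (hV : ContMDiff (𝓡 n) 𝓘(ℝ, ℝ) ∞ V)
    (hu : ContMDiff (𝓡 n) 𝓘(ℝ, ℝ) ∞ u) (x : M) :
    ContDiffOn ℝ ∞ (chartGenerator g V x u) (extChartAt (𝓡 n) x).target :=
  ((contDiffOn_chartDensity g hV x).inv fun _ hy => (chartDensity_pos g V x hy).ne').mul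
    (ContDiffOn.sum fun i _ =>
      contDiffOn_partialDeriv (isOpen_target x) (contDiffOn_chartFlux hV hu x i) i)

/-- In W⁻¹ ∂ᵢ (W g^{ij} ∂ⱼ u) with W = √(det g) e^{-V}, the derivative of e^{-V} produces the drift
-∇V·∇u. Only the point around which the chart is taken is reached, because `laplaceBeltrami` is
defined pointwise in that chart. -/
theorem diffusionGenerator_eq_chartGenerator (hV : ContMDiff (𝓡 n) 𝓘(ℝ, ℝ) ∞ V)
    (hu : ContMDiff (𝓡 n) 𝓘(ℝ, ℝ) ∞ u) (p : M) :
    diffusionGenerator g V u p = chartGenerator g V p u (extChartAt (𝓡 n) p p) := by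
  set y := extChartAt (𝓡 n) p p
  have hy : y ∈ (extChartAt (𝓡 n) p).target := mem_extChartAt_target p
  set E : EuclideanSpace ℝ (Fin n) → ℝ :=
    fun y => Real.exp (-V ((extChartAt (𝓡 n) p).symm y)) with hE
  set H : Fin n → EuclideanSpace ℝ (Fin n) → ℝ := fun i y =>
    sqrtDet g p y * ∑ j, (metricMatrix g p y)⁻¹ i j * chartGrad p u y j with hH
  have hHd : ∀ i, DifferentiableAt ℝ (H i) y := fun i =>
    differentiableAt_of_contDiffOn (isOpen_target p)
      ((contDiffOn_sqrtDet g p).mul (ContDiffOn.sum fun j _ =>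
        (contDiffOn_metricMatrix_inv g p i j).mul (contDiffOn_chartGrad hu p j))) hy
  have hVd := differentiableAt_comp_symm hV p hy
  have hEd : DifferentiableAt ℝ E y := hVd.neg.exp
  have hdE : ∀ i, partialDeriv i E y = -E y * chartGrad p V y i := by
    intro i
    have h : HasFDerivAt E _ y := hVd.hasFDerivAt.neg.exp
    rw [partialDeriv, h.fderiv]
    simp [hE, chartGrad, partialDeriv]
  have hflux : ∀ i, chartFlux g V p u i = fun y => E y * H i y := by
    intro i; funext y; simp only [chartFlux, chartDensity, hE, hH]; ring
  have hs : sqrtDet g p y ≠ 0 := (sqrtDet_pos g p hy).ne'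
  have hEp : E y ≠ 0 := (Real.exp_pos _).ne'
  have hW : chartDensity g V p y = sqrtDet g p y * E y := rfl
  rw [chartGenerator, hW]
  simp only [hflux, partialDeriv_mul _ hEd (hHd _), hdE]
  rw [diffusionGenerator, laplaceBeltrami, gradInner, Finset.sum_add_distrib, mul_add, mul_inv,
    ← Finset.mul_sum, sub_eq_add_neg]
  congr 1
  · change (sqrtDet g p y)⁻¹ * ∑ i, partialDeriv i (H i) y = _
    field_simp
  · rw [Finset.mul_sum, ← Finset.sum_neg_distrib]
    refine Finset.sum_congr rfl fun i _ => ?_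
    simp only [hH]
    change -(∑ j, (metricMatrix g p y)⁻¹ i j * chartGrad p V y i * chartGrad p u y j) = _
    have : ∑ j, (metricMatrix g p y)⁻¹ i j * chartGrad p V y i * chartGrad p u y j =
        chartGrad p V y i * ∑ j, (metricMatrix g p y)⁻¹ i j * chartGrad p u y j := by
      rw [Finset.mul_sum]
      exact Finset.sum_congr rfl fun j _ => by ring
    rw [this]
    field_simp

theorem continuousOn_chartGradInner (hu : ContMDiff (𝓡 n) 𝓘(ℝ, ℝ) ∞ u)
    (hv : ContMDiff (𝓡 n) 𝓘(ℝ, ℝ) ∞ v) (x : M) :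
    ContinuousOn (chartGradInner g x u v) (extChartAt (𝓡 n) x).target := by
  unfold chartGradInner
  simp only [dotProduct, Matrix.mulVec]
  refine continuousOn_finsetSum _ fun i _ => (contDiffOn_chartGrad hu x i).continuousOn.mul
    (continuousOn_finsetSum _ fun j _ => (contDiffOn_metricMatrix_inv g x i j).continuousOn.mul
      (contDiffOn_chartGrad hv x j).continuousOn)

theorem continuous_of_chart {f : M → ℝ} {F : M → EuclideanSpace ℝ (Fin n) → ℝ}
    (hF : ∀ x, ContinuousOn (F x) (extChartAt (𝓡 n) x).target)
    (h : ∀ x, ∀ y ∈ (extChartAt (𝓡 n) x).target, f ((extChartAt (𝓡 n) x).symm y) = F x y) :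
    Continuous f := by
  rw [continuous_iff_continuousAt]
  intro x
  have h1 : ContinuousAt (F x ∘ extChartAt (𝓡 n) x) x :=
    ((hF x).continuousAt (extChartAt_target_mem_nhds x)).comp (continuousAt_extChartAt x)
  refine h1.congr ?_
  filter_upwards [extChartAt_source_mem_nhds (I := 𝓡 n) x] with p hp
  rw [Function.comp_apply, ← h x _ ((extChartAt (𝓡 n) x).map_source hp),
    (extChartAt (𝓡 n) x).left_inv hp]

theorem continuous_gradInner (hu : ContMDiff (𝓡 n) 𝓘(ℝ, ℝ) ∞ u)
    (hv : ContMDiff (𝓡 n) 𝓘(ℝ, ℝ) ∞ v) : Continuous (gradInner g u v) :=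
  continuous_of_chart (continuousOn_chartGradInner hu hv) fun x _ hy => gradInner_eq g hu hv x hy

theorem gradInner_eq_zero_of_eventuallyEq {p : M} (h : u =ᶠ[𝓝 p] fun _ => 0) :
    gradInner g u v p = 0 := by
  rw [gradInner]
  refine Finset.sum_eq_zero fun i _ => Finset.sum_eq_zero fun j _ => ?_
  have h2 : u ∘ (extChartAt (𝓡 n) p).symm =ᶠ[𝓝 (extChartAt (𝓡 n) p p)] fun _ => 0 := by
    have := (continuousAt_extChartAt_symm (I := 𝓡 n) p).tendsto
    rw [extChartAt_to_inv] at this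
    exact this.eventually h
  rw [partialDeriv_congr i h2]
  simp [partialDeriv]

end Generator

/-! ### Transfer of cut-off functions between a chart and the manifold. -/

section Bridge

variable {n : ℕ} {M : Type*} [TopologicalSpace M] [T2Space M]
  [ChartedSpace (EuclideanSpace ℝ (Fin n)) M] [IsManifold (𝓡 n) ∞ M]

/-- Extension by zero is smooth because the image of the support is compact, hence closed in ℝⁿ, so
that the function vanishes near every point outside the target. -/
theorem exists_contDiff_of_tsupport_subset_source [CompactSpace M] {χ : M → ℝ}
    (hχ : ContMDiff (𝓡 n) 𝓘(ℝ, ℝ) ∞ χ) {x : M} (hs : tsupport χ ⊆ (extChartAt (𝓡 n) x).source) :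
    ∃ η : EuclideanSpace ℝ (Fin n) → ℝ, ContDiff ℝ ∞ η ∧ HasCompactSupport η ∧
      tsupport η ⊆ (extChartAt (𝓡 n) x).target ∧
      EqOn η (χ ∘ (extChartAt (𝓡 n) x).symm) (extChartAt (𝓡 n) x).target := by
  set K := extChartAt (𝓡 n) x '' tsupport χ with hK
  have hKc : IsCompact K := (isClosed_tsupport χ).isCompact.image_of_continuousOn
    ((continuousOn_extChartAt x).mono hs)
  have hKt : K ⊆ (extChartAt (𝓡 n) x).target := by
    rintro _ ⟨p, hp, rfl⟩
    exact (extChartAt (𝓡 n) x).map_source (hs hp)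
  set η := (extChartAt (𝓡 n) x).target.indicator (χ ∘ (extChartAt (𝓡 n) x).symm) with hη
  have hsupp : Function.support η ⊆ K := by
    intro y hy
    have hyt : y ∈ (extChartAt (𝓡 n) x).target := by
      by_contra h
      exact hy (indicator_of_notMem h _)
    refine ⟨(extChartAt (𝓡 n) x).symm y, subset_tsupport _ ?_, (extChartAt (𝓡 n) x).right_inv hyt⟩
    have := Function.mem_support.1 hy
    rwa [hη, indicator_of_mem hyt] at this
  have hts : tsupport η ⊆ K := closure_minimal hsupp hKc.isClosed
  refine ⟨η, ?_, hKc.of_isClosed_subset (isClosed_tsupport _) hts, hts.trans hKt,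
    fun y hy => indicator_of_mem hy _⟩
  rw [contDiff_iff_contDiffAt]
  intro y
  by_cases hy : y ∈ (extChartAt (𝓡 n) x).target
  · refine ((contDiffOn_comp_symm hχ x).contDiffAt ((isOpen_target x).mem_nhds hy)).congr_of_eventuallyEq ?_
    filter_upwards [(isOpen_target x).mem_nhds hy] with z hz using indicator_of_mem hz _
  · refine contDiffAt_const.congr_of_eventuallyEq (f := fun _ => 0) ?_
    filter_upwards [hKc.isClosed.isOpen_compl.mem_nhds (fun h => hy (hKt h))] with z hz
    by_contra h
    exact hz (hsupp h)

/-- The same extension by zero in the other direction; the compact image of the support is closed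
because the manifold is Hausdorff. -/
theorem exists_contMDiff_of_tsupport_subset_target {η : EuclideanSpace ℝ (Fin n) → ℝ}
    (hη : ContDiff ℝ ∞ η) (hc : HasCompactSupport η) {x : M}
    (hs : tsupport η ⊆ (extChartAt (𝓡 n) x).target) :
    ∃ χ : M → ℝ, ContMDiff (𝓡 n) 𝓘(ℝ, ℝ) ∞ χ ∧
      tsupport χ ⊆ (extChartAt (𝓡 n) x).symm '' tsupport η ∧
      EqOn (χ ∘ (extChartAt (𝓡 n) x).symm) η (extChartAt (𝓡 n) x).target := by
  set K := (extChartAt (𝓡 n) x).symm '' tsupport η with hK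
  have hKc : IsCompact K := hc.isCompact.image_of_continuousOn
    ((continuousOn_extChartAt_symm x).mono hs)
  have hKt : K ⊆ (extChartAt (𝓡 n) x).source := by
    rintro _ ⟨p, hp, rfl⟩
    exact (extChartAt (𝓡 n) x).map_target (hs hp)
  set χ := (extChartAt (𝓡 n) x).source.indicator (η ∘ extChartAt (𝓡 n) x) with hχ
  have hsupp : Function.support χ ⊆ K := by
    intro p hp
    have hpt : p ∈ (extChartAt (𝓡 n) x).source := by
      by_contra h
      exact hp (indicator_of_notMem h _)
    refine ⟨extChartAt (𝓡 n) x p, subset_tsupport _ ?_, (extChartAt (𝓡 n) x).left_inv hpt⟩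
    have := Function.mem_support.1 hp
    rwa [hχ, indicator_of_mem hpt] at this
  have hts : tsupport χ ⊆ K := closure_minimal hsupp hKc.isClosed
  refine ⟨χ, ?_, hts, fun y hy => ?_⟩
  · intro p
    by_cases hp : p ∈ (extChartAt (𝓡 n) x).source
    · have h1 : ContMDiffAt (𝓡 n) 𝓘(ℝ, ℝ) ∞ (η ∘ extChartAt (𝓡 n) x) p :=
        hη.contMDiff.contMDiffAt.comp p (contMDiffAt_extChartAt' (by rwa [extChartAt_source] at hp))
      refine h1.congr_of_eventuallyEq ?_
      filter_upwards [(isOpen_extChartAt_source x).mem_nhds hp] with z hz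
        using indicator_of_mem hz _
    · refine (contMDiffAt_const (c := (0 : ℝ))).congr_of_eventuallyEq ?_
      filter_upwards [hKc.isClosed.isOpen_compl.mem_nhds (fun h => hp (hKt h))] with z hz
      by_contra h
      exact hz (hsupp h)
  · rw [Function.comp_apply, hχ, indicator_of_mem ((extChartAt (𝓡 n) x).map_target hy),
      Function.comp_apply, (extChartAt (𝓡 n) x).right_inv hy]

end Bridge

/-! ### Weak form and chart independence of the generator. -/

section Weak

variable {n : ℕ} {M : Type*} [TopologicalSpace M] [T2Space M] [CompactSpace M] [Nonempty M]
  [ChartedSpace (EuclideanSpace ℝ (Fin n)) M] [IsManifold (𝓡 n) ∞ M]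
  [MeasurableSpace M] [BorelSpace M] {g : Metric n M} {V : M → ℝ}

/-- The change of variables `y = φ(p)` for functions supported in the domain of a chart `φ`. -/
theorem integral_eq_of_tsupport_subset_source (hV : ContMDiff (𝓡 n) 𝓘(ℝ, ℝ) ∞ V) {f : M → ℝ}
    (hf : Continuous f) {x : M} (hs : tsupport f ⊆ (extChartAt (𝓡 n) x).source) :
    ∫ p, f p ∂(weightedMeasure g V) = ∫ y in (extChartAt (𝓡 n) x).target,
      chartDensity g V x y * f ((extChartAt (𝓡 n) x).symm y) := by
  have := ChartedSpace.secondCountable_of_sigmaCompact (EuclideanSpace ℝ (Fin n)) M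
  rw [← setIntegral_source g hV.continuous x f hf.aestronglyMeasurable,
    setIntegral_eq_integral_of_forall_compl_eq_zero]
  exact fun p hp => image_eq_zero_of_notMem_tsupport fun h => hp (hs h)

theorem continuous_mul_chartGenerator (hV : ContMDiff (𝓡 n) 𝓘(ℝ, ℝ) ∞ V) {χ u : M → ℝ}
    (hχ : ContMDiff (𝓡 n) 𝓘(ℝ, ℝ) ∞ χ) (hu : ContMDiff (𝓡 n) 𝓘(ℝ, ℝ) ∞ u) {x : M}
    (hs : tsupport χ ⊆ (extChartAt (𝓡 n) x).source) :
    Continuous fun p => χ p * chartGenerator g V x u (extChartAt (𝓡 n) x p) :=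
  continuous_mul_of_tsupport_subset (isOpen_extChartAt_source x) hχ.continuous hs
    ((contDiffOn_chartGenerator hV hu x).continuousOn.comp (continuousOn_extChartAt x)
      fun _ hp => (extChartAt (𝓡 n) x).map_source hp)

/-- The density W of the measure cancels the factor W⁻¹ of the divergence form, and integration by
parts applies. The right-hand side no longer depends on the chart. -/
theorem integral_mul_chartGenerator (hV : ContMDiff (𝓡 n) 𝓘(ℝ, ℝ) ∞ V) {χ u : M → ℝ}
    (hχ : ContMDiff (𝓡 n) 𝓘(ℝ, ℝ) ∞ χ) (hu : ContMDiff (𝓡 n) 𝓘(ℝ, ℝ) ∞ u) {x : M}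
    (hs : tsupport χ ⊆ (extChartAt (𝓡 n) x).source) :
    ∫ p, χ p * chartGenerator g V x u (extChartAt (𝓡 n) x p) ∂(weightedMeasure g V) =
      -∫ p, gradInner g χ u p ∂(weightedMeasure g V) := by
  have hT := isOpen_target (n := n) x
  have hs1 : tsupport (fun p => χ p * chartGenerator g V x u (extChartAt (𝓡 n) x p)) ⊆
      (extChartAt (𝓡 n) x).source :=
    (closure_mono fun z hz => left_ne_zero_of_mul hz).trans hs
  have hs2 : tsupport (gradInner g χ u) ⊆ (extChartAt (𝓡 n) x).source := by
    refine (closure_minimal (fun p hp => ?_) (isClosed_tsupport χ)).trans hs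
    by_contra h
    exact hp (gradInner_eq_zero_of_eventuallyEq (notMem_tsupport_iff_eventuallyEq.1 h))
  rw [integral_eq_of_tsupport_subset_source hV (continuous_mul_chartGenerator hV hχ hu hs) hs1,
    integral_eq_of_tsupport_subset_source hV (continuous_gradInner hχ hu) hs2]
  obtain ⟨η, hη, hηc, hηs, hηe⟩ := exists_contDiff_of_tsupport_subset_source hχ hs
  have hgrad : ∀ y ∈ (extChartAt (𝓡 n) x).target, ∀ i, partialDeriv i η y = chartGrad x χ y i := by
    intro y hy i
    refine partialDeriv_congr i ?_
    filter_upwards [hT.mem_nhds hy] with z hz using hηe hz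
  have hdη : ∀ i, Continuous (partialDeriv i η) := fun i =>
    continuousOn_univ.1 (contDiffOn_partialDeriv isOpen_univ hη.contDiffOn i).continuousOn
  have hL : ∀ y ∈ (extChartAt (𝓡 n) x).target,
      chartDensity g V x y * (χ ((extChartAt (𝓡 n) x).symm y) *
        chartGenerator g V x u (extChartAt (𝓡 n) x ((extChartAt (𝓡 n) x).symm y))) =
      ∑ i, η y * partialDeriv i (chartFlux g V x u i) y := by
    intro y hy
    have hW := (chartDensity_pos g V x hy).ne'
    rw [(extChartAt (𝓡 n) x).right_inv hy, hηe hy, chartGenerator, ← Finset.mul_sum,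
      Function.comp_apply]
    field_simp
  have hR : ∀ y ∈ (extChartAt (𝓡 n) x).target,
      chartDensity g V x y * gradInner g χ u ((extChartAt (𝓡 n) x).symm y) =
      ∑ i, partialDeriv i η y * chartFlux g V x u i y := by
    intro y hy
    rw [gradInner_eq g hχ hu x hy, chartGradInner]
    simp only [dotProduct, Matrix.mulVec, hgrad y hy, chartFlux, Finset.mul_sum]
    exact Finset.sum_congr rfl fun i _ => Finset.sum_congr rfl fun j _ => by ring
  rw [setIntegral_congr_fun hT.measurableSet hL, setIntegral_congr_fun hT.measurableSet hR,
    integral_finsetSum, integral_finsetSum, ← Finset.sum_neg_distrib]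
  · exact Finset.sum_congr rfl fun i _ =>
      setIntegral_mul_partialDeriv hT hη hηc hηs (contDiffOn_chartFlux hV hu x i) i
  · intro i _
    refine (Continuous.integrable_of_hasCompactSupport ?_ ?_).integrableOn
    · exact continuous_mul_of_tsupport_subset hT (hdη i)
        ((tsupport_partialDeriv_subset i η).trans hηs) (contDiffOn_chartFlux hV hu x i).continuousOn
    · exact HasCompactSupport.mul_right
        (hηc.of_isClosed_subset (isClosed_tsupport _) (tsupport_partialDeriv_subset i η))
  · intro i _
    refine (Continuous.integrable_of_hasCompactSupport ?_ hηc.mul_right).integrableOn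
    exact continuous_mul_of_tsupport_subset hT hη.continuous hηs
      (contDiffOn_partialDeriv hT (contDiffOn_chartFlux hV hu x i) i).continuousOn

/-- The expression of the generator in divergence form does not depend on the chart. -/
theorem chartGenerator_transition (hV : ContMDiff (𝓡 n) 𝓘(ℝ, ℝ) ∞ V) {u : M → ℝ}
    (hu : ContMDiff (𝓡 n) 𝓘(ℝ, ℝ) ∞ u) {x x' : M} {y : EuclideanSpace ℝ (Fin n)}
    (hy : y ∈ overlap x x') :
    chartGenerator g V x u y = chartGenerator g V x' u (transition x x' y) := by
  have hO := isOpen_overlap (n := n) x x'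
  set d : EuclideanSpace ℝ (Fin n) → ℝ := fun y => chartDensity g V x y *
    (chartGenerator g V x u y - chartGenerator g V x' u (transition x x' y)) with hd
  have hdc : ContinuousOn d (overlap x x') :=
    ((contDiffOn_chartDensity g hV x).continuousOn.mono inter_subset_left).mul
      (((contDiffOn_chartGenerator hV hu x).continuousOn.mono inter_subset_left).sub
        ((contDiffOn_chartGenerator hV hu x').continuousOn.comp
          (contDiffOn_transition x x').continuousOn fun _ hz => transition_mem_target hz))
  -- A test function on the overlap lifts to one supported in both chart domains; against it both
  -- chart expressions integrate to the same weak form. So `d` vanishes almost everywhere, and then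
  -- everywhere by continuity.
  have hae : ∀ᵐ z ∂volume, z ∈ overlap x x' → d z = 0 := by
    refine hO.ae_eq_zero_of_integral_contDiff_smul_eq_zero
      (hdc.locallyIntegrableOn hO.measurableSet) fun η hη hηc hηs => ?_
    obtain ⟨χ, hχ, hχs, hχe⟩ := exists_contMDiff_of_tsupport_subset_target hη hηc
      (hηs.trans inter_subset_left)
    have hχ1 : tsupport χ ⊆ (extChartAt (𝓡 n) x).source := by
      refine hχs.trans ?_
      rintro _ ⟨z, hz, rfl⟩
      exact (extChartAt (𝓡 n) x).map_target (hηs hz).1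
    have hχ2 : tsupport χ ⊆ (extChartAt (𝓡 n) x').source := by
      refine hχs.trans ?_
      rintro _ ⟨z, hz, rfl⟩
      exact (hηs hz).2
    have h1 := integral_mul_chartGenerator (g := g) hV hχ hu hχ1
    have h2 := integral_mul_chartGenerator (g := g) hV hχ hu hχ2
    have hs : ∀ F : M → ℝ, tsupport (fun p => χ p * F p) ⊆ (extChartAt (𝓡 n) x).source := fun F =>
      (closure_mono fun z hz => left_ne_zero_of_mul hz).trans hχ1
    have hc1 := continuous_mul_chartGenerator (g := g) hV hχ hu hχ1
    have hc2 := continuous_mul_chartGenerator (g := g) hV hχ hu hχ2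
    rw [integral_eq_of_tsupport_subset_source hV hc1 (hs _)] at h1
    rw [integral_eq_of_tsupport_subset_source hV hc2 (hs _), ← h1] at h2
    have hW := (contDiffOn_chartDensity g hV x).continuousOn
    have hint : ∀ {F : M → ℝ}, Continuous (fun p => χ p * F p) → IntegrableOn (fun y =>
        chartDensity g V x y * (χ ((extChartAt (𝓡 n) x).symm y) *
          F ((extChartAt (𝓡 n) x).symm y))) (extChartAt (𝓡 n) x).target := by
      intro F hF
      have hcont : Continuous fun y => η y * (chartDensity g V x y *
          F ((extChartAt (𝓡 n) x).symm y)) := by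
        refine continuous_of_tsupport fun z hz => ?_
        have hz1 : z ∈ (extChartAt (𝓡 n) x).target :=
          (hηs (closure_mono (fun z hz => left_ne_zero_of_mul hz) hz)).1
        have hm := (isOpen_target x).mem_nhds hz1
        have h3 : ContinuousAt (fun y => chartDensity g V x y *
            ((fun p => χ p * F p) ((extChartAt (𝓡 n) x).symm y))) z :=
          (hW.continuousAt hm).mul (hF.continuousAt.comp
            ((continuousOn_extChartAt_symm x).continuousAt hm))
        refine h3.congr ?_
        filter_upwards [hm] with w hw
        rw [← hχe hw, Function.comp_apply]
        ring
      refine ((hcont.integrable_of_hasCompactSupport (μ := volume)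
        hηc.mul_right).integrableOn).congr_fun (fun y hy => ?_) (isOpen_target x).measurableSet
      simp only
      rw [← hχe hy, Function.comp_apply]
      ring
    have h3 : ∫ y in (extChartAt (𝓡 n) x).target, η y • d y = 0 := by
      have h4 := sub_eq_zero.2 h2.symm
      rw [← integral_sub (hint (F := fun p => chartGenerator g V x u (extChartAt (𝓡 n) x p)) hc1)
        (hint (F := fun p => chartGenerator g V x' u (extChartAt (𝓡 n) x' p)) hc2)] at h4
      rw [← h4]
      refine setIntegral_congr_fun (isOpen_target x).measurableSet fun z hz => ?_
      simp only [hd, smul_eq_mul]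
      rw [(extChartAt (𝓡 n) x).right_inv hz, ← hχe hz, Function.comp_apply]
      simp only [transition, Function.comp_apply]
      ring
    rw [← h3, setIntegral_eq_integral_of_forall_compl_eq_zero]
    intro z hz
    rw [image_eq_zero_of_notMem_tsupport (fun h => hz (hηs h).1), zero_smul]
  have h0 : EqOn d 0 (overlap x x') := by
    refine Measure.eqOn_open_of_ae_eq (μ := volume) ?_ hO hdc continuousOn_const
    exact (ae_restrict_iff' hO.measurableSet).2 hae
  have := h0 hy
  simp only [hd, Pi.zero_apply, mul_eq_zero] at this
  rcases this with h | h
  · exact absurd h (chartDensity_pos g V x hy.1).ne'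
  · exact sub_eq_zero.1 h

end Weak

/-- The properties of the generator `L = Δ - ∇V · ∇` on which the tensorization rests: in charts
it is a second order differential operator with continuous coefficients, nonnegative leading part
and no zeroth order term, and its values have mean zero. -/
structure IsDiffusion (n : ℕ) {M : Type*} [TopologicalSpace M]
    [ChartedSpace (EuclideanSpace ℝ (Fin n)) M] [MeasurableSpace M] (μ : Measure M)
    (L : (M → ℝ) → M → ℝ) : Prop where
  chart_eq : ∀ x : M, ∃ (A : EuclideanSpace ℝ (Fin n) → Fin n → Fin n → ℝ)
    (B : EuclideanSpace ℝ (Fin n) → Fin n → ℝ),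
    (∀ i j, ContinuousOn (fun y => A y i j) (extChartAt (𝓡 n) x).target) ∧
    (∀ j, ContinuousOn (fun y => B y j) (extChartAt (𝓡 n) x).target) ∧
    (∀ y ∈ (extChartAt (𝓡 n) x).target, ∀ ξ : Fin n → ℝ, 0 ≤ ∑ i, ∑ j, A y i j * (ξ i * ξ j)) ∧
    ∀ u : M → ℝ, ContMDiff (𝓡 n) 𝓘(ℝ, ℝ) ∞ u → ∀ y ∈ (extChartAt (𝓡 n) x).target,
      L u ((extChartAt (𝓡 n) x).symm y) =
        ∑ i, ∑ j, A y i j *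
          partialDeriv i (partialDeriv j (u ∘ (extChartAt (𝓡 n) x).symm)) y +
        ∑ j, B y j * partialDeriv j (u ∘ (extChartAt (𝓡 n) x).symm) y
  integral_eq_zero : ∀ u : M → ℝ, ContMDiff (𝓡 n) 𝓘(ℝ, ℝ) ∞ u → ∫ p, L u p ∂μ = 0

/-! ### The weighted Laplacian is a diffusion. -/

section Diffusion

variable {n : ℕ} {M : Type*} [TopologicalSpace M] [T2Space M] [CompactSpace M] [Nonempty M]
  [ChartedSpace (EuclideanSpace ℝ (Fin n)) M] [IsManifold (𝓡 n) ∞ M]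
  [MeasurableSpace M] [BorelSpace M] {g : Metric n M} {V : M → ℝ}

theorem diffusionGenerator_symm (hV : ContMDiff (𝓡 n) 𝓘(ℝ, ℝ) ∞ V) {u : M → ℝ}
    (hu : ContMDiff (𝓡 n) 𝓘(ℝ, ℝ) ∞ u) (x : M) {y : EuclideanSpace ℝ (Fin n)}
    (hy : y ∈ (extChartAt (𝓡 n) x).target) :
    diffusionGenerator g V u ((extChartAt (𝓡 n) x).symm y) = chartGenerator g V x u y := by
  rw [diffusionGenerator_eq_chartGenerator hV hu]
  exact (chartGenerator_transition hV hu ⟨hy, mem_extChartAt_source _⟩).symm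

theorem continuous_diffusionGenerator (hV : ContMDiff (𝓡 n) 𝓘(ℝ, ℝ) ∞ V) {u : M → ℝ}
    (hu : ContMDiff (𝓡 n) 𝓘(ℝ, ℝ) ∞ u) : Continuous (diffusionGenerator g V u) :=
  continuous_of_chart (fun x => (contDiffOn_chartGenerator hV hu x).continuousOn)
    fun x _ hy => diffusionGenerator_symm hV hu x hy

/-- The product rule on the flux separates leading and first order coefficients, in the form that
`IsDiffusion` requires. -/
theorem chartGenerator_eq_sum (hV : ContMDiff (𝓡 n) 𝓘(ℝ, ℝ) ∞ V) {u : M → ℝ}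
    (hu : ContMDiff (𝓡 n) 𝓘(ℝ, ℝ) ∞ u) (x : M) {y : EuclideanSpace ℝ (Fin n)}
    (hy : y ∈ (extChartAt (𝓡 n) x).target) :
    chartGenerator g V x u y =
      ∑ i, ∑ j, (metricMatrix g x y)⁻¹ i j *
        partialDeriv i (partialDeriv j (u ∘ (extChartAt (𝓡 n) x).symm)) y +
      ∑ j, ((chartDensity g V x y)⁻¹ * ∑ i, partialDeriv i (fun z => chartDensity g V x z *
        (metricMatrix g x z)⁻¹ i j) y) *
          partialDeriv j (u ∘ (extChartAt (𝓡 n) x).symm) y := by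
  have hT := isOpen_target (n := n) x
  have hWA : ∀ i j, DifferentiableAt ℝ (fun z => chartDensity g V x z *
      (metricMatrix g x z)⁻¹ i j) y := fun i j => differentiableAt_of_contDiffOn hT
    ((contDiffOn_chartDensity g hV x).mul (contDiffOn_metricMatrix_inv g x i j)) hy
  have hD : ∀ j, DifferentiableAt ℝ (fun z => chartGrad x u z j) y := fun j =>
    differentiableAt_of_contDiffOn hT (contDiffOn_chartGrad hu x j) hy
  have hflux : ∀ i, chartFlux g V x u i = fun z => ∑ j, (chartDensity g V x z *
      (metricMatrix g x z)⁻¹ i j) * chartGrad x u z j := by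
    intro i; funext z
    rw [chartFlux, Finset.mul_sum]
    exact Finset.sum_congr rfl fun j _ => by ring
  have h1 : ∀ i, partialDeriv i (chartFlux g V x u i) y = ∑ j, (chartDensity g V x y *
      (metricMatrix g x y)⁻¹ i j * partialDeriv i (fun z => chartGrad x u z j) y +
        chartGrad x u y j * partialDeriv i (fun z => chartDensity g V x z *
          (metricMatrix g x z)⁻¹ i j) y) := by
    intro i
    rw [hflux, partialDeriv_sum _ _ fun j _ => (hWA i j).fun_mul (hD j)]
    exact Finset.sum_congr rfl fun j _ => partialDeriv_mul i (hWA i j) (hD j)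
  have hW := (chartDensity_pos g V x hy).ne'
  simp only [chartGenerator, h1, Finset.sum_add_distrib, mul_add]
  congr 1
  · rw [Finset.mul_sum]
    refine Finset.sum_congr rfl fun i _ => ?_
    rw [Finset.mul_sum]
    refine Finset.sum_congr rfl fun j _ => ?_
    change _ = _ * partialDeriv i (fun z => chartGrad x u z j) y
    field_simp
  · rw [Finset.sum_comm, Finset.mul_sum]
    refine Finset.sum_congr rfl fun j _ => ?_
    rw [← Finset.mul_sum]
    change _ = _ * chartGrad x u y j
    ring

/-- The gradient of the constant function 1 vanishes. -/
theorem sum_gradInner {ι : Type*} (s : Finset ι) {χ : ι → M → ℝ} {u : M → ℝ}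
    (hχ : ∀ k, ContMDiff (𝓡 n) 𝓘(ℝ, ℝ) ∞ (χ k)) (h1 : ∀ p, ∑ k ∈ s, χ k p = 1) (p : M) :
    ∑ k ∈ s, gradInner g (χ k) u p = 0 := by
  have hz : ∀ i, ∑ k ∈ s, partialDeriv i (χ k ∘ (extChartAt (𝓡 n) p).symm)
      (extChartAt (𝓡 n) p p) = 0 := by
    intro i
    rw [← partialDeriv_sum s i fun k _ =>
      differentiableAt_comp_symm (hχ k) p (mem_extChartAt_target p)]
    simp [h1, partialDeriv]
  simp only [gradInner]
  rw [Finset.sum_comm]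
  refine Finset.sum_eq_zero fun i _ => ?_
  rw [Finset.sum_comm]
  refine Finset.sum_eq_zero fun j _ => ?_
  rw [← Finset.sum_mul, ← Finset.mul_sum, hz, mul_zero, zero_mul]

/-- A partition of unity χ_k subordinate to charts, with finitely many nonzero members by
compactness, gives ∫ Lu = ∑ ∫ χ_k Lu = -∑ ∫ ∇χ_k·∇u, and the last sum vanishes. -/
theorem integral_diffusionGenerator [IsFiniteMeasure (weightedMeasure g V)]
    (hV : ContMDiff (𝓡 n) 𝓘(ℝ, ℝ) ∞ V) {u : M → ℝ}
    (hu : ContMDiff (𝓡 n) 𝓘(ℝ, ℝ) ∞ u) :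
    ∫ p, diffusionGenerator g V u p ∂(weightedMeasure g V) = 0 := by
  have := ChartedSpace.secondCountable_of_sigmaCompact (EuclideanSpace ℝ (Fin n)) M
  obtain ⟨f, hf⟩ := SmoothPartitionOfUnity.exists_isSubordinate_chartAt_source (𝓡 n) M
  have hfin : {k | (Function.support (f k)).Nonempty}.Finite :=
    f.locallyFinite.finite_nonempty_of_compact
  have hsum : ∀ p, ∑ k ∈ hfin.toFinset, f k p = 1 := by
    intro p
    rw [← f.sum_eq_one (mem_univ p)]
    refine (finsum_eq_sum_of_support_subset _ fun k hk => ?_).symm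
    simp only [Finite.coe_toFinset, mem_ofPred_eq]
    exact ⟨p, hk⟩
  have hχ : ∀ k, ContMDiff (𝓡 n) 𝓘(ℝ, ℝ) ∞ (f k) := fun k => (f k).contMDiff
  have hint : ∀ {F : M → ℝ}, Continuous F → Integrable F (weightedMeasure g V) := fun hF =>
    hF.integrable_of_hasCompactSupport (HasCompactSupport.of_compactSpace _)
  have hL := continuous_diffusionGenerator (g := g) hV hu
  have h1 : ∀ k, ∫ p, f k p * diffusionGenerator g V u p ∂(weightedMeasure g V) =
      -∫ p, gradInner g (f k) u p ∂(weightedMeasure g V) := by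
    intro k
    have hs : tsupport (f k) ⊆ (extChartAt (𝓡 n) k).source := by
      rw [extChartAt_source]; exact hf k
    rw [← integral_mul_chartGenerator hV (hχ k) hu hs]
    refine integral_congr_ae (ae_of_all _ fun p => ?_)
    simp only
    by_cases hp : p ∈ (extChartAt (𝓡 n) k).source
    · rw [← diffusionGenerator_symm hV hu k ((extChartAt (𝓡 n) k).map_source hp),
        (extChartAt (𝓡 n) k).left_inv hp]
    · rw [image_eq_zero_of_notMem_tsupport fun h => hp (hs h), zero_mul, zero_mul]
  have h2 : ∀ p, diffusionGenerator g V u p =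
      ∑ k ∈ hfin.toFinset, f k p * diffusionGenerator g V u p := by
    intro p
    rw [← Finset.sum_mul, hsum, one_mul]
  rw [integral_congr_ae (ae_of_all _ h2),
    integral_finsetSum _ fun k _ => hint (F := fun p => f k p * diffusionGenerator g V u p)
      ((hχ k).continuous.mul hL)]
  simp only [h1]
  rw [Finset.sum_neg_distrib,
    ← integral_finsetSum _ fun k _ => hint (continuous_gradInner (hχ k) hu),
    integral_congr_ae (ae_of_all _ (sum_gradInner _ hχ hsum)), integral_zero, neg_zero]

theorem isDiffusion_diffusionGenerator [IsFiniteMeasure (weightedMeasure g V)]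
    (hV : ContMDiff (𝓡 n) 𝓘(ℝ, ℝ) ∞ V) :
    IsDiffusion n (weightedMeasure g V) (diffusionGenerator g V) where
  chart_eq x := by
    have hT := isOpen_target (n := n) x
    refine ⟨fun y i j => (metricMatrix g x y)⁻¹ i j, fun y j => (chartDensity g V x y)⁻¹ *
      ∑ i, partialDeriv i (fun z => chartDensity g V x z * (metricMatrix g x z)⁻¹ i j) y,
      fun i j => (contDiffOn_metricMatrix_inv g x i j).continuousOn, fun j => ?_, ?_, ?_⟩
    · exact (((contDiffOn_chartDensity g hV x).inv fun _ hy => (chartDensity_pos g V x hy).ne').mul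
        (ContDiffOn.sum fun i _ => contDiffOn_partialDeriv hT ((contDiffOn_chartDensity g hV x).mul
          (contDiffOn_metricMatrix_inv g x i j)) i)).continuousOn
    · intro y hy ξ
      have h := (posDef_metricMatrix g x hy).inv.posSemidef.dotProduct_mulVec_nonneg ξ
      simp only [dotProduct, Matrix.mulVec, star_trivial, Finset.mul_sum] at h
      exact h.trans_eq (Finset.sum_congr rfl fun i _ => Finset.sum_congr rfl fun j _ => by ring)
    · intro u hu y hy
      rw [diffusionGenerator_symm hV hu x hy, chartGenerator_eq_sum hV hu x hy]
  integral_eq_zero u hu := integral_diffusionGenerator hV hu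

end Diffusion

/-! ### Parametrized families and differentiation under the integral. -/

section Family

universe u v

variable {Z : Type v} [TopologicalSpace Z] {X : Type u} [NormedAddCommGroup X] [NormedSpace ℝ X]

/-- The family `(G z)` of functions on `S` is of class `C^k`, with derivatives that are jointly
continuous on `W × S`. -/
def IsContDiffFamily : ℕ → ∀ {F : Type u} [NormedAddCommGroup F] [NormedSpace ℝ F],
    (Z → X → F) → Set Z → Set X → Prop
  | 0, _, _, _, G, W, S => ContinuousOn (fun q : Z × X => G q.1 q.2) (W ×ˢ S)
  | k + 1, _, _, _, G, W, S => ContinuousOn (fun q : Z × X => G q.1 q.2) (W ×ˢ S) ∧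
      (∀ z ∈ W, DifferentiableOn ℝ (G z) S) ∧
      IsContDiffFamily k (fun z => fderivWithin ℝ (G z) S) W S

variable {F : Type u} [NormedAddCommGroup F] [NormedSpace ℝ F]
  {F' : Type u} [NormedAddCommGroup F'] [NormedSpace ℝ F'] {G : Z → X → F} {W : Set Z} {S : Set X}

namespace IsContDiffFamily

theorem continuousOn {k : ℕ} (h : IsContDiffFamily k G W S) :
    ContinuousOn (fun q : Z × X => G q.1 q.2) (W ×ˢ S) := by
  cases k with
  | zero => exact h
  | succ k => exact h.1

theorem congr {k : ℕ} {G' : Z → X → F} (h : IsContDiffFamily k G W S)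
    (hG : ∀ z ∈ W, EqOn (G' z) (G z) S) : IsContDiffFamily k G' W S := by
  induction k generalizing F with
  | zero => exact ContinuousOn.congr h fun q hq => hG q.1 hq.1 hq.2
  | succ k ih =>
    refine ⟨h.1.congr fun q hq => hG q.1 hq.1 hq.2, fun z hz => (h.2.1 z hz).congr (hG z hz),
      ih h.2.2 fun z hz x hx => ?_⟩
    exact fderivWithin_congr (hG z hz) (hG z hz hx)

theorem of_local {k : ℕ} (h : ∀ z, ∃ W ∈ 𝓝 z, IsContDiffFamily k G W S) :
    IsContDiffFamily k G univ S := by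
  have hc : ∀ {F : Type u} [NormedAddCommGroup F] [NormedSpace ℝ F] {G : Z → X → F},
      (∀ z, ∃ W ∈ 𝓝 z, ContinuousOn (fun q : Z × X => G q.1 q.2) (W ×ˢ S)) →
      ContinuousOn (fun q : Z × X => G q.1 q.2) (univ ×ˢ S) := by
    intro F _ _ G h q hq
    obtain ⟨W, hW, hc⟩ := h q.1
    refine (hc q ⟨mem_of_mem_nhds hW, hq.2⟩).mono_of_mem_nhdsWithin ?_
    rw [nhdsWithin_prod_eq, nhdsWithin_univ]
    exact prod_mem_prod hW self_mem_nhdsWithin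
  induction k generalizing F with
  | zero => exact hc h
  | succ k ih =>
    refine ⟨hc fun z => ?_, fun z _ => ?_, ih fun z => ?_⟩
    · obtain ⟨W, hW, h⟩ := h z
      exact ⟨W, hW, h.1⟩
    · obtain ⟨W, hW, h⟩ := h z
      exact h.2.1 z (mem_of_mem_nhds hW)
    · obtain ⟨W, hW, h⟩ := h z
      exact ⟨W, hW, h.2.2⟩

/-- Only derivatives in `x` are taken, through the inclusion of the second factor, so the
coordinates `ψ` of the parameter need only be continuous. -/
theorem of_comp {Y : Type u} [NormedAddCommGroup Y] [NormedSpace ℝ Y] {T : Set Y}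
    (hT : UniqueDiffOn ℝ T) (hS : UniqueDiffOn ℝ S) {H : Y × X → F} {ψ : Z → Y}
    (hψ : ContinuousOn ψ W) (hψT : MapsTo ψ W T) {k : ℕ} (hH : ContDiffOn ℝ k H (T ×ˢ S))
    (hG : ∀ z ∈ W, ∀ x ∈ S, G z x = H (ψ z, x)) : IsContDiffFamily k G W S := by
  have hcont : ∀ {F : Type u} [NormedAddCommGroup F] [NormedSpace ℝ F] {G : Z → X → F}
      {H : Y × X → F}, ContinuousOn H (T ×ˢ S) → (∀ z ∈ W, ∀ x ∈ S, G z x = H (ψ z, x)) →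
      ContinuousOn (fun q : Z × X => G q.1 q.2) (W ×ˢ S) := by
    intro F _ _ G H hH hG
    refine (hH.comp ((hψ.comp continuousOn_fst fun q hq => hq.1).prodMk continuousOn_snd)
      fun q hq => ⟨hψT hq.1, hq.2⟩).congr fun q hq => hG q.1 hq.1 q.2 hq.2
  induction k generalizing F with
  | zero => exact hcont hH.continuousOn hG
  | succ k ih =>
    have hder : ∀ z ∈ W, ∀ x ∈ S, HasFDerivWithinAt (G z)
        ((fderivWithin ℝ H (T ×ˢ S) (ψ z, x)).comp (ContinuousLinearMap.inr ℝ Y X)) S x := by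
      intro z hz x hx
      have h1 : HasFDerivWithinAt H (fderivWithin ℝ H (T ×ˢ S) (ψ z, x)) (T ×ˢ S) (ψ z, x) :=
        (hH.differentiableOn (by simp) (ψ z, x) ⟨hψT hz, hx⟩).hasFDerivWithinAt
      have h2 : HasFDerivWithinAt (fun x : X => (ψ z, x)) (ContinuousLinearMap.inr ℝ Y X) S x :=
        (hasFDerivAt_prodMk_right _ _).hasFDerivWithinAt
      exact (h1.comp x h2 fun x' hx' => ⟨hψT hz, hx'⟩).congr (fun x' hx' => hG z hz x' hx')
        (hG z hz x hx)
    refine ⟨hcont hH.continuousOn hG, fun z hz x hx => (hder z hz x hx).differentiableWithinAt, ?_⟩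
    refine ih (H := fun q => (fderivWithin ℝ H (T ×ˢ S) q).comp (ContinuousLinearMap.inr ℝ Y X))
      ?_ fun z hz x hx => (hder z hz x hx).fderivWithin (hS x hx)
    have := hH.fderivWithin (m := k) (hT.prod hS) (by simp)
    exact this.clm_comp contDiffOn_const

theorem clm_comp {k : ℕ} (h : IsContDiffFamily k G W S) (hS : UniqueDiffOn ℝ S) (ℓ : F →L[ℝ] F') :
    IsContDiffFamily k (fun z x => ℓ (G z x)) W S := by
  induction k generalizing F F' with
  | zero => exact ℓ.continuous.comp_continuousOn h
  | succ k ih =>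
    refine ⟨ℓ.continuous.comp_continuousOn h.1,
      fun z hz => ℓ.differentiable.comp_differentiableOn (h.2.1 z hz), ?_⟩
    refine (ih h.2.2 (ContinuousLinearMap.compL ℝ X F F' ℓ)).congr fun z hz x hx => ?_
    exact ((ℓ.hasFDerivAt.comp_hasFDerivWithinAt x
      (h.2.1 z hz x hx).hasFDerivWithinAt)).fderivWithin (hS x hx)

theorem contDiffOn {k : ℕ} (h : IsContDiffFamily k G W S) (hS : UniqueDiffOn ℝ S) {z : Z}
    (hz : z ∈ W) : ContDiffOn ℝ k (G z) S := by
  induction k generalizing F with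
  | zero =>
    refine contDiffOn_zero.2 (ContinuousOn.comp (t := W ×ˢ S) h (f := fun x => (z, x))
      (by fun_prop) fun x hx => ⟨hz, hx⟩)
  | succ k ih =>
    push_cast
    rw [contDiffOn_succ_iff_fderivWithin hS]
    exact ⟨h.2.1 z hz, by simp, ih h.2.2⟩

end IsContDiffFamily

variable [CompactSpace Z] [SecondCountableTopology Z] [MeasurableSpace Z] [BorelSpace Z]
  (ν : Measure Z) [IsFiniteMeasure ν] [CompleteSpace F]

theorem integrable_of_continuous_of_compactSpace {f : Z → F} (hf : Continuous f) :
    Integrable f ν := hf.integrable_of_hasCompactSupport (HasCompactSupport.of_compactSpace _)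

theorem continuous_family_left (hG : ContinuousOn (fun q : Z × X => G q.1 q.2) (univ ×ˢ S)) {x : X}
    (hx : x ∈ S) : Continuous fun z => G z x := by
  rw [← continuousOn_univ]
  exact hG.comp (f := fun z => (z, x)) (by fun_prop) fun z hz => ⟨hz, hx⟩

/-- Compactness of the parameter space makes continuity at `x₀` uniform in the parameter. -/
theorem eventually_forall_norm_sub_lt
    (hG : ContinuousOn (fun q : Z × X => G q.1 q.2) (univ ×ˢ S)) {x₀ : X} (hx₀ : x₀ ∈ S) {ε : ℝ}
    (hε : 0 < ε) : ∀ᶠ x in 𝓝 x₀, ∀ z, x ∈ S → ‖G z x - G z x₀‖ < ε := by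
  have h := isCompact_univ.eventually_forall_of_forall_eventually (x₀ := x₀) (K := (univ : Set Z))
    (P := fun x z => x ∈ S → ‖G z x - G z x₀‖ < ε) ?_
  · exact h.mono fun x hx z => hx z (mem_univ z)
  intro z _
  have h1 := hG (z, x₀) ⟨mem_univ _, hx₀⟩
  have h2 : Tendsto (fun q : Z × X => ‖G q.1 q.2 - G q.1 x₀‖) (𝓝[univ ×ˢ S] (z, x₀)) (𝓝 0) := by
    have h3 : ContinuousWithinAt (fun q : Z × X => ‖G q.1 q.2 - G q.1 x₀‖) (univ ×ˢ S) (z, x₀) :=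
      (h1.sub ((continuous_family_left hG hx₀).comp
        continuous_fst).continuousAt.continuousWithinAt).norm
    simpa [ContinuousWithinAt] using h3
  have h4 := h2.eventually (gt_mem_nhds hε)
  rw [eventually_nhdsWithin_iff] at h4
  have h5 := (continuous_swap.tendsto (x₀, z)).eventually h4
  exact h5.mono fun q hq hqS => hq ⟨mem_univ _, hqS⟩

theorem continuousOn_integral_family
    (hG : ContinuousOn (fun q : Z × X => G q.1 q.2) (univ ×ˢ S)) :
    ContinuousOn (fun x => ∫ z, G z x ∂ν) S := by
  intro x₀ hx₀
  rw [ContinuousWithinAt, Metric.tendsto_nhds]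
  intro ε hε
  -- The added 1 keeps the denominator positive when the measure is zero.
  have hν : 0 < ν.real univ + 1 := by positivity
  have h := eventually_forall_norm_sub_lt hG hx₀ (div_pos hε hν)
  filter_upwards [mem_nhdsWithin_of_mem_nhds h, self_mem_nhdsWithin] with x hx hxS
  rw [dist_eq_norm, ← integral_sub
    (integrable_of_continuous_of_compactSpace ν (continuous_family_left hG hxS))
    (integrable_of_continuous_of_compactSpace ν (continuous_family_left hG hx₀))]
  calc ‖∫ z, (G z x - G z x₀) ∂ν‖ ≤ ε / (ν.real univ + 1) * ν.real univ :=
        norm_integral_le_of_norm_le_const (ae_of_all _ fun z => (hx z hxS).le)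
    _ < ε / (ν.real univ + 1) * (ν.real univ + 1) := by
        have := div_pos hε hν
        nlinarith
    _ = ε := by field_simp

/-- Differentiation under the integral sign, over a compact space of parameters. -/
theorem hasFDerivWithinAt_integral_family (hS : ∀ x ∈ S, ∃ U ∈ 𝓝 x, Convex ℝ (S ∩ U))
    {G' : Z → X → X →L[ℝ] F}
    (hG : ContinuousOn (fun q : Z × X => G q.1 q.2) (univ ×ˢ S))
    (hd : ∀ z, ∀ x ∈ S, HasFDerivWithinAt (G z) (G' z x) S x)
    (hG' : ContinuousOn (fun q : Z × X => G' q.1 q.2) (univ ×ˢ S)) {x₀ : X} (hx₀ : x₀ ∈ S) :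
    HasFDerivWithinAt (fun x => ∫ z, G z x ∂ν) (∫ z, G' z x₀ ∂ν) S x₀ := by
  rw [hasFDerivWithinAt_iff_isLittleO, Asymptotics.isLittleO_iff]
  intro ε hε
  have hν : 0 < ν.real univ + 1 := by positivity
  set δ := ε / (ν.real univ + 1) with hδ
  have hδp : 0 < δ := div_pos hε hν
  obtain ⟨U, hU, hUc⟩ := hS x₀ hx₀
  obtain ⟨r, hr, hball⟩ := Metric.eventually_nhds_iff_ball.1
    (eventually_forall_norm_sub_lt hG' hx₀ hδp)
  have hI := fun {x} (hx : x ∈ S) => integrable_of_continuous_of_compactSpace ν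
    (continuous_family_left hG hx)
  have hI' := integrable_of_continuous_of_compactSpace ν (continuous_family_left hG' hx₀)
  filter_upwards [mem_nhdsWithin_of_mem_nhds hU,
    mem_nhdsWithin_of_mem_nhds (Metric.ball_mem_nhds x₀ hr), self_mem_nhdsWithin] with x hxU hxr hxS
  have hle : ∀ z, ‖G z x - G z x₀ - G' z x₀ (x - x₀)‖ ≤ δ * ‖x - x₀‖ := by
    intro z
    refine Convex.norm_image_sub_le_of_norm_hasFDerivWithin_le' (s := (S ∩ U) ∩ Metric.ball x₀ r)
      (f' := G' z) (fun y hy => (hd z y hy.1.1).mono fun w hw => hw.1.1)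
      (fun y hy => (hball y hy.2 z hy.1.1).le) (hUc.inter (convex_ball _ _))
      ⟨⟨hx₀, mem_of_mem_nhds hU⟩, Metric.mem_ball_self hr⟩ ⟨⟨hxS, hxU⟩, hxr⟩
  have hI'' : Integrable (fun z => G' z x₀ (x - x₀)) ν :=
    hI'.apply_continuousLinearMap _
  rw [ContinuousLinearMap.integral_apply hI', ← integral_sub (hI hxS) (hI hx₀),
    ← integral_sub (f := fun z => G z x - G z x₀) ((hI hxS).sub (hI hx₀)) hI'']
  calc _ ≤ δ * ‖x - x₀‖ * ν.real univ :=
        norm_integral_le_of_norm_le_const (ae_of_all _ hle)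
    _ ≤ δ * ‖x - x₀‖ * (ν.real univ + 1) := by gcongr; simp
    _ = ε * ‖x - x₀‖ := by rw [hδ]; field_simp

namespace IsContDiffFamily

theorem hasFDerivWithinAt_integral {k : ℕ} (h : IsContDiffFamily (k + 1) G univ S)
    (hS : ∀ x ∈ S, ∃ U ∈ 𝓝 x, Convex ℝ (S ∩ U)) {x : X} (hx : x ∈ S) :
    HasFDerivWithinAt (fun x => ∫ z, G z x ∂ν) (∫ z, fderivWithin ℝ (G z) S x ∂ν) S x :=
  hasFDerivWithinAt_integral_family ν hS h.1
    (fun z x hx => (h.2.1 z (mem_univ z) x hx).hasFDerivWithinAt) h.2.2.continuousOn hx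

theorem contDiffOn_integral {k : ℕ} (h : IsContDiffFamily k G univ S) (hS : UniqueDiffOn ℝ S)
    (hS' : ∀ x ∈ S, ∃ U ∈ 𝓝 x, Convex ℝ (S ∩ U)) :
    ContDiffOn ℝ k (fun x => ∫ z, G z x ∂ν) S := by
  induction k generalizing F with
  | zero => exact contDiffOn_zero.2 (continuousOn_integral_family ν h)
  | succ k ih =>
    push_cast
    rw [contDiffOn_succ_iff_fderivWithin hS]
    have hd := fun x (hx : x ∈ S) => h.hasFDerivWithinAt_integral ν hS' hx
    refine ⟨fun x hx => (hd x hx).differentiableWithinAt, by simp, ?_⟩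
    exact (ih h.2.2).congr fun x hx => (hd x hx).fderivWithin (hS x hx)

end IsContDiffFamily

end Family

/-- Local convexity is what the mean value inequality asks of the domain. -/
theorem exists_convex_inter_of_isOpen {X : Type*} [NormedAddCommGroup X] [NormedSpace ℝ X]
    {S : Set X} (hS : IsOpen S) : ∀ x ∈ S, ∃ U ∈ 𝓝 x, Convex ℝ (S ∩ U) := by
  intro x hx
  obtain ⟨r, hr, h⟩ := Metric.isOpen_iff.1 hS x hx
  refine ⟨Metric.ball x r, Metric.ball_mem_nhds x hr, ?_⟩
  rw [inter_eq_right.2 h]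
  exact convex_ball x r

section PartialFamily

variable {n : ℕ} {Z : Type*} [TopologicalSpace Z] {S : Set (EuclideanSpace ℝ (Fin n))}
  {G : Z → EuclideanSpace ℝ (Fin n) → ℝ}

theorem IsContDiffFamily.partialDeriv {k : ℕ} (h : IsContDiffFamily (k + 1) G univ S)
    (hS : IsOpen S) (j : Fin n) :
    IsContDiffFamily k (fun z => partialDeriv j (G z)) univ S := by
  refine (h.2.2.clm_comp hS.uniqueDiffOn
    (ContinuousLinearMap.apply ℝ ℝ (EuclideanSpace.single j (1 : ℝ)))).congr fun z _ x hx => ?_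
  simp [MarkovTransport.partialDeriv, fderivWithin_of_isOpen hS hx]

theorem partialDeriv_integral [CompactSpace Z] [SecondCountableTopology Z] [MeasurableSpace Z]
    [BorelSpace Z] (ν : Measure Z) [IsFiniteMeasure ν] {k : ℕ}
    (h : IsContDiffFamily (k + 1) G univ S) (hS : IsOpen S) (j : Fin n)
    {y : EuclideanSpace ℝ (Fin n)} (hy : y ∈ S) :
    partialDeriv j (fun y => ∫ z, G z y ∂ν) y = ∫ z, partialDeriv j (G z) y ∂ν := by
  have h1 := (h.hasFDerivWithinAt_integral ν (exists_convex_inter_of_isOpen hS) hy).hasFDerivAt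
    (hS.mem_nhds hy)
  rw [partialDeriv, h1.fderiv, ContinuousLinearMap.integral_apply]
  · refine integral_congr_ae (ae_of_all _ fun z => ?_)
    simp [partialDeriv, fderivWithin_of_isOpen hS hy]
  · exact integrable_of_continuous_of_compactSpace ν
      (continuous_family_left h.2.2.continuousOn hy)

end PartialFamily

/-! ### Families of smooth functions on a manifold. -/

section SmoothFamily

variable {n : ℕ} {M : Type*} [TopologicalSpace M]
  [ChartedSpace (EuclideanSpace ℝ (Fin n)) M]
  {Z : Type*} [TopologicalSpace Z]

/-- `(w z)` is a family of smooth functions on `M`, all of whose derivatives are jointly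
continuous. -/
def IsSmoothFamily (n : ℕ) {M : Type*} [TopologicalSpace M]
    [ChartedSpace (EuclideanSpace ℝ (Fin n)) M] {Z : Type*} [TopologicalSpace Z]
    (w : Z → M → ℝ) : Prop :=
  ∀ (x : M) (k : ℕ), IsContDiffFamily k (fun z y => w z ((extChartAt (𝓡 n) x).symm y)) univ
    (extChartAt (𝓡 n) x).target

variable [IsManifold (𝓡 n) ∞ M] {w : Z → M → ℝ}

theorem contMDiff_of_contDiffOn_chart {u : M → ℝ}
    (h : ∀ x : M, ContDiffOn ℝ ∞ (fun y => u ((extChartAt (𝓡 n) x).symm y))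
      (extChartAt (𝓡 n) x).target) : ContMDiff (𝓡 n) 𝓘(ℝ, ℝ) ∞ u := by
  intro p
  have h1 : ContMDiffAt (𝓡 n) 𝓘(ℝ, ℝ) ∞
      ((fun y => u ((extChartAt (𝓡 n) p).symm y)) ∘ extChartAt (𝓡 n) p) p :=
    ((h p).contDiffAt (extChartAt_target_mem_nhds p)).contMDiffAt.comp p contMDiffAt_extChartAt
  refine h1.congr_of_eventuallyEq ?_
  filter_upwards [extChartAt_source_mem_nhds (I := 𝓡 n) p] with q hq
  rw [Function.comp_apply, (extChartAt (𝓡 n) p).left_inv hq]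

namespace IsSmoothFamily

theorem contMDiff (hw : IsSmoothFamily n w) (z : Z) : ContMDiff (𝓡 n) 𝓘(ℝ, ℝ) ∞ (w z) :=
  contMDiff_of_contDiffOn_chart fun x => contDiffOn_infty.2 fun k =>
    (hw x k).contDiffOn (isOpen_target x).uniqueDiffOn (mem_univ z)

theorem continuous_of_chart₂ {f : Z × M → ℝ} {F : M → Z → EuclideanSpace ℝ (Fin n) → ℝ}
    (hF : ∀ x, ContinuousOn (fun q : Z × _ => F x q.1 q.2) (univ ×ˢ (extChartAt (𝓡 n) x).target))
    (h : ∀ x z, ∀ y ∈ (extChartAt (𝓡 n) x).target,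
      f (z, (extChartAt (𝓡 n) x).symm y) = F x z y) : Continuous f := by
  rw [continuous_iff_continuousAt]
  rintro ⟨z, x⟩
  have hU : (univ : Set Z) ×ˢ (extChartAt (𝓡 n) x).source ∈ 𝓝 (z, x) :=
    prod_mem_nhds univ_mem (extChartAt_source_mem_nhds x)
  have h1 : ContinuousOn (fun q : Z × M => F x q.1 (extChartAt (𝓡 n) x q.2))
      (univ ×ˢ (extChartAt (𝓡 n) x).source) := by
    refine (hF x).comp (f := fun q : Z × M => (q.1, extChartAt (𝓡 n) x q.2)) ?_
      fun q hq => ⟨mem_univ _, (extChartAt (𝓡 n) x).map_source hq.2⟩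
    exact continuousOn_fst.prodMk ((continuousOn_extChartAt x).comp continuousOn_snd
      fun q hq => hq.2)
  refine (h1.continuousAt hU).congr ?_
  filter_upwards [hU] with q hq
  rw [← h x _ _ ((extChartAt (𝓡 n) x).map_source hq.2), (extChartAt (𝓡 n) x).left_inv hq.2]

section Integral

variable [CompactSpace Z] [SecondCountableTopology Z] [MeasurableSpace Z]
    [BorelSpace Z] (ν : Measure Z) [IsFiniteMeasure ν]

theorem contMDiff_integral (hw : IsSmoothFamily n w) :
    ContMDiff (𝓡 n) 𝓘(ℝ, ℝ) ∞ (fun p => ∫ z, w z p ∂ν) :=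
  contMDiff_of_contDiffOn_chart fun x => contDiffOn_infty.2 fun k =>
    (hw x k).contDiffOn_integral ν (isOpen_target x).uniqueDiffOn
      (exists_convex_inter_of_isOpen (isOpen_target x))

end Integral

end IsSmoothFamily

/-! ### Diffusions acting on families; convexity of the energy. -/

section Operator

variable [MeasurableSpace M] {μ : Measure M} {L : (M → ℝ) → M → ℝ}

/-- In a chart, `L` combines derivatives of order at most two, jointly continuous for a smooth
family, with continuous coefficients. -/
theorem IsDiffusion.continuous_family (hL : IsDiffusion n μ L) (hw : IsSmoothFamily n w) :
    Continuous fun q : Z × M => L (w q.1) q.2 := by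
  choose A B hA hB _ hLe using hL.chart_eq
  refine IsSmoothFamily.continuous_of_chart₂ (n := n) (fun x => ?_) fun x z y hy =>
    hLe x (w z) (hw.contMDiff z) y hy
  have hT := isOpen_target (n := n) x
  have hs : MapsTo (fun q : Z × EuclideanSpace ℝ (Fin n) => q.2)
    (univ ×ˢ (extChartAt (𝓡 n) x).target) (extChartAt (𝓡 n) x).target := fun q hq => hq.2
  refine (continuousOn_finsetSum _ fun i _ => continuousOn_finsetSum _ fun j _ => ?_).add
    (continuousOn_finsetSum _ fun j _ => ?_)
  · exact ((hA x i j).comp continuousOn_snd hs).mul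
      (((hw x 2).partialDeriv hT j).partialDeriv hT i).continuousOn
  · exact ((hB x j).comp continuousOn_snd hs).mul ((hw x 1).partialDeriv hT j).continuousOn

/-- Two differentiations under the integral sign in the chart around `p`. -/
theorem IsDiffusion.apply_integral [CompactSpace Z] [SecondCountableTopology Z] [MeasurableSpace Z]
    [BorelSpace Z] (ν : Measure Z) [IsFiniteMeasure ν] (hL : IsDiffusion n μ L)
    (hw : IsSmoothFamily n w) (p : M) :
    L (fun p => ∫ z, w z p ∂ν) p = ∫ z, L (w z) p ∂ν := by
  obtain ⟨A, B, hA, hB, _, hLe⟩ := hL.chart_eq p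
  have hT := isOpen_target (n := n) p
  have hy := mem_extChartAt_target (I := 𝓡 n) p
  have hp := extChartAt_to_inv (I := 𝓡 n) p
  set y := extChartAt (𝓡 n) p p with hyp
  have h1 : ∀ u : M → ℝ, ContMDiff (𝓡 n) 𝓘(ℝ, ℝ) ∞ u → L u p = ∑ i, ∑ j, A y i j *
        partialDeriv i (partialDeriv j (u ∘ (extChartAt (𝓡 n) p).symm)) y +
      ∑ j, B y j * partialDeriv j (u ∘ (extChartAt (𝓡 n) p).symm) y := by
    intro u hu
    rw [← hLe u hu y hy, hp]
  rw [h1 _ (hw.contMDiff_integral ν)]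
  simp only [h1 _ (hw.contMDiff _)]
  have hd1 : ∀ j, ∀ z ∈ (extChartAt (𝓡 n) p).target,
      partialDeriv j ((fun p => ∫ z, w z p ∂ν) ∘ (extChartAt (𝓡 n) p).symm) z =
      ∫ t, partialDeriv j (w t ∘ (extChartAt (𝓡 n) p).symm) z ∂ν := fun j z hz =>
    partialDeriv_integral ν (hw p 1) hT j hz
  have hd2 : ∀ i j, partialDeriv i (partialDeriv j
      ((fun p => ∫ z, w z p ∂ν) ∘ (extChartAt (𝓡 n) p).symm)) y =
      ∫ t, partialDeriv i (partialDeriv j (w t ∘ (extChartAt (𝓡 n) p).symm)) y ∂ν := by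
    intro i j
    rw [partialDeriv_congr i (v := fun z => ∫ t, partialDeriv j
      (w t ∘ (extChartAt (𝓡 n) p).symm) z ∂ν)]
    · exact partialDeriv_integral ν ((hw p 2).partialDeriv hT j) hT i hy
    · filter_upwards [hT.mem_nhds hy] with z hz using hd1 j z hz
  have hI1 : ∀ j, Integrable (fun t => B y j *
      partialDeriv j (w t ∘ (extChartAt (𝓡 n) p).symm) y) ν := fun j =>
    (integrable_of_continuous_of_compactSpace ν (continuous_family_left
      ((hw p 1).partialDeriv hT j).continuousOn hy)).const_mul _
  have hI2 : ∀ i j, Integrable (fun t => A y i j *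
      partialDeriv i (partialDeriv j (w t ∘ (extChartAt (𝓡 n) p).symm)) y) ν := fun i j =>
    (integrable_of_continuous_of_compactSpace ν (continuous_family_left
      (((hw p 2).partialDeriv hT j).partialDeriv hT i).continuousOn hy)).const_mul _
  rw [integral_add (integrable_finsetSum _ fun i _ => integrable_finsetSum _ fun j _ => hI2 i j)
    (integrable_finsetSum _ fun j _ => hI1 j),
    integral_finsetSum _ fun i _ => integrable_finsetSum _ fun j _ => hI2 i j,
    integral_finsetSum _ fun j _ => hI1 j]
  congr 1
  · refine Finset.sum_congr rfl fun i _ => ?_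
    rw [integral_finsetSum _ fun j _ => hI2 i j]
    exact Finset.sum_congr rfl fun j _ => by rw [hd2, integral_const_mul]
  · exact Finset.sum_congr rfl fun j _ => by rw [hd1 j y hy, integral_const_mul]

/-- The carré du champ of a diffusion is a nonnegative quadratic form in the gradient. -/
theorem IsDiffusion.carreDuChamp_eq (hL : IsDiffusion n μ L) (x : M) :
    ∃ A : EuclideanSpace ℝ (Fin n) → Fin n → Fin n → ℝ,
      (∀ i j, ContinuousOn (fun y => A y i j) (extChartAt (𝓡 n) x).target) ∧
      (∀ y ∈ (extChartAt (𝓡 n) x).target, ∀ ξ : Fin n → ℝ,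
        0 ≤ ∑ i, ∑ j, A y i j * (ξ i * ξ j)) ∧
      ∀ u : M → ℝ, ContMDiff (𝓡 n) 𝓘(ℝ, ℝ) ∞ u → ∀ y ∈ (extChartAt (𝓡 n) x).target,
        carreDuChamp L u u ((extChartAt (𝓡 n) x).symm y) =
          ∑ i, ∑ j, A y i j * (chartGrad x u y i * chartGrad x u y j) := by
  obtain ⟨A, B, hA, hB, hpos, hLe⟩ := hL.chart_eq x
  refine ⟨A, hA, hpos, fun u hu y hy => ?_⟩
  have hT := isOpen_target (n := n) x
  set U := u ∘ (extChartAt (𝓡 n) x).symm with hU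
  have hUs : ContDiffOn ℝ ∞ U (extChartAt (𝓡 n) x).target := contDiffOn_comp_symm hu x
  have hUd : ∀ z ∈ (extChartAt (𝓡 n) x).target, DifferentiableAt ℝ U z := fun z hz =>
    differentiableAt_of_contDiffOn hT hUs hz
  have hdUd : ∀ j, DifferentiableAt ℝ (partialDeriv j U) y := fun j =>
    differentiableAt_of_contDiffOn hT (contDiffOn_partialDeriv hT hUs j) hy
  have hcomp : (fun p => u p * u p) ∘ (extChartAt (𝓡 n) x).symm = fun z => U z * U z := rfl
  have h1 : ∀ j, ∀ z ∈ (extChartAt (𝓡 n) x).target,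
      partialDeriv j (fun z => U z * U z) z = U z * partialDeriv j U z + U z * partialDeriv j U z :=
    fun j z hz => partialDeriv_mul j (hUd z hz) (hUd z hz)
  have h2 : ∀ i j, partialDeriv i (partialDeriv j (fun z => U z * U z)) y =
      2 * (U y * partialDeriv i (partialDeriv j U) y +
        partialDeriv j U y * partialDeriv i U y) := by
    intro i j
    have hd := (hUd y hy).fun_mul (hdUd j)
    rw [partialDeriv_congr i (v := fun z => U z * partialDeriv j U z + U z * partialDeriv j U z),
      partialDeriv_add i hd hd, partialDeriv_mul i (hUd y hy) (hdUd j)]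
    · ring
    · filter_upwards [hT.mem_nhds hy] with z hz using h1 j z hz
  have hUy : u ((extChartAt (𝓡 n) x).symm y) = U y := rfl
  rw [carreDuChamp, hLe u hu y hy, hLe (fun p => u p * u p) (hu.mul hu) y hy, hcomp, hUy]
  simp only [h2, h1 _ y hy, ← hU]
  -- The terms with a factor `U y` cancel against 2uLu, as there is no zeroth order part; products
  -- of first derivatives remain.
  have e1 : ∑ i, ∑ j, A y i j * (2 * (U y * partialDeriv i (partialDeriv j U) y +
      partialDeriv j U y * partialDeriv i U y)) =
      2 * U y * (∑ i, ∑ j, A y i j * partialDeriv i (partialDeriv j U) y) +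
      2 * ∑ i, ∑ j, A y i j * (chartGrad x u y i * chartGrad x u y j) := by
    simp only [Finset.mul_sum, ← Finset.sum_add_distrib]
    refine Finset.sum_congr rfl fun i _ => Finset.sum_congr rfl fun j _ => ?_
    simp only [chartGrad, ← hU]
    ring
  have e2 : ∑ j, B y j * (U y * partialDeriv j U y + U y * partialDeriv j U y) =
      2 * U y * ∑ j, B y j * partialDeriv j U y := by
    rw [Finset.mul_sum]
    exact Finset.sum_congr rfl fun j _ => by ring
  rw [e1, e2]
  ring

theorem IsDiffusion.carreDuChamp_nonneg (hL : IsDiffusion n μ L) {u : M → ℝ}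
    (hu : ContMDiff (𝓡 n) 𝓘(ℝ, ℝ) ∞ u) (p : M) : 0 ≤ carreDuChamp L u u p := by
  obtain ⟨A, _, hpos, h⟩ := hL.carreDuChamp_eq p
  rw [← extChartAt_to_inv (I := 𝓡 n) p, h u hu _ (mem_extChartAt_target p)]
  exact hpos _ (mem_extChartAt_target p) _

theorem IsDiffusion.continuous_carreDuChamp_family (hL : IsDiffusion n μ L)
    (hw : IsSmoothFamily n w) :
    Continuous fun q : Z × M => carreDuChamp L (w q.1) (w q.1) q.2 := by
  choose A hA _ h using hL.carreDuChamp_eq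
  refine IsSmoothFamily.continuous_of_chart₂ (n := n) (fun x => ?_) fun x z y hy =>
    h x (w z) (hw.contMDiff z) y hy
  have hT := isOpen_target (n := n) x
  have hd := fun j => ((hw x 1).partialDeriv hT j).continuousOn
  exact continuousOn_finsetSum _ fun i _ => continuousOn_finsetSum _ fun j _ =>
    ((hA x i j).comp continuousOn_snd fun q hq => hq.2).mul ((hd i).mul (hd j))

/-- Joint convexity of `(ρ, h) ↦ Γ(h) / ρ`. -/
theorem IsDiffusion.carreDuChamp_integral_div_le [CompactSpace Z] [SecondCountableTopology Z]
    [MeasurableSpace Z] [BorelSpace Z] (ν : Measure Z) [IsFiniteMeasure ν]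
    (hL : IsDiffusion n μ L) (hw : IsSmoothFamily n w) (p : M) {r : Z → ℝ} (hr : Continuous r)
    (hr0 : ∀ z, 0 < r z) (hR : 0 < ∫ z, r z ∂ν) :
    carreDuChamp L (fun p => ∫ z, w z p ∂ν) (fun p => ∫ z, w z p ∂ν) p / ∫ z, r z ∂ν ≤
      ∫ z, carreDuChamp L (w z) (w z) p / r z ∂ν := by
  obtain ⟨A, _, hpos, h⟩ := hL.carreDuChamp_eq p
  have hT := isOpen_target (n := n) p
  have hy := mem_extChartAt_target (I := 𝓡 n) p
  have hp := extChartAt_to_inv (I := 𝓡 n) p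
  set y := extChartAt (𝓡 n) p p with hyp
  set R := ∫ z, r z ∂ν with hRdef
  set H : M → ℝ := fun p => ∫ z, w z p ∂ν with hH
  have h' : ∀ u : M → ℝ, ContMDiff (𝓡 n) 𝓘(ℝ, ℝ) ∞ u → carreDuChamp L u u p =
      ∑ i, ∑ j, A y i j * (chartGrad p u y i * chartGrad p u y j) := fun u hu => by
    rw [← h u hu y hy, hp]
  have hHs : ContMDiff (𝓡 n) 𝓘(ℝ, ℝ) ∞ H := hw.contMDiff_integral ν
  have hgrad : ∀ j, chartGrad p H y j = ∫ z, chartGrad p (w z) y j ∂ν := fun j =>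
    partialDeriv_integral ν (hw p 1) hT j hy
  have hcg : ∀ j, Continuous fun z => chartGrad p (w z) y j := fun j =>
    continuous_family_left (G := fun z => MarkovTransport.partialDeriv j
      (fun y => w z ((extChartAt (𝓡 n) p).symm y))) ((hw p 1).partialDeriv hT j).continuousOn hy
  have hcg' : Continuous fun z => carreDuChamp L (w z) (w z) p / r z :=
    ((hL.continuous_carreDuChamp_family hw).comp (Continuous.prodMk_left p)).div hr
      fun z => (hr0 z).ne'
  have hint : ∀ {f : Z → ℝ}, Continuous f → Integrable f ν := fun hf =>
    integrable_of_continuous_of_compactSpace ν hf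
  -- The cross term of the quadratic form, symmetrized because `A` is not assumed symmetric.
  set P : Z → ℝ := fun z => ∑ i, ∑ j, A y i j * (chartGrad p (w z) y i * chartGrad p H y j +
    chartGrad p H y i * chartGrad p (w z) y j) with hP
  have hPc : Continuous P := by
    refine continuous_finsetSum _ fun i _ => continuous_finsetSum _ fun j _ => ?_
    have := hcg i
    have := hcg j
    fun_prop
  have hPi : ∫ z, P z ∂ν = 2 * carreDuChamp L H H p := by
    have hci : ∀ i j, Continuous fun z => A y i j * (chartGrad p (w z) y i * chartGrad p H y j +
        chartGrad p H y i * chartGrad p (w z) y j) := fun i j => by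
      have := hcg i
      have := hcg j
      fun_prop
    rw [h' H hHs, hP, integral_finsetSum _ fun i _ =>
      integrable_finsetSum _ fun j _ => hint (hci i j), Finset.mul_sum]
    refine Finset.sum_congr rfl fun i _ => ?_
    rw [integral_finsetSum _ fun j _ => hint (hci i j), Finset.mul_sum]
    refine Finset.sum_congr rfl fun j _ => ?_
    rw [integral_const_mul, integral_add (hint ((hcg i).mul_const _))
      (hint ((hcg j).const_mul _)), integral_mul_const, integral_const_mul, ← hgrad, ← hgrad]
    ring
  -- This is `r z` times the quadratic form evaluated at ∇w_z / r_z - ∇H / R. Integrated in z, with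
  -- ∫ r = R and ∫ P = 2Γ(H), it is the claim.
  have key : ∀ z, 0 ≤ carreDuChamp L (w z) (w z) p / r z - P z / R +
      r z * (carreDuChamp L H H p / R ^ 2) := by
    intro z
    have hq := hpos y hy fun i => chartGrad p (w z) y i / r z - chartGrad p H y i / R
    have hrz := (hr0 z).ne'
    have e : carreDuChamp L (w z) (w z) p / r z - P z / R +
        r z * (carreDuChamp L H H p / R ^ 2) =
        r z * ∑ i, ∑ j, A y i j * ((chartGrad p (w z) y i / r z - chartGrad p H y i / R) *
          (chartGrad p (w z) y j / r z - chartGrad p H y j / R)) := by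
      rw [h' _ (hw.contMDiff z), h' H hHs, hP]
      simp only [Finset.sum_div, Finset.mul_sum, ← Finset.sum_sub_distrib,
        ← Finset.sum_add_distrib]
      refine Finset.sum_congr rfl fun i _ => Finset.sum_congr rfl fun j _ => ?_
      have := hR.ne'
      field_simp
      ring
    rw [e]
    exact mul_nonneg (hr0 z).le hq
  have hI := integral_nonneg (μ := ν) (f := fun z => carreDuChamp L (w z) (w z) p / r z - P z / R +
      r z * (carreDuChamp L H H p / R ^ 2)) key
  rw [integral_add (f := fun z => carreDuChamp L (w z) (w z) p / r z - P z / R)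
    ((hint hcg').sub (hint (hPc.div_const R))) (hint (hr.mul_const _)),
    integral_sub (hint hcg') (hint (hPc.div_const R)), integral_div, hPi, integral_mul_const,
    ← hRdef] at hI
  have e2 : R * (carreDuChamp L H H p / R ^ 2) = carreDuChamp L H H p / R := by
    field_simp
  rw [e2] at hI
  have e3 : 2 * carreDuChamp L H H p / R = 2 * (carreDuChamp L H H p / R) := by ring
  rw [e3] at hI
  linarith

end Operator

end SmoothFamily

/-! ### The product manifold and its slices. -/

section PiManifold

variable {N : ℕ} {n : Fin N → ℕ} {E : Fin N → Type*} [∀ i, TopologicalSpace (E i)]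
  [∀ i, ChartedSpace (EuclideanSpace ℝ (Fin (n i))) (E i)] [∀ i, IsManifold (𝓡 (n i)) ∞ (E i)]

instance isManifold_pi :
    IsManifold (ModelWithCorners.pi fun i => 𝓡 (n i)) ∞ (∀ i, E i) := by
  refine isManifold_of_contDiffOn _ _ _ ?_
  rintro _ _ ⟨e, he, rfl⟩ ⟨e', he', rfl⟩
  rw [contDiffOn_pi]
  intro i
  have h := (contDiffGroupoid ∞ (𝓡 (n i))).compatible (he i (mem_univ i)) (he' i (mem_univ i))
  rw [contDiffGroupoid, mem_groupoid_of_pregroupoid] at h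
  have h1 : ContDiffOn ℝ ∞ (e' i ∘ (e i).symm) ((e i).symm.trans (e' i)).source := by
    have := h.1
    simp only [contDiffPregroupoid, modelWithCornersSelf_coe, range_id,
      modelWithCornersSelf_coe_symm, preimage_id, inter_univ] at this
    exact this
  refine h1.comp (f := fun t : ∀ j, EuclideanSpace ℝ (Fin (n j)) => t i)
    (ContinuousLinearMap.proj (R := ℝ)
      (φ := fun j => EuclideanSpace ℝ (Fin (n j))) i).contDiff.contDiffOn ?_
  rintro t ⟨ht, -⟩
  exact ⟨ht.1 i (mem_univ i), ht.2 i (mem_univ i)⟩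

theorem extChartAt_pi_target (x : ∀ i, E i) :
    (extChartAt (ModelWithCorners.pi fun i => 𝓡 (n i)) x).target =
      univ.pi fun i => (extChartAt (𝓡 (n i)) (x i)).target := by
  ext t
  rw [extChartAt_target]
  simp only [mem_inter_iff, Set.mem_pi, extChartAt_target,
    modelWithCornersSelf_coe, modelWithCornersSelf_coe_symm, range_id, preimage_id, inter_univ]
  exact ⟨fun h => h.1, fun h => ⟨h, ⟨t, rfl⟩⟩⟩

theorem contDiffOn_comp_pi_symm {u : (∀ i, E i) → ℝ}
    (hu : ContMDiff (ModelWithCorners.pi fun i => 𝓡 (n i)) 𝓘(ℝ, ℝ) ∞ u) (x : ∀ i, E i) :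
    ContDiffOn ℝ ∞ (fun t : ∀ i, EuclideanSpace ℝ (Fin (n i)) =>
      u fun i => (extChartAt (𝓡 (n i)) (x i)).symm (t i))
      (univ.pi fun i => (extChartAt (𝓡 (n i)) (x i)).target) := by
  rw [← extChartAt_pi_target, ← contMDiffOn_iff_contDiffOn]
  exact hu.comp_contMDiffOn (contMDiffOn_extChartAt_symm x)

theorem contDiffOn_path_comp_pi_symm {h : ℝ → (∀ i, E i) → ℝ} {J : Set ℝ}
    (hh : ContMDiffOn (𝓘(ℝ, ℝ).prod (ModelWithCorners.pi fun i => 𝓡 (n i))) 𝓘(ℝ, ℝ) ∞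
      (fun p : ℝ × (∀ i, E i) => h p.1 p.2) (J ×ˢ univ)) (x : ∀ i, E i) :
    ContDiffOn ℝ ∞ (fun q : ℝ × ∀ i, EuclideanSpace ℝ (Fin (n i)) =>
      h q.1 fun i => (extChartAt (𝓡 (n i)) (x i)).symm (q.2 i))
      (J ×ˢ univ.pi fun i => (extChartAt (𝓡 (n i)) (x i)).target) := by
  rw [← extChartAt_pi_target, ← contMDiffOn_iff_contDiffOn]
  have h1 := (contMDiffOn_extChartAt_symm (I := ModelWithCorners.pi fun i => 𝓡 (n i))
    (n := ∞) x).comp (contDiff_snd (𝕜 := ℝ) (E := ℝ) (n := ∞)).contMDiff.contMDiffOn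
      (s := J ×ˢ (extChartAt (ModelWithCorners.pi fun i => 𝓡 (n i)) x).target) fun q hq => hq.2
  have h2 := (contDiff_fst (𝕜 := ℝ) (E := ℝ) (F := ∀ i, EuclideanSpace ℝ (Fin (n i)))
    (n := ∞)).contMDiff.contMDiffOn
      (s := J ×ˢ (extChartAt (ModelWithCorners.pi fun i => 𝓡 (n i)) x).target)
  exact hh.comp (h2.prodMk h1) fun q hq => ⟨hq.1, mem_univ _⟩

theorem contDiff_update (i : Fin N) :
    ContDiff ℝ ∞ fun q : (∀ j, EuclideanSpace ℝ (Fin (n j))) × EuclideanSpace ℝ (Fin (n i)) =>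
      Function.update q.1 i q.2 := by
  rw [contDiff_pi]
  intro j
  rcases eq_or_ne j i with rfl | hj
  · simpa using contDiff_snd
  · simp only [Function.update_of_ne hj]
    exact (ContinuousLinearMap.proj (R := ℝ)
      (φ := fun j => EuclideanSpace ℝ (Fin (n j))) j).contDiff.comp contDiff_fst

/-- Product charts turn the replacement of a coordinate into the same replacement in ℝⁿ, which is
smooth; this reduces slices to `IsContDiffFamily.of_comp`. -/
theorem update_eq_charts (i : Fin N) (z₀ : ∀ j, E j) (x : E i) {z : ∀ j, E j}
    (hz : ∀ j, z j ∈ (extChartAt (𝓡 (n j)) (z₀ j)).source) (y : EuclideanSpace ℝ (Fin (n i))) :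
    Function.update z i ((extChartAt (𝓡 (n i)) x).symm y) =
      fun j => (extChartAt (𝓡 (n j)) (Function.update z₀ i x j)).symm
        (Function.update (fun j => extChartAt (𝓡 (n j)) (z₀ j) (z j)) i y j) := by
  ext j
  rcases eq_or_ne j i with rfl | hj
  · simp only [Function.update_self]
  · simp only [Function.update_of_ne hj]
    rw [(extChartAt (𝓡 (n j)) (z₀ j)).left_inv (hz j)]

theorem update_mem_target (i : Fin N) (z₀ : ∀ j, E j) (x : E i)
    {t : ∀ j, EuclideanSpace ℝ (Fin (n j))} {y : EuclideanSpace ℝ (Fin (n i))}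
    (ht : t ∈ univ.pi fun j => (extChartAt (𝓡 (n j)) (z₀ j)).target)
    (hy : y ∈ (extChartAt (𝓡 (n i)) x).target) :
    Function.update t i y ∈
      univ.pi fun j => (extChartAt (𝓡 (n j)) (Function.update z₀ i x j)).target := by
  intro j _
  rcases eq_or_ne j i with rfl | hj
  · simpa only [Function.update_self] using hy
  · simpa only [Function.update_of_ne hj] using ht j (mem_univ j)

theorem setOf_mem_chart_source_mem_nhds (z₀ : ∀ j, E j) :
    {z : ∀ j, E j | ∀ j, z j ∈ (extChartAt (𝓡 (n j)) (z₀ j)).source} ∈ 𝓝 z₀ := by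
  have := set_pi_mem_nhds (finite_univ (α := Fin N)) (x := z₀)
    (s := fun j => (extChartAt (𝓡 (n j)) (z₀ j)).source)
    fun j _ => extChartAt_source_mem_nhds (z₀ j)
  simpa [Set.pi] using this

theorem continuousOn_charts (z₀ : ∀ j, E j) :
    ContinuousOn (fun (z : ∀ j, E j) j => extChartAt (𝓡 (n j)) (z₀ j) (z j))
      {z | ∀ j, z j ∈ (extChartAt (𝓡 (n j)) (z₀ j)).source} :=
  continuousOn_pi.2 fun j => (continuousOn_extChartAt (z₀ j)).comp
    (continuous_apply j).continuousOn fun _ hz => hz j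

theorem isOpen_pi_target (z₀ : ∀ j, E j) :
    IsOpen (univ.pi fun j => (extChartAt (𝓡 (n j)) (z₀ j)).target) :=
  isOpen_set_pi finite_univ fun j _ => isOpen_target (z₀ j)

/-- The slices of a smooth function on the product in the direction of the factor `i`, indexed by
the points of the product. -/
theorem isSmoothFamily_slice {u : (∀ i, E i) → ℝ}
    (hu : ContMDiff (ModelWithCorners.pi fun i => 𝓡 (n i)) 𝓘(ℝ, ℝ) ∞ u) (i : Fin N) :
    IsSmoothFamily (n i) fun z : (∀ j, E j) => slice u z i := by
  intro x k
  refine IsContDiffFamily.of_local fun z₀ => ⟨_, setOf_mem_chart_source_mem_nhds (n := n) z₀, ?_⟩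
  have h1 := (contDiffOn_comp_pi_symm hu (Function.update z₀ i x)).comp
    (contDiff_update i).contDiffOn (s := (univ.pi fun j => (extChartAt (𝓡 (n j)) (z₀ j)).target) ×ˢ
      (extChartAt (𝓡 (n i)) x).target) fun q hq => update_mem_target i z₀ x hq.1 hq.2
  refine IsContDiffFamily.of_comp (isOpen_pi_target (n := n) z₀).uniqueDiffOn
    (isOpen_target x).uniqueDiffOn (continuousOn_charts (n := n) z₀)
    (fun z hz j _ => (extChartAt (𝓡 (n j)) (z₀ j)).map_source (hz j))
    (h1.of_le (by exact_mod_cast le_top)) fun z hz y _ => ?_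
  simp only [slice, Function.comp_apply]
  rw [update_eq_charts i z₀ x hz y]

/-- Time and the i-th chart variable are differentiated jointly, the point of the product being the
parameter, so averages are smooth up to both ends of the time interval. -/
theorem isContDiffFamily_path {h : ℝ → (∀ i, E i) → ℝ}
    (hh : ContMDiffOn (𝓘(ℝ, ℝ).prod (ModelWithCorners.pi fun i => 𝓡 (n i))) 𝓘(ℝ, ℝ) ∞
      (fun p : ℝ × (∀ i, E i) => h p.1 p.2) (Icc 0 1 ×ˢ univ)) (i : Fin N) (x : E i) (k : ℕ) :
    IsContDiffFamily k (fun (z : ∀ j, E j) (q : ℝ × EuclideanSpace ℝ (Fin (n i))) =>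
      h q.1 (Function.update z i ((extChartAt (𝓡 (n i)) x).symm q.2))) univ
      (Icc 0 1 ×ˢ (extChartAt (𝓡 (n i)) x).target) := by
  refine IsContDiffFamily.of_local fun z₀ => ⟨_, setOf_mem_chart_source_mem_nhds (n := n) z₀, ?_⟩
  have h0 : ContDiff ℝ ∞ fun q : (∀ j, EuclideanSpace ℝ (Fin (n j))) ×
      (ℝ × EuclideanSpace ℝ (Fin (n i))) => (q.2.1, Function.update q.1 i q.2.2) :=
    (contDiff_fst.comp contDiff_snd).prodMk ((contDiff_update i).comp
      (contDiff_fst.prodMk (contDiff_snd.comp contDiff_snd)))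
  have h1 := (contDiffOn_path_comp_pi_symm hh (Function.update z₀ i x)).comp
    h0.contDiffOn (s := (univ.pi fun j => (extChartAt (𝓡 (n j)) (z₀ j)).target) ×ˢ
      (Icc (0 : ℝ) 1 ×ˢ (extChartAt (𝓡 (n i)) x).target))
      fun q hq => ⟨hq.2.1, update_mem_target i z₀ x hq.1 hq.2.2⟩
  refine IsContDiffFamily.of_comp (isOpen_pi_target (n := n) z₀).uniqueDiffOn
    ((uniqueDiffOn_Icc zero_lt_one).prod (isOpen_target x).uniqueDiffOn) (continuousOn_charts (n := n) z₀)
    (fun z hz j _ => (extChartAt (𝓡 (n j)) (z₀ j)).map_source (hz j))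
    (h1.of_le (by exact_mod_cast le_top)) fun z hz q _ => ?_
  simp only [Function.comp_apply]
  rw [update_eq_charts i z₀ x hz q.2]

theorem contMDiff_of_path {h : ℝ → (∀ i, E i) → ℝ}
    (hh : ContMDiffOn (𝓘(ℝ, ℝ).prod (ModelWithCorners.pi fun i => 𝓡 (n i))) 𝓘(ℝ, ℝ) ∞
      (fun p : ℝ × (∀ i, E i) => h p.1 p.2) (Icc 0 1 ×ˢ univ)) {s : ℝ} (hs : s ∈ Icc (0 : ℝ) 1) :
    ContMDiff (ModelWithCorners.pi fun i => 𝓡 (n i)) 𝓘(ℝ, ℝ) ∞ (h s) := by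
  rw [← contMDiffOn_univ]
  exact hh.comp (f := fun x => (s, x)) ((contMDiffOn_const).prodMk contMDiffOn_id)
    fun x _ => ⟨hs, mem_univ x⟩

end PiManifold

section PathOfCharts

variable {n : ℕ} {M : Type*} [TopologicalSpace M]
  [ChartedSpace (EuclideanSpace ℝ (Fin n)) M] [IsManifold (𝓡 n) ∞ M]

theorem contMDiffOn_path_of_charts {h : ℝ → M → ℝ} {J : Set ℝ}
    (hh : ∀ x : M, ContDiffOn ℝ ∞ (fun q : ℝ × EuclideanSpace ℝ (Fin n) =>
      h q.1 ((extChartAt (𝓡 n) x).symm q.2)) (J ×ˢ (extChartAt (𝓡 n) x).target)) :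
    ContMDiffOn (𝓘(ℝ, ℝ).prod (𝓡 n)) 𝓘(ℝ, ℝ) ∞ (fun p : ℝ × M => h p.1 p.2) (J ×ˢ univ) := by
  rintro ⟨s, x⟩ ⟨hs, -⟩
  have h1 : ContMDiffOn (𝓘(ℝ, ℝ).prod (𝓡 n)) 𝓘(ℝ, ℝ × EuclideanSpace ℝ (Fin n)) ∞
      (fun p : ℝ × M => (p.1, extChartAt (𝓡 n) x p.2)) (J ×ˢ (extChartAt (𝓡 n) x).source) :=
    contMDiffOn_fst.prodMk_space ((contMDiffOn_extChartAt (I := 𝓡 n) (x := x)).comp contMDiffOn_snd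
      fun q hq => by simpa [extChartAt_source] using hq.2)
  have h2 := (hh x).contMDiffOn.comp h1
    fun q hq => ⟨hq.1, (extChartAt (𝓡 n) x).map_source hq.2⟩
  have h3 := (h2.congr (f₁ := fun p : ℝ × M => h p.1 p.2) fun q hq => by
    simp only [Function.comp_apply, (extChartAt (𝓡 n) x).left_inv hq.2])
      (s, x) ⟨hs, mem_extChartAt_source x⟩
  refine h3.mono_of_mem_nhdsWithin ?_
  rw [nhdsWithin_prod_eq, nhdsWithin_univ]
  exact prod_mem_prod self_mem_nhdsWithin (extChartAt_source_mem_nhds x)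

end PathOfCharts

/-! ### Resampling a coordinate of a product measure. -/

section ProductMeasure

variable {ι : Type*} [Fintype ι] [DecidableEq ι] {E : ι → Type*} [∀ i, MeasurableSpace (E i)]

theorem measurable_update_prod (i : ι) :
    Measurable fun q : (∀ j, E j) × E i => Function.update q.1 i q.2 := by
  rw [measurable_pi_iff]
  intro j
  rcases eq_or_ne j i with rfl | hj
  · simpa using measurable_snd
  · simp only [Function.update_of_ne hj]
    exact (measurable_pi_apply j).comp measurable_fst

/-- Resampling one coordinate of a product measure. -/
theorem map_update_prod (ν : ∀ i, Measure (E i)) [∀ i, IsProbabilityMeasure (ν i)] (i : ι)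
    (κ : Measure (E i)) [IsProbabilityMeasure κ] :
    ((Measure.pi ν).prod κ).map (fun q => Function.update q.1 i q.2) =
      Measure.pi (Function.update ν i κ) := by
  have : ∀ j, IsProbabilityMeasure (Function.update ν i κ j) := by
    intro j
    rcases eq_or_ne j i with rfl | hj
    · simpa using ‹IsProbabilityMeasure κ›
    · rw [Function.update_of_ne hj]; infer_instance
  symm
  refine Measure.pi_eq fun s hs => ?_
  rw [Measure.map_apply (measurable_update_prod i) (MeasurableSet.univ_pi hs)]
  -- The old i-th coordinate is overwritten, so it is unconstrained.
  have hpre : (fun q : (∀ j, E j) × E i => Function.update q.1 i q.2) ⁻¹' univ.pi s =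
      (univ.pi (Function.update s i univ)) ×ˢ s i := by
    ext ⟨z, y⟩
    simp only [mem_preimage, Set.mem_pi, mem_univ, forall_const, mem_prod]
    constructor
    · intro h
      refine ⟨fun j => ?_, by simpa using h i⟩
      rcases eq_or_ne j i with rfl | hj
      · simp
      · simpa only [Function.update_of_ne hj] using h j
    · rintro ⟨h, h'⟩ j
      rcases eq_or_ne j i with rfl | hj
      · simpa using h'
      · simpa only [Function.update_of_ne hj] using h j
  rw [hpre, Measure.prod_prod, Measure.pi_pi, ← Finset.mul_prod_erase _ _ (Finset.mem_univ i),
    ← Finset.mul_prod_erase (a := i) Finset.univ (fun j => Function.update ν i κ j (s j))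
      (Finset.mem_univ i)]
  simp only [Function.update_self, measure_univ, one_mul]
  rw [mul_comm]
  congr 1
  refine Finset.prod_congr rfl fun j hj => ?_
  rw [Function.update_of_ne (Finset.ne_of_mem_erase hj),
    Function.update_of_ne (Finset.ne_of_mem_erase hj)]

theorem map_update_prod_self (μ : ∀ i, Measure (E i)) [∀ i, IsProbabilityMeasure (μ i)] (i : ι) :
    ((Measure.pi μ).prod (μ i)).map (fun q => Function.update q.1 i q.2) = Measure.pi μ := by
  rw [map_update_prod, Function.update_eq_self]

theorem lintegral_pi_eq_lintegral_update (μ : ∀ i, Measure (E i))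
    [∀ i, IsProbabilityMeasure (μ i)] (i : ι) {f : (∀ i, E i) → ℝ≥0∞} (hf : Measurable f) :
    ∫⁻ x, f x ∂(Measure.pi μ) =
      ∫⁻ z, ∫⁻ y, f (Function.update z i y) ∂(μ i) ∂(Measure.pi μ) := by
  conv_lhs => rw [← map_update_prod_self μ i]
  rw [lintegral_map hf (measurable_update_prod i)]
  exact lintegral_prod _ (hf.comp (measurable_update_prod i)).aemeasurable

theorem integral_pi_eq_integral_update (μ : ∀ i, Measure (E i))
    [∀ i, IsProbabilityMeasure (μ i)] (i : ι) {f : (∀ i, E i) → ℝ}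
    (hf : Integrable f (Measure.pi μ)) :
    ∫ x, f x ∂(Measure.pi μ) =
      ∫ z, ∫ y, f (Function.update z i y) ∂(μ i) ∂(Measure.pi μ) := by
  have hm := (measurable_update_prod (E := E) i).aemeasurable (μ := (Measure.pi μ).prod (μ i))
  rw [← map_update_prod_self μ i] at hf
  conv_lhs => rw [← map_update_prod_self μ i]
  rw [integral_map hm hf.aestronglyMeasurable, integral_prod]
  exact (integrable_map_measure hf.aestronglyMeasurable hm).1 hf

/-- Coordinates are independent under a product of probability measures. -/
theorem lintegral_pi_prod (μ : ∀ i, Measure (E i)) [∀ i, IsProbabilityMeasure (μ i)]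
    {f : ∀ i, E i → ℝ≥0∞} (hf : ∀ i, Measurable (f i)) :
    ∫⁻ x, ∏ i, f i (x i) ∂(Measure.pi μ) = ∏ i, ∫⁻ y, f i y ∂(μ i) := by
  rw [lintegral_prod_eq_prod_lintegral_of_indepFun Finset.univ (fun i (x : ∀ i, E i) => f i (x i))
    (iIndepFun_pi fun i => (hf i).aemeasurable) fun i => (hf i).comp (measurable_pi_apply i)]
  refine Finset.prod_congr rfl fun i _ => ?_
  exact (measurePreserving_eval μ i).lintegral_comp (hf i)

end ProductMeasure

/-! ### Products of Markov kernels. -/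

section ProductKernel

variable {ι : Type*} [Fintype ι] {E : ι → Type*} [∀ i, MeasurableSpace (E i)]

/-- The product of Markov kernels on the factors of a product. -/
def prodKernel (κ : ∀ i, Kernel (E i) (E i)) [∀ i, IsMarkovKernel (κ i)] :
    Kernel (∀ i, E i) (∀ i, E i) where
  toFun x := Measure.pi fun i => κ i (x i)
  measurable' := by
    refine Measurable.measure_of_isPiSystem_of_isProbabilityMeasure generateFrom_pi.symm
      isPiSystem_pi ?_
    rintro _ ⟨s, hs, rfl⟩
    simp only [Measure.pi_pi]
    exact Finset.measurable_prod _ fun i _ =>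
      ((κ i).measurable_coe (hs i (mem_univ i))).comp (measurable_pi_apply i)

variable (κ η : ∀ i, Kernel (E i) (E i)) [∀ i, IsMarkovKernel (κ i)] [∀ i, IsMarkovKernel (η i)]

theorem prodKernel_apply (x : ∀ i, E i) : prodKernel κ x = Measure.pi fun i => κ i (x i) := rfl

instance isMarkovKernel_prodKernel : IsMarkovKernel (prodKernel κ) :=
  ⟨fun x => by rw [prodKernel_apply]; infer_instance⟩

theorem prodKernel_congr (h : ∀ i, κ i = η i) : prodKernel κ = prodKernel η := by
  ext1 x
  simp only [prodKernel_apply, h]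

/-- Boxes determine the measures, and the mass of a box is a product of functions of separate
variables, whose integral factors. -/
theorem prodKernel_comp [DecidableEq ι] :
    prodKernel κ ∘ₖ prodKernel η = prodKernel fun i => κ i ∘ₖ η i := by
  ext1 x
  rw [prodKernel_apply]
  symm
  refine Measure.pi_eq fun s hs => ?_
  rw [Kernel.comp_apply' _ _ _ (MeasurableSet.univ_pi hs), prodKernel_apply]
  simp only [prodKernel_apply, Measure.pi_pi]
  rw [lintegral_pi_prod (fun i => η i (x i)) fun i => (κ i).measurable_coe (hs i)]
  exact Finset.prod_congr rfl fun i _ => (Kernel.comp_apply' _ _ _ (hs i)).symm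

theorem prodKernel_id : prodKernel (fun i => (Kernel.id : Kernel (E i) (E i))) = Kernel.id := by
  ext1 x
  rw [prodKernel_apply]
  refine Measure.pi_eq fun s hs => ?_
  simp only [Kernel.id_apply]
  rw [Measure.dirac_apply' _ (MeasurableSet.univ_pi hs)]
  simp only [Measure.dirac_apply' _ (hs _)]
  classical
  by_cases h : x ∈ univ.pi s
  · rw [indicator_of_mem h, Pi.one_apply]
    exact (Finset.prod_eq_one fun i _ => by rw [indicator_of_mem (h i (mem_univ i)), Pi.one_apply]).symm
  · rw [indicator_of_notMem h]
    simp only [Set.mem_pi, mem_univ, forall_const, not_forall] at h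
    obtain ⟨i, hi⟩ := h
    exact (Finset.prod_eq_zero (Finset.mem_univ i) (indicator_of_notMem hi _)).symm

end ProductKernel

/-! ### Reversibility of kernels. -/

section Reversible

/-- For a fixed set A both sides are finite measures in B, so agreement on a π-system extends to all
B. This is used twice, once for each of the two sets. -/
theorem isReversible_of_isPiSystem {α : Type*} [m : MeasurableSpace α] {C : Set (Set α)}
    (hC : IsPiSystem C) (hgen : m = MeasurableSpace.generateFrom C) (huniv : univ ∈ C)
    {κ : Kernel α α} [IsMarkovKernel κ] {π : Measure α} [IsFiniteMeasure π]
    (h : ∀ A ∈ C, ∀ B ∈ C, ∫⁻ x in A, κ x B ∂π = ∫⁻ x in B, κ x A ∂π) :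
    Kernel.IsReversible κ π := by
  have hCm : ∀ A ∈ C, MeasurableSet A := fun A hA => by
    rw [hgen]; exact MeasurableSpace.measurableSet_generateFrom hA
  have key : ∀ A, MeasurableSet A → (∀ B ∈ C, ∫⁻ x in A, κ x B ∂π = ∫⁻ x in B, κ x A ∂π) →
      ∀ B, MeasurableSet B → ∫⁻ x in A, κ x B ∂π = ∫⁻ x in B, κ x A ∂π := by
    intro A hA hAC
    have e1 : ∀ {B}, MeasurableSet B → ((π.restrict A).bind κ) B = ∫⁻ x in A, κ x B ∂π :=
      fun hB => Measure.bind_apply hB κ.aemeasurable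
    have e2 : ∀ {B}, MeasurableSet B → (π.withDensity fun x => κ x A) B = ∫⁻ x in B, κ x A ∂π :=
      fun hB => withDensity_apply _ hB
    have hext : (π.restrict A).bind κ = π.withDensity fun x => κ x A := by
      refine ext_of_generate_finite C hgen hC (fun B hB => ?_) ?_
      · rw [e1 (hCm B hB), e2 (hCm B hB), hAC B hB]
      · rw [e1 .univ, e2 .univ, hAC _ huniv]
    intro B hB
    rw [← e1 hB, ← e2 hB, hext]
  intro A B hA hB
  refine key A hA (fun B hB => ?_) B hB
  exact (key B (hCm B hB) (fun A hA => h B hB A hA) A hA).symm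

theorem isReversible_prodKernel {ι : Type*} [Fintype ι] [DecidableEq ι] {E : ι → Type*}
    [∀ i, MeasurableSpace (E i)] {κ : ∀ i, Kernel (E i) (E i)} [∀ i, IsMarkovKernel (κ i)]
    {μ : ∀ i, Measure (E i)} [∀ i, IsProbabilityMeasure (μ i)]
    (h : ∀ i, Kernel.IsReversible (κ i) (μ i)) :
    Kernel.IsReversible (prodKernel κ) (Measure.pi μ) := by
  refine isReversible_of_isPiSystem isPiSystem_pi generateFrom_pi.symm
    ⟨fun _ => univ, fun i _ => MeasurableSet.univ, by simp⟩ ?_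
  have e : ∀ s t : ∀ i, Set (E i), (∀ i, MeasurableSet (s i)) → (∀ i, MeasurableSet (t i)) →
      ∫⁻ x in univ.pi s, prodKernel κ x (univ.pi t) ∂(Measure.pi μ) =
        ∏ i, ∫⁻ y in s i, κ i y (t i) ∂(μ i) := by
    intro s t hs ht
    rw [← lintegral_indicator (MeasurableSet.univ_pi hs)]
    have : ∀ x : ∀ i, E i, (univ.pi s).indicator (fun x => prodKernel κ x (univ.pi t)) x =
        ∏ i, (s i).indicator (fun y => κ i y (t i)) (x i) := by
      intro x
      by_cases hx : x ∈ univ.pi s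
      · rw [indicator_of_mem hx, prodKernel_apply, Measure.pi_pi]
        exact Finset.prod_congr rfl fun i _ =>
          (indicator_of_mem (hx i (mem_univ i)) fun y => κ i y (t i)).symm
      · rw [indicator_of_notMem hx]
        simp only [Set.mem_pi, mem_univ, forall_const, not_forall] at hx
        obtain ⟨i, hi⟩ := hx
        exact (Finset.prod_eq_zero (Finset.mem_univ i) (indicator_of_notMem hi _)).symm
    rw [lintegral_congr this, lintegral_pi_prod μ fun i =>
      ((κ i).measurable_coe (ht i)).indicator (hs i)]
    exact Finset.prod_congr rfl fun i _ => lintegral_indicator (hs i) _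
  rintro _ ⟨s, hs, rfl⟩ _ ⟨t, ht, rfl⟩
  rw [e s t (fun i => hs i (mem_univ i)) fun i => ht i (mem_univ i),
    e t s (fun i => ht i (mem_univ i)) fun i => hs i (mem_univ i)]
  exact Finset.prod_congr rfl fun i _ => h i (hs i (mem_univ i)) (ht i (mem_univ i))

theorem isReversible_id {α : Type*} [MeasurableSpace α] (π : Measure α) :
    Kernel.IsReversible Kernel.id π := by
  intro A B hA hB
  simp only [Kernel.id_apply, Measure.dirac_apply' _ hA, Measure.dirac_apply' _ hB]
  rw [lintegral_indicator_one hB, lintegral_indicator_one hA, Measure.restrict_apply hB,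
    Measure.restrict_apply hA, inter_comm]

/-- The symmetry of the action of a reversible kernel. -/
theorem IsReversible.integral_mul_act {α : Type*} [MeasurableSpace α] {κ : Kernel α α}
    [IsMarkovKernel κ] {π : Measure α} [IsFiniteMeasure π] (h : Kernel.IsReversible κ π)
    {u v : α → ℝ} (hu : Measurable u) (hv : Measurable v) {C D : ℝ} (hC : ∀ x, |u x| ≤ C)
    (hD : ∀ x, |v x| ≤ D) :
    ∫ x, u x * ∫ y, v y ∂(κ x) ∂π = ∫ x, v x * ∫ y, u y ∂(κ x) ∂π := by
  -- Reversibility is the symmetry of the joint law of one step started from `π`.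
  have hsym : (π ⊗ₘ κ).map Prod.swap = π ⊗ₘ κ := by
    refine Measure.ext_prod fun {s t} hs ht => ?_
    rw [Measure.map_apply measurable_swap (hs.prod ht), Set.preimage_swap_prod,
      Measure.compProd_apply_prod ht hs, Measure.compProd_apply_prod hs ht]
    exact (h hs ht).symm
  have hint : ∀ {a b : α → ℝ} {A B : ℝ}, Measurable a → Measurable b → (∀ x, |a x| ≤ A) →
      (∀ x, |b x| ≤ B) → Integrable (fun q : α × α => a q.1 * b q.2) (π ⊗ₘ κ) := by
    intro a b A B ha hb hA hB
    refine Integrable.of_bound (by fun_prop) (A * B) (ae_of_all _ fun q => ?_)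
    rw [norm_mul]
    exact mul_le_mul (hA _) (hB _) (abs_nonneg _) ((abs_nonneg _).trans (hA q.1))
  have e : ∀ {a b : α → ℝ} {A B : ℝ}, Measurable a → Measurable b → (∀ x, |a x| ≤ A) →
      (∀ x, |b x| ≤ B) →
      ∫ x, a x * ∫ y, b y ∂(κ x) ∂π = ∫ q, a q.1 * b q.2 ∂(π ⊗ₘ κ) := by
    intro a b A B ha hb hA hB
    rw [Measure.integral_compProd (hint ha hb hA hB)]
    simp only [integral_const_mul]
  rw [e hu hv hC hD, e hv hu hD hC]
  conv_lhs => rw [← hsym]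
  rw [integral_map measurable_swap.aemeasurable
    (by rw [hsym]; exact (hint hu hv hC hD).aestronglyMeasurable)]
  simp [mul_comm]

end Reversible

/-- Slicing commutes with products, and the slice of w through x takes the value w x at the base
point; the identity then holds term by term, for arbitrary functions. -/
theorem carreDuChamp_sumOperator {ι : Type*} [Fintype ι] [DecidableEq ι] {E : ι → Type*}
    (L : ∀ i, (E i → ℝ) → E i → ℝ) (u v : (∀ i, E i) → ℝ) :
    carreDuChamp (sumOperator L) u v = sumBilinear (fun i => carreDuChamp (L i)) u v := by
  funext x
  have hs : ∀ (w : (∀ i, E i) → ℝ) i, slice w x i (x i) = w x := fun w i => by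
    rw [slice, Function.update_eq_self]
  simp only [carreDuChamp, sumOperator, sumBilinear, hs]
  rw [Finset.mul_sum, Finset.mul_sum, ← Finset.sum_sub_distrib, ← Finset.sum_sub_distrib,
    Finset.mul_sum]
  rfl

theorem slice_update_self {ι : Type*} [DecidableEq ι] {E : ι → Type*} (u : (∀ i, E i) → ℝ)
    (z : ∀ i, E i) (i : ι) (y : E i) : slice u (Function.update z i y) i = slice u z i := by
  funext w
  rw [slice, slice, Function.update_idem]

theorem slice_update_update {ι : Type*} [DecidableEq ι] {E : ι → Type*} (u : (∀ i, E i) → ℝ)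
    (z : ∀ i, E i) {i j : ι} (hij : j ≠ i) (y : E i) (w : E j) :
    slice u (Function.update (Function.update z j w) i y) j =
      slice u (Function.update z i y) j := by
  rw [Function.update_comm hij, slice_update_self]

/-! ### Averaging of admissible paths and the transport inequality. -/

section Tensorization

variable {N : ℕ} {n : Fin N → ℕ} {E : Fin N → Type*}
  [∀ i, TopologicalSpace (E i)] [∀ i, CompactSpace (E i)]
  [∀ i, SecondCountableTopology (E i)]
  [∀ i, ChartedSpace (EuclideanSpace ℝ (Fin (n i))) (E i)] [∀ i, IsManifold (𝓡 (n i)) ∞ (E i)]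
  [∀ i, MeasurableSpace (E i)] [∀ i, BorelSpace (E i)]
  {μ : ∀ i, Measure (E i)} [∀ i, IsProbabilityMeasure (μ i)] {L : ∀ i, (E i → ℝ) → E i → ℝ}

/-- The function of the variable `i` obtained by averaging over the other variables. -/
def marginal (μ : ∀ i, Measure (E i)) (i : Fin N) (u : (∀ i, E i) → ℝ) (y : E i) : ℝ :=
  ∫ z, slice u z i y ∂(Measure.pi μ)

theorem integrable_pi {f : (∀ i, E i) → ℝ} (hf : Continuous f) : Integrable f (Measure.pi μ) :=
  integrable_of_continuous_of_compactSpace _ hf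

theorem continuous_slice {u : (∀ i, E i) → ℝ} (hu : Continuous u) (i : Fin N) :
    Continuous fun q : (∀ j, E j) × E i => slice u q.1 i q.2 :=
  hu.comp (continuous_fst.update i continuous_snd)

theorem integral_marginal {u : (∀ i, E i) → ℝ} (hu : Continuous u) (i : Fin N) :
    ∫ y, marginal μ i u y ∂(μ i) = ∫ x, u x ∂(Measure.pi μ) := by
  rw [integral_pi_eq_integral_update μ i (integrable_pi hu)]
  exact integral_integral_swap (f := fun y z => slice u z i y)
    (integrable_of_continuous_of_compactSpace _
      ((continuous_slice hu i).comp (continuous_snd.prodMk continuous_fst)))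

theorem integral_pos_of_continuous_pos {Z : Type*} [TopologicalSpace Z] [CompactSpace Z]
    [SecondCountableTopology Z] [MeasurableSpace Z] [BorelSpace Z] (ν : Measure Z)
    [IsProbabilityMeasure ν] {f : Z → ℝ} (hf : Continuous f) (h0 : ∀ z, 0 < f z) :
    0 < ∫ z, f z ∂ν := by
  rw [integral_pos_iff_support_of_nonneg (fun z => (h0 z).le)
    (integrable_of_continuous_of_compactSpace ν hf)]
  have : Function.support f = univ := eq_univ_of_forall fun z => (h0 z).ne'
  simp [this]

theorem contMDiff_marginal {u : (∀ i, E i) → ℝ}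
    (hu : ContMDiff (ModelWithCorners.pi fun i => 𝓡 (n i)) 𝓘(ℝ, ℝ) ∞ u) (i : Fin N) :
    ContMDiff (𝓡 (n i)) 𝓘(ℝ, ℝ) ∞ (marginal μ i u) :=
  (isSmoothFamily_slice hu i).contMDiff_integral (Measure.pi μ)

theorem IsDensity.marginal {ρ : (∀ i, E i) → ℝ}
    (hρ : IsDensity (ModelWithCorners.pi fun i => 𝓡 (n i)) (Measure.pi μ) ρ) (i : Fin N) :
    IsDensity (𝓡 (n i)) (μ i) (marginal μ i ρ) where
  smooth := contMDiff_marginal hρ.smooth i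
  pos y := integral_pos_of_continuous_pos _
    ((continuous_slice hρ.smooth.continuous i).comp (Continuous.prodMk_left y))
    fun _ => hρ.pos _
  integral_eq_one := (integral_marginal hρ.smooth.continuous i).trans hρ.integral_eq_one

/-- In the slice the i-th factor is a constant, and each other factor integrates to 1. -/
theorem marginal_prod {f : ∀ i, E i → ℝ} (hf : ∀ i, IsDensity (𝓡 (n i)) (μ i) (f i))
    (i : Fin N) : marginal μ i (fun x => ∏ j, f j (x j)) = f i := by
  funext y
  have h : ∀ z : ∀ j, E j, slice (fun x => ∏ j, f j (x j)) z i y =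
      ∏ j, Function.update f i (fun _ => f i y) j (z j) := by
    intro z
    refine Finset.prod_congr rfl fun j _ => ?_
    rcases eq_or_ne j i with rfl | hj
    · simp
    · simp only [Function.update_of_ne hj]
  simp only [marginal, h]
  rw [integral_fintype_prod_eq_prod, Finset.prod_eq_single i]
  · simp
  · intro j _ hj
    rw [Function.update_of_ne hj, (hf j).integral_eq_one]
  · simp

/-- `L` acts continuously along the points of the product. -/
theorem continuous_slice_operator (hL : ∀ i, IsDiffusion (n i) (μ i) (L i)) {u : (∀ i, E i) → ℝ}
    (hu : ContMDiff (ModelWithCorners.pi fun i => 𝓡 (n i)) 𝓘(ℝ, ℝ) ∞ u) (i : Fin N) :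
    Continuous fun q : (∀ j, E j) × E i => L i (slice u q.1 i) q.2 :=
  (hL i).continuous_family (isSmoothFamily_slice hu i)

/-- Averaging over the other variables intertwines `⊕ L_j` and `L_i`. -/
theorem integral_sumOperator (hL : ∀ i, IsDiffusion (n i) (μ i) (L i)) {u : (∀ i, E i) → ℝ}
    (hu : ContMDiff (ModelWithCorners.pi fun i => 𝓡 (n i)) 𝓘(ℝ, ℝ) ∞ u) (i : Fin N) (y : E i) :
    ∫ z, sumOperator L u (Function.update z i y) ∂(Measure.pi μ) = L i (marginal μ i u) y := by
  have hc : ∀ j, Continuous fun z : ∀ j, E j =>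
      L j (slice u (Function.update z i y) j) (Function.update z i y j) := fun j => by
    have hup : Continuous fun z : ∀ j, E j => Function.update z i y :=
      continuous_id.update i continuous_const
    exact (continuous_slice_operator hL hu j).comp
      (hup.prodMk ((continuous_apply j).comp hup))
  simp only [sumOperator]
  rw [integral_finsetSum _ fun j _ => integrable_pi (hc j), Finset.sum_eq_single i]
  · simp only [slice_update_self, Function.update_self]
    exact ((hL i).apply_integral (Measure.pi μ) (isSmoothFamily_slice hu i) y).symm
  -- Resampling the j-th coordinate exhibits an inner integral of L_j of a smooth function, which
  -- vanishes.
  · intro j _ hj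
    rw [integral_pi_eq_integral_update μ j (integrable_pi (hc j))]
    refine integral_eq_zero_of_ae (ae_of_all _ fun z => ?_)
    simp only [slice_update_update u z hj, Function.update_of_ne hj, Function.update_self,
      Pi.zero_apply]
    exact (hL j).integral_eq_zero _ ((isSmoothFamily_slice hu j).contMDiff _)
  · simp

theorem exists_convex_inter_Icc_prod {X : Type*} [NormedAddCommGroup X] [NormedSpace ℝ X]
    {T : Set X} (hT : IsOpen T) :
    ∀ q ∈ Icc (0 : ℝ) 1 ×ˢ T, ∃ U ∈ 𝓝 q, Convex ℝ ((Icc (0 : ℝ) 1 ×ˢ T) ∩ U) := by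
  rintro ⟨s, y⟩ ⟨_, hy⟩
  obtain ⟨U, hU, hc⟩ := exists_convex_inter_of_isOpen hT y hy
  refine ⟨univ ×ˢ U, prod_mem_nhds univ_mem hU, ?_⟩
  rw [prod_inter_prod, inter_univ]
  exact (convex_Icc 0 1).prod hc

theorem contMDiffOn_marginal_path {h : ℝ → (∀ i, E i) → ℝ}
    (hh : ContMDiffOn (𝓘(ℝ, ℝ).prod (ModelWithCorners.pi fun i => 𝓡 (n i))) 𝓘(ℝ, ℝ) ∞
      (fun p : ℝ × (∀ i, E i) => h p.1 p.2) (Icc 0 1 ×ˢ univ)) (i : Fin N) :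
    ContMDiffOn (𝓘(ℝ, ℝ).prod (𝓡 (n i))) 𝓘(ℝ, ℝ) ∞
      (fun p : ℝ × E i => marginal μ i (h p.1) p.2) (Icc 0 1 ×ˢ univ) :=
  contMDiffOn_path_of_charts (h := fun s => marginal μ i (h s)) fun x =>
    contDiffOn_infty.2 fun k => (isContDiffFamily_path hh i x k).contDiffOn_integral _
      ((uniqueDiffOn_Icc zero_lt_one).prod (isOpen_target x).uniqueDiffOn)
      (exists_convex_inter_Icc_prod (isOpen_target x))

/-- Differentiation under the integral along a line in the time direction; uniqueness of derivatives
on the interval identifies the integrand with h'. -/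
theorem hasDerivWithinAt_marginal {h : ℝ → (∀ i, E i) → ℝ}
    (hh : ContMDiffOn (𝓘(ℝ, ℝ).prod (ModelWithCorners.pi fun i => 𝓡 (n i))) 𝓘(ℝ, ℝ) ∞
      (fun p : ℝ × (∀ i, E i) => h p.1 p.2) (Icc 0 1 ×ˢ univ)) {s : ℝ} (hs : s ∈ Icc (0 : ℝ) 1)
    {h' : (∀ i, E i) → ℝ} (hd : ∀ x, HasDerivWithinAt (fun r => h r x) (h' x) (Icc 0 1) s)
    (i : Fin N) (y : E i) :
    HasDerivWithinAt (fun r => marginal μ i (h r) y) (marginal μ i h' y) (Icc 0 1) s := by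
  set S := Icc (0 : ℝ) 1 ×ˢ (extChartAt (𝓡 (n i)) y).target with hS
  set q : ℝ × EuclideanSpace ℝ (Fin (n i)) := (s, extChartAt (𝓡 (n i)) y y) with hq
  have hqS : q ∈ S := ⟨hs, mem_extChartAt_target y⟩
  set G : (∀ j, E j) → ℝ × EuclideanSpace ℝ (Fin (n i)) → ℝ := fun z q =>
    h q.1 (Function.update z i ((extChartAt (𝓡 (n i)) y).symm q.2)) with hG
  have hfam : IsContDiffFamily 1 G univ S := isContDiffFamily_path hh i y 1
  have hline : HasDerivWithinAt (fun r : ℝ => (r, extChartAt (𝓡 (n i)) y y))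
      ((1 : ℝ), (0 : EuclideanSpace ℝ (Fin (n i)))) (Icc 0 1) s :=
    (hasDerivWithinAt_id s _).prodMk (hasDerivWithinAt_const s _ _)
  have hmaps : MapsTo (fun r : ℝ => (r, extChartAt (𝓡 (n i)) y y)) (Icc 0 1) S := fun r hr =>
    ⟨hr, mem_extChartAt_target y⟩
  have h1 := (hfam.hasFDerivWithinAt_integral (Measure.pi μ)
    (exists_convex_inter_Icc_prod (isOpen_target y)) hqS).comp_hasDerivWithinAt s hline hmaps
  have h2 : ∀ z, fderivWithin ℝ (G z) S q (1, 0) = h' (Function.update z i y) := by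
    intro z
    have h3 := ((hfam.2.1 z (mem_univ z) q hqS).hasFDerivWithinAt).comp_hasDerivWithinAt s
      hline hmaps
    have h4 := hd (Function.update z i y)
    have h5 : (G z ∘ fun r : ℝ => (r, extChartAt (𝓡 (n i)) y y)) =
        fun r => h r (Function.update z i y) := by
      funext r
      simp only [hG, Function.comp_apply, extChartAt_to_inv]
    rw [h5] at h3
    exact (uniqueDiffOn_Icc zero_lt_one s hs).eq_deriv _ h3 h4
  rw [ContinuousLinearMap.integral_apply (integrable_of_continuous_of_compactSpace _
    (continuous_family_left hfam.2.2.continuousOn hqS))] at h1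
  simp only [h2] at h1
  have h6 : ((fun x => ∫ z, G z x ∂(Measure.pi μ)) ∘
      fun r : ℝ => (r, extChartAt (𝓡 (n i)) y y)) = fun r => marginal μ i (h r) y := by
    funext r
    simp only [hG, Function.comp_apply, extChartAt_to_inv, marginal, slice]
  rw [h6] at h1
  exact h1

theorem IsAdmissiblePath.marginal (hL : ∀ i, IsDiffusion (n i) (μ i) (L i))
    {f g : ∀ i, E i → ℝ} (hf : ∀ i, IsDensity (𝓡 (n i)) (μ i) (f i))
    (hg : ∀ i, IsDensity (𝓡 (n i)) (μ i) (g i)) {ρ h : ℝ → (∀ i, E i) → ℝ}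
    (hp : IsAdmissiblePath (ModelWithCorners.pi fun i => 𝓡 (n i)) (Measure.pi μ) (sumOperator L)
      (fun x => ∏ i, f i (x i)) (fun x => ∏ i, g i (x i)) ρ h) (i : Fin N) :
    IsAdmissiblePath (𝓡 (n i)) (μ i) (L i) (f i) (g i) (fun s => marginal μ i (ρ s))
      (fun s => marginal μ i (h s)) where
  smooth_ρ := contMDiffOn_marginal_path hp.smooth_ρ i
  smooth_h := contMDiffOn_marginal_path hp.smooth_h i
  density s hs := (hp.density s hs).marginal i
  continuity_eq s hs y := by
    have h1 := hasDerivWithinAt_marginal (μ := μ) hp.smooth_ρ hs (hp.continuity_eq s hs) i y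
    convert h1 using 1
    rw [← integral_sumOperator hL (contMDiff_of_path hp.smooth_h hs) i y, ← integral_neg]
    rfl
  start_eq := by
    simp only [hp.start_eq]
    exact marginal_prod hf i
  end_eq := by
    simp only [hp.end_eq]
    exact marginal_prod hg i

/-- For each i, Jensen's inequality in the averaged variables followed by the resampling form of
Fubini; the integrands Γ_i(h)/ρ then sum to Γ(h)/ρ. -/
theorem sum_energy_marginal_le (hL : ∀ i, IsDiffusion (n i) (μ i) (L i))
    {ρ h : (∀ i, E i) → ℝ}
    (hρ : IsDensity (ModelWithCorners.pi fun i => 𝓡 (n i)) (Measure.pi μ) ρ)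
    (hh : ContMDiff (ModelWithCorners.pi fun i => 𝓡 (n i)) 𝓘(ℝ, ℝ) ∞ h) :
    ∑ i, energy (μ i) (L i) (marginal μ i ρ) (marginal μ i h) ≤
      energy (Measure.pi μ) (sumOperator L) ρ h := by
  have hρc := hρ.smooth.continuous
  have hfam := fun i => isSmoothFamily_slice hh i
  have hΓ : ∀ i, Continuous fun q : (∀ j, E j) × E i =>
      carreDuChamp (L i) (slice h q.1 i) (slice h q.1 i) q.2 := fun i =>
    (hL i).continuous_carreDuChamp_family (hfam i)
  have hΓ0 : ∀ i (z : ∀ j, E j) y, 0 ≤ carreDuChamp (L i) (slice h z i) (slice h z i) y :=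
    fun i z y => (hL i).carreDuChamp_nonneg ((hfam i).contMDiff z) y
  set F : ∀ i : Fin N, (∀ j, E j) → ℝ := fun i x =>
    carreDuChamp (L i) (slice h x i) (slice h x i) (x i) / ρ x with hF
  have hFc : ∀ i, Continuous (F i) := fun i =>
    ((hΓ i).comp (continuous_id.prodMk (continuous_apply i))).div hρc fun x => (hρ.pos x).ne'
  have hFu : ∀ i (z : ∀ j, E j) y, F i (Function.update z i y) =
      carreDuChamp (L i) (slice h z i) (slice h z i) y / slice ρ z i y := fun i z y => by
    simp only [hF, slice_update_self, Function.update_self, slice]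
  have hup : ∀ i, Continuous fun q : E i × (∀ j, E j) => F i (Function.update q.2 i q.1) :=
    fun i => (hFc i).comp (continuous_snd.update i continuous_fst)
  have hF0 : ∀ i x, 0 ≤ F i x := fun i x => div_nonneg (hΓ0 i x (x i)) (hρ.pos x).le
  have h1 : ∀ i, energy (μ i) (L i) (marginal μ i ρ) (marginal μ i h) ≤
      ∫⁻ x, ENNReal.ofReal (F i x) ∂(Measure.pi μ) := by
    intro i
    rw [lintegral_pi_eq_lintegral_update μ i (hFc i).measurable.ennreal_ofReal,
      lintegral_lintegral_swap
        ((hup i).comp (continuous_snd.prodMk continuous_fst)).measurable.ennreal_ofReal.aemeasurable]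
    refine lintegral_mono fun y => ?_
    have hsl : Continuous fun z => slice ρ z i y :=
      (continuous_slice hρc i).comp (Continuous.prodMk_left y)
    have h2 := (hL i).carreDuChamp_integral_div_le (Measure.pi μ) (hfam i) y hsl
      (fun z => hρ.pos _) (integral_pos_of_continuous_pos _ hsl fun z => hρ.pos _)
    refine (ENNReal.ofReal_le_ofReal h2).trans_eq ?_
    simp only [← hFu]
    exact ofReal_integral_eq_lintegral_ofReal
      (integrable_pi ((hup i).comp (Continuous.prodMk_right y))) (ae_of_all _ fun z => hF0 i _)
  refine (Finset.sum_le_sum fun i _ => h1 i).trans_eq ?_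
  rw [← lintegral_finsetSum _ fun i _ => (hFc i).measurable.ennreal_ofReal, energy]
  refine lintegral_congr fun x => ?_
  rw [← ENNReal.ofReal_sum_of_nonneg fun i _ => hF0 i x, carreDuChamp_sumOperator, sumBilinear,
    Finset.sum_div]

/-- Superadditivity of the lower integral needs no measurability, so none has to be shown for the
energy as a function of time. -/
theorem sum_lintegral_le_lintegral_sum {α ι : Type*} [MeasurableSpace α] (ν : Measure α)
    (s : Finset ι) (f : ι → α → ℝ≥0∞) :
    ∑ i ∈ s, ∫⁻ a, f i a ∂ν ≤ ∫⁻ a, ∑ i ∈ s, f i a ∂ν := by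
  classical
  induction s using Finset.induction_on with
  | empty => simp
  | insert i s hi ih =>
    simp only [Finset.sum_insert hi]
    exact (add_le_add_right ih _).trans (le_lintegral_add _ _)

theorem rpow_half_sq (a : ℝ≥0∞) : (a ^ (1 / 2 : ℝ)) ^ 2 = a := by
  rw [← ENNReal.rpow_natCast, ← ENNReal.rpow_mul]
  norm_num

theorem sum_T2_sq_le (hL : ∀ i, IsDiffusion (n i) (μ i) (L i))
    {f g : ∀ i, E i → ℝ} (hf : ∀ i, IsDensity (𝓡 (n i)) (μ i) (f i))
    (hg : ∀ i, IsDensity (𝓡 (n i)) (μ i) (g i)) :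
    ∑ i, T2 (𝓡 (n i)) (μ i) (L i) (f i) (g i) ^ 2 ≤
      T2 (ModelWithCorners.pi fun i => 𝓡 (n i)) (Measure.pi μ) (sumOperator L)
        (fun x => ∏ i, f i (x i)) (fun x => ∏ i, g i (x i)) ^ 2 := by
  rw [← rpow_half_sq (∑ i, _)]
  refine pow_le_pow_left' ?_ 2
  rw [T2]
  -- If there is no admissible path, the infimum is `⊤` and the bound is vacuous.
  refine le_iInf fun ρ => le_iInf fun h => le_iInf fun hp => ?_
  refine ENNReal.rpow_le_rpow ?_ (by norm_num)
  have h1 : ∀ i, T2 (𝓡 (n i)) (μ i) (L i) (f i) (g i) ^ 2 ≤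
      pathAction (μ i) (L i) (fun s => marginal μ i (ρ s)) (fun s => marginal μ i (h s)) := by
    intro i
    rw [← rpow_half_sq (pathAction _ _ _ _)]
    refine pow_le_pow_left' ?_ 2
    exact iInf_le_of_le _ (iInf_le_of_le _ (iInf_le_of_le (hp.marginal hL hf hg i) le_rfl))
  refine (Finset.sum_le_sum fun i _ => h1 i).trans ((sum_lintegral_le_lintegral_sum _ _ _).trans ?_)
  exact setLIntegral_mono' measurableSet_Icc fun s hs =>
    sum_energy_marginal_le hL (hp.density s hs) (contMDiff_of_path hp.smooth_h hs)

end Tensorization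

/-! ### Kernels acting on bounded functions, and L² contraction. -/

section KernelMean

variable {α : Type*} [MeasurableSpace α]

/-- The action of a kernel on functions. -/
def kernelMean (κ : Kernel α α) (f : α → ℝ) (x : α) : ℝ := ∫ y, f y ∂(κ x)

/-- Bounded measurable functions. -/
structure IsBoundedMeasurable (f : α → ℝ) : Prop where
  measurable : Measurable f
  exists_bound : ∃ C : ℝ≥0, ∀ x, |f x| ≤ C

namespace IsBoundedMeasurable

variable {f g : α → ℝ}

theorem add (hf : IsBoundedMeasurable f) (hg : IsBoundedMeasurable g) :
    IsBoundedMeasurable fun x => f x + g x := by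
  obtain ⟨C, hC⟩ := hf.exists_bound
  obtain ⟨D, hD⟩ := hg.exists_bound
  exact ⟨hf.measurable.add hg.measurable, C + D, fun x => (abs_add_le _ _).trans
    (by push_cast; exact add_le_add (hC x) (hD x))⟩

theorem const_mul (hf : IsBoundedMeasurable f) (c : ℝ) :
    IsBoundedMeasurable fun x => c * f x := by
  obtain ⟨C, hC⟩ := hf.exists_bound
  refine ⟨hf.measurable.const_mul c, ‖c‖₊ * C, fun x => ?_⟩
  rw [abs_mul]
  push_cast
  exact mul_le_mul_of_nonneg_left (hC x) (abs_nonneg c)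

theorem sub (hf : IsBoundedMeasurable f) (hg : IsBoundedMeasurable g) :
    IsBoundedMeasurable fun x => f x - g x := by
  simpa [sub_eq_add_neg] using hf.add (hg.const_mul (-1))

theorem of_continuous [TopologicalSpace α] [CompactSpace α] [OpensMeasurableSpace α]
    (hf : Continuous f) : IsBoundedMeasurable f := by
  refine ⟨hf.measurable, ?_⟩
  obtain ⟨C, hC⟩ := isCompact_univ.exists_bound_of_continuousOn hf.continuousOn
  exact ⟨C.toNNReal, fun x => (hC x (mem_univ x)).trans (Real.le_coe_toNNReal C)⟩

theorem integrable (hf : IsBoundedMeasurable f) (π : Measure α) [IsFiniteMeasure π] :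
    Integrable f π := by
  obtain ⟨C, hC⟩ := hf.exists_bound
  exact Integrable.of_bound hf.measurable.aestronglyMeasurable C (ae_of_all _ hC)

theorem memLp_two (hf : IsBoundedMeasurable f) (π : Measure α) [IsFiniteMeasure π] :
    MemLp f 2 π := by
  obtain ⟨C, hC⟩ := hf.exists_bound
  exact MemLp.of_bound hf.measurable.aestronglyMeasurable C (ae_of_all _ hC)

theorem kernelMean (hf : IsBoundedMeasurable f) (κ : Kernel α α) [IsMarkovKernel κ] :
    IsBoundedMeasurable (kernelMean κ f) := by
  refine ⟨(hf.measurable.stronglyMeasurable.integral_kernel).measurable, ?_⟩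
  obtain ⟨C, hC⟩ := hf.exists_bound
  refine ⟨C, fun x => ?_⟩
  have := norm_integral_le_of_norm_le_const (μ := κ x) (f := f) (ae_of_all _ hC)
  simpa [MarkovTransport.kernelMean] using this

end IsBoundedMeasurable

variable {κ η : Kernel α α} [IsMarkovKernel κ] [IsMarkovKernel η] {f g : α → ℝ}

theorem kernelMean_sub (hf : IsBoundedMeasurable f) (hg : IsBoundedMeasurable g) (x : α) :
    kernelMean κ (fun y => f y - g y) x = kernelMean κ f x - kernelMean κ g x :=
  integral_sub (hf.integrable _) (hg.integrable _)

theorem kernelMean_const_mul (c : ℝ) (x : α) :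
    kernelMean κ (fun y => c * f y) x = c * kernelMean κ f x :=
  integral_const_mul _ _

theorem kernelMean_comp (hf : IsBoundedMeasurable f) (x : α) :
    kernelMean (κ ∘ₖ η) f x = kernelMean η (kernelMean κ f) x :=
  Kernel.integral_comp (hf.integrable _)

theorem eLpNorm_two_sq (f : α → ℝ) (π : Measure α) :
    eLpNorm f 2 π ^ 2 = ∫⁻ x, ‖f x‖ₑ ^ 2 ∂π := by
  have := eLpNorm_nnreal_pow_eq_lintegral (μ := π) (f := f) (p := 2) two_ne_zero
  simpa using this

/-- A Markov kernel with an invariant measure is a contraction of `L²`. -/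
theorem eLpNorm_kernelMean_le {π : Measure α} (h : Kernel.Invariant κ π) (hf : Measurable f) :
    eLpNorm (kernelMean κ f) 2 π ≤ eLpNorm f 2 π := by
  rw [← ENNReal.pow_le_pow_left_iff two_ne_zero, eLpNorm_two_sq, eLpNorm_two_sq]
  calc ∫⁻ x, ‖kernelMean κ f x‖ₑ ^ 2 ∂π ≤ ∫⁻ x, ∫⁻ y, ‖f y‖ₑ ^ 2 ∂(κ x) ∂π := by
        refine lintegral_mono fun x => ?_
        rw [← eLpNorm_two_sq]
        -- Jensen's inequality: for the probability measure `κ x`, |∫ f| is at most the L¹ norm,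
        -- hence at most the L² norm.
        refine pow_le_pow_left' ?_ 2
        refine (enorm_integral_le_lintegral_enorm _).trans ?_
        rw [← eLpNorm_one_eq_lintegral_enorm]
        exact eLpNorm_le_eLpNorm_of_exponent_le one_le_two hf.aestronglyMeasurable
    _ = ∫⁻ y, ‖f y‖ₑ ^ 2 ∂π := by
        conv_rhs => rw [← h.def]
        rw [Measure.lintegral_bind κ.aemeasurable (by fun_prop)]

theorem eLpNorm_two_le_of_bound {π : Measure α} [IsProbabilityMeasure π] {C : ℝ≥0}
    (hC : ∀ x, |f x| ≤ C) : eLpNorm f 2 π ≤ C := by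
  have := eLpNorm_le_of_ae_bound (p := 2) (μ := π) (f := f) (ae_of_all _ hC)
  simpa using this

end KernelMean

/-! ### Estimates for one Markov semigroup. -/

section Factor

/-- A Markov kernel on a compact manifold is reversible if it is symmetric on smooth functions. -/
theorem isReversible_of_contMDiff {X H M : Type*} [NormedAddCommGroup X] [NormedSpace ℝ X]
    [FiniteDimensional ℝ X] [TopologicalSpace H] (I : ModelWithCorners ℝ X H) [TopologicalSpace M]
    [ChartedSpace H M] [IsManifold I ∞ M] [T2Space M] [CompactSpace M] [MeasurableSpace M]
    [BorelSpace M] {κ : Kernel M M} [IsMarkovKernel κ] {π : Measure M} [IsFiniteMeasure π]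
    (h : ∀ u v : M → ℝ, ContMDiff I 𝓘(ℝ, ℝ) ∞ u → ContMDiff I 𝓘(ℝ, ℝ) ∞ v →
      ∫ x, u x * kernelMean κ v x ∂π = ∫ x, v x * kernelMean κ u x ∂π) :
    Kernel.IsReversible κ π := by
  refine isReversible_of_isPiSystem isPiSystem_isClosed
    (BorelSpace.measurable_eq.trans borel_eq_generateFrom_isClosed) isClosed_univ ?_
  -- Take f smooth with values in [0,1], equal to 1 exactly on A; its powers are smooth and converge
  -- pointwise to the indicator of A.
  have happ : ∀ A : Set M, IsClosed A → ∃ f : M → ℝ, ContMDiff I 𝓘(ℝ, ℝ) ∞ f ∧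
      (∀ k x, |f x ^ k| ≤ 1) ∧
      ∀ x, Tendsto (fun k : ℕ => f x ^ k) atTop (𝓝 (A.indicator 1 x)) := by
    intro A hA
    obtain ⟨f, hf, hr, -, h1⟩ := exists_contMDiff_zero_iff_one_iff_of_isClosed (n := ⊤) I
      isClosed_empty hA (empty_disjoint A)
    have hr' : ∀ x, 0 ≤ f x ∧ f x ≤ 1 := fun x => hr (mem_range_self x)
    refine ⟨f, hf, fun k x => ?_, fun x => ?_⟩
    · rw [abs_of_nonneg (pow_nonneg (hr' x).1 k)]
      exact pow_le_one₀ (hr' x).1 (hr' x).2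
    · by_cases hx : x ∈ A
      · simp [indicator_of_mem hx, (h1 x).1 hx]
      · rw [indicator_of_notMem hx]
        exact tendsto_pow_atTop_nhds_zero_of_lt_one (hr' x).1
          (lt_of_le_of_ne (hr' x).2 fun he => hx ((h1 x).2 he))
  have hlim : ∀ {a b : M → ℝ} {A B : Set M}, Continuous a → Continuous b → (∀ k x, |a x ^ k| ≤ 1) →
      (∀ k x, |b x ^ k| ≤ 1) → (∀ x, Tendsto (fun k : ℕ => a x ^ k) atTop (𝓝 (A.indicator 1 x))) →
      (∀ x, Tendsto (fun k : ℕ => b x ^ k) atTop (𝓝 (B.indicator 1 x))) → MeasurableSet A →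
      MeasurableSet B →
      Tendsto (fun k : ℕ => ∫ x, a x ^ k * kernelMean κ (fun y => b y ^ k) x ∂π) atTop
        (𝓝 (∫⁻ x in A, κ x B ∂π).toReal) := by
    intro a b A B ha hb ha1 hb1 hat hbt hA hB
    have hm : ∀ k, IsBoundedMeasurable (kernelMean κ fun y => b y ^ k) := fun k =>
      (IsBoundedMeasurable.of_continuous (hb.pow k)).kernelMean κ
    have hle : ∀ k x, |kernelMean κ (fun y => b y ^ k) x| ≤ 1 := fun k x => by
      have := norm_integral_le_of_norm_le_const (μ := κ x)
        (f := fun y => b y ^ k) (ae_of_all _ (hb1 k))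
      simpa [kernelMean] using this
    have hin : ∀ x, Tendsto (fun k : ℕ => kernelMean κ (fun y => b y ^ k) x) atTop
        (𝓝 (κ x B).toReal) := by
      intro x
      have := tendsto_integral_of_dominated_convergence (μ := κ x) (fun _ => (1 : ℝ))
        (fun k => (hb.pow k).aestronglyMeasurable) (integrable_const _)
        (fun k => ae_of_all _ (hb1 k)) (ae_of_all _ hbt)
      rwa [integral_indicator_one hB] at this
    have := tendsto_integral_of_dominated_convergence (μ := π) (fun _ => (1 : ℝ))
      (F := fun k x => a x ^ k * kernelMean κ (fun y => b y ^ k) x)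
      (fun k => ((ha.pow k).measurable.mul (hm k).measurable).aestronglyMeasurable)
      (integrable_const _)
      (fun k => ae_of_all _ fun x => by
        rw [norm_mul]
        exact mul_le_one₀ (ha1 k x) (norm_nonneg _) (hle k x))
      (ae_of_all _ fun x => (hat x).mul (hin x))
    convert this using 2
    rw [← integral_toReal (κ.measurable_coe hB).aemeasurable (ae_of_all _ fun x => measure_lt_top _ _),
      ← integral_indicator hA]
    refine integral_congr_ae (ae_of_all _ fun x => ?_)
    by_cases hx : x ∈ A <;> simp [hx]
  intro A hA B hB
  obtain ⟨a, ha, ha1, hat⟩ := happ A hA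
  obtain ⟨b, hb, hb1, hbt⟩ := happ B hB
  have hfin : ∀ A B : Set M, ∫⁻ x in A, κ x B ∂π ≠ ⊤ := fun A B => by
    refine ne_top_of_le_ne_top ((measure_lt_top π A).ne) ?_
    refine (lintegral_mono fun x => prob_le_one (μ := κ x) (s := B)).trans ?_
    simp
  rw [← ENNReal.toReal_eq_toReal_iff' (hfin _ _) (hfin _ _)]
  refine tendsto_nhds_unique (hlim ha.continuous hb.continuous ha1 hb1 hat hbt hA.measurableSet
    hB.measurableSet) ?_
  refine (hlim hb.continuous ha.continuous hb1 ha1 hbt hat hB.measurableSet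
    hA.measurableSet).congr fun k => ?_
  exact h _ _ (hb.pow k) (ha.pow k)

namespace IsMarkovSemigroup

variable {X H M : Type*} [NormedAddCommGroup X] [NormedSpace ℝ X] [FiniteDimensional ℝ X]
  [TopologicalSpace H] {I : ModelWithCorners ℝ X H} [TopologicalSpace M] [ChartedSpace H M]
  [IsManifold I ∞ M] [T2Space M] [CompactSpace M] [MeasurableSpace M] [BorelSpace M]
  {μ : Measure M} [IsProbabilityMeasure μ] {L : (M → ℝ) → M → ℝ} {P : ℝ≥0 → Kernel M M}

theorem isReversible (hP : IsMarkovSemigroup I μ L P) (t : ℝ≥0) :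
    Kernel.IsReversible (P t) μ :=
  haveI := hP.markov t
  isReversible_of_contMDiff I fun u v hu hv => hP.reversible u v hu hv t

/-- Telescoping: P_{(k+1)τ} u - u = P_{kτ}(P_τ u - u) + (P_{kτ} u - u), and P_{kτ} contracts L². -/
theorem eLpNorm_act_sub_nsmul_le (hP : IsMarkovSemigroup I μ L P) {u : M → ℝ}
    (hu : Continuous u) (τ : ℝ≥0) (k : ℕ) :
    eLpNorm (fun x => act P (k * τ) u x - u x) 2 μ ≤
      k * eLpNorm (fun x => act P τ u x - u x) 2 μ := by
  have hm := hP.markov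
  have hub := IsBoundedMeasurable.of_continuous hu
  have hb : ∀ s, IsBoundedMeasurable fun x => act P s u x - u x := fun s =>
    (hub.kernelMean (P s)).sub hub
  induction k with
  | zero =>
    have : ∀ x, act P 0 u x = u x := fun x => by
      rw [act, hP.zero, Kernel.id_apply]
      exact integral_dirac' _ _ hu.stronglyMeasurable
    simp [this]
  | succ k ih =>
    have e : (fun x => act P ((k + 1 : ℕ) * τ) u x - u x) =
        (kernelMean (P (k * τ)) fun y => act P τ u y - u y) +
          fun x => act P (k * τ) u x - u x := by
      funext x
      rw [Pi.add_apply, kernelMean_sub (f := act P τ u) (hub.kernelMean (P τ)) hub]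
      have : act P ((k + 1 : ℕ) * τ) u x = kernelMean (P (k * τ)) (act P τ u) x := by
        have : ((k + 1 : ℕ) : ℝ≥0) * τ = τ + k * τ := by push_cast; ring
        rw [act, this, hP.add]
        exact kernelMean_comp hub x
      rw [this]
      simp only [act, kernelMean]
      ring
    rw [e]
    refine (eLpNorm_add_le ((hb τ).kernelMean _).measurable.aestronglyMeasurable
      (hb _).measurable.aestronglyMeasurable one_le_two).trans ?_
    push_cast
    rw [add_mul, one_mul, add_comm]
    exact add_le_add ih
      (eLpNorm_kernelMean_le (hP.isReversible _).invariant (hb τ).measurable)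

/-- Cut t into k + 1 steps of length τ, each costing at most τ(‖Lu‖ + o(1)), and let k tend to
infinity. Only the derivative at time 0 is used. -/
theorem eLpNorm_act_sub_le (hP : IsMarkovSemigroup I μ L P) {u : M → ℝ}
    (hu : ContMDiff I 𝓘(ℝ, ℝ) ∞ u) (t : ℝ≥0) :
    eLpNorm (fun x => act P t u x - u x) 2 μ ≤ t * eLpNorm (L u) 2 μ := by
  have hm := hP.markov
  have hub := IsBoundedMeasurable.of_continuous hu.continuous
  have hb : ∀ s, IsBoundedMeasurable fun x => act P s u x - u x := fun s =>
    (hub.kernelMean (P s)).sub hub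
  rcases eq_or_ne t 0 with rfl | ht
  · have := hP.eLpNorm_act_sub_nsmul_le hu.continuous 0 0
    simpa using this
  have htend : Tendsto (fun k : ℕ => t / (k + 1 : ℝ≥0)) atTop (𝓝[>] 0) := by
    rw [tendsto_nhdsWithin_iff]
    refine ⟨?_, Eventually.of_forall fun k => ?_⟩
    · have := (tendsto_one_div_add_atTop_nhds_zero_nat (𝕜 := ℝ≥0)).const_mul t
      simpa [div_eq_mul_inv] using this
    · exact div_pos (pos_iff_ne_zero.2 ht) (by positivity)
  have hlim := ((hP.generator u hu).2.comp htend).add_const (eLpNorm (L u) 2 μ)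
  rw [zero_add] at hlim
  have hlim' := ENNReal.Tendsto.const_mul (a := (t : ℝ≥0∞)) hlim (Or.inr ENNReal.coe_ne_top)
  refine ge_of_tendsto hlim' (Eventually.of_forall fun k => ?_)
  set τ : ℝ≥0 := t / (k + 1 : ℝ≥0) with hτ
  have hτ0 : τ ≠ 0 := div_ne_zero ht (by positivity)
  have hkt : ((k + 1 : ℕ) : ℝ≥0) * τ = t := by
    rw [hτ]; push_cast; field_simp
  have h1 := hP.eLpNorm_act_sub_nsmul_le hu.continuous τ (k + 1)
  rw [hkt] at h1
  have h2 : eLpNorm (fun x => act P τ u x - u x) 2 μ ≤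
      τ * (eLpNorm (fun x => (τ : ℝ)⁻¹ * (act P τ u x - u x) - L u x) 2 μ +
        eLpNorm (L u) 2 μ) := by
    have e : (fun x => act P τ u x - u x) =
        (τ : ℝ) • ((fun x => (τ : ℝ)⁻¹ * (act P τ u x - u x) - L u x) + L u) := by
      funext x
      have : (τ : ℝ) ≠ 0 := by exact_mod_cast hτ0
      simp only [Pi.smul_apply, Pi.add_apply, smul_eq_mul]
      field_simp
      ring
    conv_lhs => rw [e]
    rw [eLpNorm_const_smul]
    have : ‖(τ : ℝ)‖ₑ = (τ : ℝ≥0∞) := by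
      rw [Real.enorm_eq_ofReal τ.coe_nonneg]; exact ENNReal.ofReal_coe_nnreal
    rw [this]
    gcongr
    have hLm := (hP.generator u hu).1.aestronglyMeasurable
    exact eLpNorm_add_le ((((hb τ).const_mul _).measurable.aestronglyMeasurable).sub hLm) hLm
      one_le_two
  refine h1.trans ((mul_le_mul_right h2 _).trans_eq ?_)
  rw [← mul_assoc]
  congr 1
  exact_mod_cast hkt

/-- A bound uniform in t, which provides the domination when convergence on slices is integrated
over the product. -/
theorem eLpNorm_generator_quotient_le (hP : IsMarkovSemigroup I μ L P) {u : M → ℝ}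
    (hu : ContMDiff I 𝓘(ℝ, ℝ) ∞ u) {t : ℝ≥0} (ht : 0 < t) :
    eLpNorm (fun x => (t : ℝ)⁻¹ * (act P t u x - u x) - L u x) 2 μ ≤ 2 * eLpNorm (L u) 2 μ := by
  have hm := hP.markov
  have hub := IsBoundedMeasurable.of_continuous hu.continuous
  have hb : ∀ s, IsBoundedMeasurable fun x => act P s u x - u x := fun s =>
    (hub.kernelMean (P s)).sub hub
  refine (eLpNorm_sub_le (f := fun x => (t : ℝ)⁻¹ * (act P t u x - u x))
    ((hb t).const_mul _).measurable.aestronglyMeasurable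
    (hP.generator u hu).1.aestronglyMeasurable one_le_two).trans ?_
  rw [two_mul]
  gcongr
  have := eLpNorm_const_smul (t : ℝ)⁻¹ (fun x => act P t u x - u x) 2 μ
  refine this.trans_le ?_
  have ht' : (t : ℝ≥0∞) ≠ 0 := by exact_mod_cast ht.ne'
  have e : ‖(t : ℝ)⁻¹‖ₑ = (t : ℝ≥0∞)⁻¹ := by
    rw [Real.enorm_eq_ofReal (by positivity), ENNReal.ofReal_inv_of_pos (by exact_mod_cast ht),
      ENNReal.ofReal_coe_nnreal]
  rw [e]
  refine (mul_le_mul_right (hP.eLpNorm_act_sub_le hu t) _).trans_eq ?_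
  rw [← mul_assoc, ENNReal.inv_mul_cancel ht' ENNReal.coe_ne_top, one_mul]

/-- A Markov semigroup is strongly continuous at `0`. -/
theorem tendsto_eLpNorm_act_sub (hP : IsMarkovSemigroup I μ L P) {w : M → ℝ}
    (hw : Continuous w) :
    Tendsto (fun t => eLpNorm (fun x => act P t w x - w x) 2 μ) (𝓝[>] 0) (𝓝 0) := by
  have hm := hP.markov
  rw [ENNReal.tendsto_nhds_zero]
  intro ε hε
  -- With v smooth and uniformly δ-close to w, the terms P_t(w - v), P_t v - v and v - w each cost
  -- at most δ.
  obtain ⟨δ, hδ0, hδ⟩ : ∃ δ : ℝ≥0, 0 < δ ∧ (δ : ℝ≥0∞) + δ + δ ≤ ε := by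
    rcases eq_or_ne ε ⊤ with rfl | hε'
    · exact ⟨1, one_pos, le_top⟩
    · refine ⟨ε.toNNReal / 3, by simpa using ENNReal.toNNReal_pos hε.ne' hε', ?_⟩
      conv_rhs => rw [← ENNReal.coe_toNNReal hε']
      rw [← ENNReal.coe_add, ← ENNReal.coe_add, ENNReal.coe_le_coe]
      exact (by ring : ε.toNNReal / 3 + ε.toNNReal / 3 + ε.toNNReal / 3 = ε.toNNReal).le
  obtain ⟨v, hv, -⟩ := Continuous.exists_contMDiff_approx I ⊤ hw
    (continuous_const : Continuous fun _ : M => (δ : ℝ)) fun _ => by exact_mod_cast hδ0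
  have hvb := IsBoundedMeasurable.of_continuous v.contMDiff.continuous
  have hwb := IsBoundedMeasurable.of_continuous hw
  have hd : eLpNorm (fun x => w x - v x) 2 μ ≤ δ := eLpNorm_two_le_of_bound fun x => by
    rw [← Real.dist_eq, dist_comm]; exact (hv x).le
  have hd' : eLpNorm (fun x => v x - w x) 2 μ ≤ δ := eLpNorm_two_le_of_bound fun x => by
    rw [← Real.dist_eq]; exact (hv x).le
  have hsmall : Tendsto (fun t : ℝ≥0 => (t : ℝ≥0∞) * eLpNorm (L v) 2 μ) (𝓝[>] 0) (𝓝 0) := by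
    have h1 : Tendsto (fun t : ℝ≥0 => (t : ℝ≥0∞)) (𝓝[>] 0) (𝓝 0) :=
      (ENNReal.continuous_coe.tendsto' 0 0 rfl).mono_left nhdsWithin_le_nhds
    have := ENNReal.Tendsto.mul_const h1 (b := eLpNorm (L v) 2 μ)
      (Or.inr (hP.generator v v.contMDiff).1.eLpNorm_ne_top)
    simpa using this
  filter_upwards [ENNReal.tendsto_nhds_zero.1 hsmall δ (by exact_mod_cast hδ0)] with t ht
  have e : (fun x => act P t w x - w x) = (kernelMean (P t) fun y => w y - v y) +
      (fun x => act P t v x - v x) + fun x => v x - w x := by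
    funext x
    rw [Pi.add_apply, Pi.add_apply, kernelMean_sub hwb hvb]
    simp only [act, kernelMean]
    ring
  rw [e]
  have m1 := ((hwb.sub hvb).kernelMean (P t)).measurable.aestronglyMeasurable (μ := μ)
  have m2 := ((hvb.kernelMean (P t)).sub hvb).measurable.aestronglyMeasurable (μ := μ)
  refine (eLpNorm_add_le (m1.add m2) (hvb.sub hwb).measurable.aestronglyMeasurable
    one_le_two).trans ((add_le_add ((eLpNorm_add_le m1 m2 one_le_two).trans (add_le_add
      ((eLpNorm_kernelMean_le (hP.isReversible t).invariant (hwb.sub hvb).measurable).trans hd)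
      ((hP.eLpNorm_act_sub_le v.contMDiff t).trans ht))) hd').trans hδ)

end IsMarkovSemigroup

end Factor

/-! ### The product semigroup and its generator. -/

section ProductSemigroup

section PartialKernel

variable {ι : Type*} [Fintype ι] [DecidableEq ι] {E : ι → Type*} [∀ i, MeasurableSpace (E i)]
  (κ : ∀ i, Kernel (E i) (E i)) [∀ i, IsMarkovKernel (κ i)]

instance isMarkovKernel_ite_id (s : Finset ι) (i : ι) :
    IsMarkovKernel (if i ∈ s then κ i else Kernel.id) := by
  split_ifs <;> infer_instance

/-- The kernel `κ i` acts on the variables `i ∈ s`, and the other variables are fixed. -/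
def partialKernel (s : Finset ι) : Kernel (∀ i, E i) (∀ i, E i) :=
  prodKernel fun i => if i ∈ s then κ i else Kernel.id

instance isMarkovKernel_partialKernel (s : Finset ι) : IsMarkovKernel (partialKernel κ s) :=
  isMarkovKernel_prodKernel _

theorem partialKernel_empty : partialKernel κ ∅ = Kernel.id := by
  rw [← prodKernel_id, partialKernel]
  exact prodKernel_congr _ _ fun i => by simp

theorem partialKernel_univ : partialKernel κ Finset.univ = prodKernel κ :=
  prodKernel_congr _ _ fun i => by simp

/-- Kernels moving disjoint sets of variables compose to the one moving their union; this drives the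
inductions on `s`. -/
theorem partialKernel_insert {s : Finset ι} {k : ι} (hk : k ∉ s) :
    partialKernel κ (insert k s) = partialKernel κ {k} ∘ₖ partialKernel κ s := by
  simp only [partialKernel]
  rw [prodKernel_comp]
  ext1 x
  simp only [prodKernel_apply]
  congr 1
  funext i
  rcases eq_or_ne i k with rfl | hi
  · simp [hk]
  · by_cases his : i ∈ s <;> simp [hi, his]

/-- The kernel started at x is the Dirac mass at x with its k-th coordinate resampled. -/
theorem kernelMean_partialKernel_singleton (k : ι) {f : (∀ i, E i) → ℝ}
    (hf : IsBoundedMeasurable f) (x : ∀ i, E i) :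
    kernelMean (partialKernel κ {k}) f x = kernelMean (κ k) (slice f x k) (x k) := by
  have e : partialKernel κ {k} x =
      ((Measure.dirac x).prod (κ k (x k))).map fun q => Function.update q.1 k q.2 := by
    have hd : Measure.dirac x = Measure.pi fun i => Measure.dirac (x i) := by
      have := congrArg (fun η : Kernel _ _ => η x) (prodKernel_id (E := E))
      simp only [prodKernel_apply, Kernel.id_apply] at this
      exact this.symm
    rw [hd, map_update_prod, partialKernel, prodKernel_apply]
    congr 1
    funext i
    rcases eq_or_ne i k with rfl | hi
    · simp
    · simp [hi, Kernel.id_apply]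
  rw [kernelMean, e, integral_map (measurable_update_prod k).aemeasurable
    hf.measurable.aestronglyMeasurable]
  have hg : Measurable fun q : (∀ i, E i) × E k => f (Function.update q.1 k q.2) :=
    hf.measurable.comp (measurable_update_prod k)
  rw [Measure.dirac_prod, integral_map measurable_prodMk_left.aemeasurable hg.aestronglyMeasurable]
  rfl

variable {κ} in
theorem isReversible_partialKernel {μ : ∀ i, Measure (E i)} [∀ i, IsProbabilityMeasure (μ i)]
    (h : ∀ i, Kernel.IsReversible (κ i) (μ i)) (s : Finset ι) :
    Kernel.IsReversible (partialKernel κ s) (Measure.pi μ) :=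
  isReversible_prodKernel fun i => by
    split_ifs
    · exact h i
    · exact isReversible_id _

/-- Convergence in `L²` on a product, from convergence in `L²` along the slices. -/
theorem tendsto_eLpNorm_pi {μ : ∀ i, Measure (E i)} [∀ i, IsProbabilityMeasure (μ i)] (k : ι)
    {l : Filter ℝ≥0} [l.IsCountablyGenerated] {G : ℝ≥0 → (∀ i, E i) → ℝ}
    (hG : ∀ t, Measurable (G t)) {B : ℝ≥0∞} (hB : B ≠ ⊤)
    (hb : ∀ᶠ t in l, ∀ z, eLpNorm (slice (G t) z k) 2 (μ k) ≤ B)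
    (hlim : ∀ z, Tendsto (fun t => eLpNorm (slice (G t) z k) 2 (μ k)) l (𝓝 0)) :
    Tendsto (fun t => eLpNorm (G t) 2 (Measure.pi μ)) l (𝓝 0) := by
  have hsq : Tendsto (fun t => eLpNorm (G t) 2 (Measure.pi μ) ^ 2) l (𝓝 0) := by
    -- Resampling the k-th coordinate writes the squared norm as an average of squared norms of
    -- slices, to which dominated convergence applies.
    have e : ∀ t, eLpNorm (G t) 2 (Measure.pi μ) ^ 2 =
        ∫⁻ z, eLpNorm (slice (G t) z k) 2 (μ k) ^ 2 ∂(Measure.pi μ) := fun t => by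
      rw [eLpNorm_two_sq, lintegral_pi_eq_lintegral_update μ k
        (f := fun x => ‖G t x‖ₑ ^ 2) ((hG t).enorm.pow_const 2)]
      simp only [eLpNorm_two_sq]
      rfl
    simp only [e]
    have := tendsto_lintegral_filter_of_dominated_convergence (μ := Measure.pi μ) (l := l)
      (F := fun t z => eLpNorm (slice (G t) z k) 2 (μ k) ^ 2) (f := fun _ => 0) (fun _ => B ^ 2)
      (Eventually.of_forall fun t => by
        simp only [eLpNorm_two_sq]
        exact Measurable.lintegral_prod_right'
          (f := fun q : (∀ i, E i) × E k => ‖slice (G t) q.1 k q.2‖ₑ ^ 2)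
          (((hG t).comp (measurable_update_prod k)).enorm.pow_const 2))
      (hb.mono fun t ht => ae_of_all _ fun z => pow_le_pow_left' (ht z) 2)
      (by simpa using fun h => absurd h hB)
      (ae_of_all _ fun z => by
        have := ((ENNReal.continuous_pow 2).tendsto 0).comp (hlim z)
        rwa [zero_pow two_ne_zero] at this)
    simpa using this
  have := ((ENNReal.continuous_rpow_const (y := (1 / 2 : ℝ))).tendsto 0).comp hsq
  rw [ENNReal.zero_rpow_of_pos (by norm_num)] at this
  refine this.congr fun t => ?_
  rw [Function.comp_apply, ← ENNReal.rpow_natCast, ← ENNReal.rpow_mul]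
  norm_num

end PartialKernel

variable {N : ℕ} {n : Fin N → ℕ} {E : Fin N → Type*}
  [∀ i, TopologicalSpace (E i)] [∀ i, T2Space (E i)] [∀ i, CompactSpace (E i)]
  [∀ i, SecondCountableTopology (E i)]
  [∀ i, ChartedSpace (EuclideanSpace ℝ (Fin (n i))) (E i)] [∀ i, IsManifold (𝓡 (n i)) ∞ (E i)]
  [∀ i, MeasurableSpace (E i)] [∀ i, BorelSpace (E i)]
  {μ : ∀ i, Measure (E i)} [∀ i, IsProbabilityMeasure (μ i)] {L : ∀ i, (E i → ℝ) → E i → ℝ}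
  {P : ∀ i, ℝ≥0 → Kernel (E i) (E i)} [∀ i t, IsMarkovKernel (P i t)]

theorem slice_kernelMean_partialKernel_singleton (t : ℝ≥0) (k : Fin N) {f : (∀ i, E i) → ℝ}
    (hf : IsBoundedMeasurable f) (z : ∀ i, E i) (y : E k) :
    slice (kernelMean (partialKernel (fun i => P i t) {k}) f) z k y =
      act (P k) t (slice f z k) y := by
  rw [slice, kernelMean_partialKernel_singleton _ k hf, slice_update_self, Function.update_self]
  rfl

/-- Continuity of `w` is the right generality: the lemma is applied to L_k u on the product, which
is known to be continuous only. -/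
theorem tendsto_eLpNorm_partialKernel_sub
    (hP : ∀ i, IsMarkovSemigroup (𝓡 (n i)) (μ i) (L i) (P i)) {w : (∀ i, E i) → ℝ}
    (hw : Continuous w) (s : Finset (Fin N)) :
    Tendsto (fun t => eLpNorm
      (fun x => kernelMean (partialKernel (fun i => P i t) s) w x - w x) 2 (Measure.pi μ))
      (𝓝[>] 0) (𝓝 0) := by
  have hwb := IsBoundedMeasurable.of_continuous hw
  have hone : ∀ k, Tendsto (fun t => eLpNorm
      (fun x => kernelMean (partialKernel (fun i => P i t) {k}) w x - w x) 2 (Measure.pi μ))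
      (𝓝[>] 0) (𝓝 0) := by
    intro k
    obtain ⟨C, hC⟩ := hwb.exists_bound
    have hs : ∀ t z, (slice (fun x => kernelMean (partialKernel (fun i => P i t) {k}) w x - w x)
        z k) = fun y => act (P k) t (slice w z k) y - slice w z k y := fun t z => by
      funext y
      rw [← slice_kernelMean_partialKernel_singleton t k hwb]
      rfl
    have hc : ∀ z, Continuous (slice w z k) := fun z =>
      (continuous_slice hw k).comp (continuous_const.prodMk continuous_id)
    refine tendsto_eLpNorm_pi k (B := C + C)
      (fun t => ((hwb.kernelMean _).sub hwb).measurable) (by finiteness)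
      (Eventually.of_forall fun t z => ?_) fun z => ?_
    · rw [hs]
      have hb := IsBoundedMeasurable.of_continuous (hc z)
      have hle := eLpNorm_two_le_of_bound (π := μ k) (f := slice w z k) fun y => hC _
      refine (eLpNorm_sub_le (f := act (P k) t (slice w z k))
        (hb.kernelMean (P k t)).measurable.aestronglyMeasurable
        hb.measurable.aestronglyMeasurable one_le_two).trans (add_le_add ?_ hle)
      exact (eLpNorm_kernelMean_le ((hP k).isReversible t).invariant hb.measurable).trans hle
    · simp only [hs]
      exact (hP k).tendsto_eLpNorm_act_sub (hc z)
  induction s using Finset.induction_on with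
  | empty =>
    have : ∀ t x, kernelMean (partialKernel (fun i => P i t) ∅) w x = w x := fun t x => by
      rw [partialKernel_empty, kernelMean, Kernel.id_apply]
      exact integral_dirac' _ _ hw.stronglyMeasurable
    simp [this]
  | insert k s hk ih =>
    have h0 := (hone k).add ih
    rw [add_zero] at h0
    refine tendsto_of_tendsto_of_tendsto_of_le_of_le tendsto_const_nhds h0 (fun t => zero_le)
      fun t => ?_
    have hb1 := (hwb.kernelMean (partialKernel (fun i => P i t) {k}))
    have e : (fun x => kernelMean (partialKernel (fun i => P i t) (insert k s)) w x - w x) =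
        (kernelMean (partialKernel (fun i => P i t) s)
          fun x => kernelMean (partialKernel (fun i => P i t) {k}) w x - w x) +
        fun x => kernelMean (partialKernel (fun i => P i t) s) w x - w x := by
      funext x
      rw [partialKernel_insert _ hk, kernelMean_comp hwb, Pi.add_apply, kernelMean_sub hb1 hwb]
      ring
    simp only
    rw [e]
    refine (eLpNorm_add_le ((hb1.sub hwb).kernelMean _).measurable.aestronglyMeasurable
      ((hwb.kernelMean _).sub hwb).measurable.aestronglyMeasurable one_le_two).trans ?_
    gcongr
    exact eLpNorm_kernelMean_le
      (isReversible_partialKernel (fun i => (hP i).isReversible t) s).invariant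
      (hb1.sub hwb).measurable

theorem continuous_operator_diagonal (hL : ∀ i, IsDiffusion (n i) (μ i) (L i))
    {u : (∀ i, E i) → ℝ} (hu : ContMDiff (ModelWithCorners.pi fun i => 𝓡 (n i)) 𝓘(ℝ, ℝ) ∞ u)
    (i : Fin N) : Continuous fun x => L i (slice u x i) (x i) :=
  (continuous_slice_operator hL hu i).comp (continuous_id.prodMk (continuous_apply i))

theorem continuous_sumOperator (hL : ∀ i, IsDiffusion (n i) (μ i) (L i))
    {u : (∀ i, E i) → ℝ} (hu : ContMDiff (ModelWithCorners.pi fun i => 𝓡 (n i)) 𝓘(ℝ, ℝ) ∞ u) :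
    Continuous (sumOperator L u) :=
  continuous_finsetSum _ fun i _ => continuous_operator_diagonal hL hu i

/-- On every slice this is the generator of the k-th factor; the bound 2 sup |L_k u| dominates all
slices at once. -/
theorem tendsto_eLpNorm_generator_singleton (hL : ∀ i, IsDiffusion (n i) (μ i) (L i))
    (hP : ∀ i, IsMarkovSemigroup (𝓡 (n i)) (μ i) (L i) (P i)) {u : (∀ i, E i) → ℝ}
    (hu : ContMDiff (ModelWithCorners.pi fun i => 𝓡 (n i)) 𝓘(ℝ, ℝ) ∞ u) (k : Fin N) :
    Tendsto (fun t : ℝ≥0 => eLpNorm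
      (fun x => (t : ℝ)⁻¹ * (kernelMean (partialKernel (fun i => P i t) {k}) u x - u x) -
        L k (slice u x k) (x k)) 2 (Measure.pi μ)) (𝓝[>] 0) (𝓝 0) := by
  have hub := IsBoundedMeasurable.of_continuous hu.continuous
  have hLc := continuous_operator_diagonal hL hu k
  obtain ⟨C, hC⟩ := (IsBoundedMeasurable.of_continuous hLc).exists_bound
  have hs : ∀ (t : ℝ≥0) z, (slice (fun x =>
      (t : ℝ)⁻¹ * (kernelMean (partialKernel (fun i => P i t) {k}) u x - u x) -
        L k (slice u x k) (x k)) z k) = fun y =>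
        (t : ℝ)⁻¹ * (act (P k) t (slice u z k) y - slice u z k y) - L k (slice u z k) y :=
      fun t z => by
    funext y
    rw [← slice_kernelMean_partialKernel_singleton t k hub]
    rw [← slice_update_self u z k y]
    simp only [slice, Function.update_self, Function.update_idem]
  have hsm : ∀ z, ContMDiff (𝓡 (n k)) 𝓘(ℝ, ℝ) ∞ (slice u z k) := fun z =>
    (isSmoothFamily_slice hu k).contMDiff z
  refine tendsto_eLpNorm_pi k (B := 2 * C)
    (fun t => (((hub.kernelMean _).sub hub).const_mul _).measurable.sub hLc.measurable)
    (by finiteness) ?_ fun z => ?_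
  · filter_upwards [self_mem_nhdsWithin] with t ht z
    rw [hs]
    refine ((hP k).eLpNorm_generator_quotient_le (hsm z) ht).trans ?_
    gcongr
    refine eLpNorm_two_le_of_bound fun y => ?_
    have := hC (Function.update z k y)
    rwa [slice_update_self, Function.update_self] at this
  · simp only [hs]
    exact ((hP k).generator _ (hsm z)).2

theorem tendsto_eLpNorm_generator_partialKernel (hL : ∀ i, IsDiffusion (n i) (μ i) (L i))
    (hP : ∀ i, IsMarkovSemigroup (𝓡 (n i)) (μ i) (L i) (P i)) {u : (∀ i, E i) → ℝ}
    (hu : ContMDiff (ModelWithCorners.pi fun i => 𝓡 (n i)) 𝓘(ℝ, ℝ) ∞ u)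
    (s : Finset (Fin N)) :
    Tendsto (fun t : ℝ≥0 => eLpNorm
      (fun x => (t : ℝ)⁻¹ * (kernelMean (partialKernel (fun i => P i t) s) u x - u x) -
        ∑ i ∈ s, L i (slice u x i) (x i)) 2 (Measure.pi μ)) (𝓝[>] 0) (𝓝 0) := by
  have hub := IsBoundedMeasurable.of_continuous hu.continuous
  have hLb := fun i => IsBoundedMeasurable.of_continuous (continuous_operator_diagonal hL hu i)
  have hSb := fun s : Finset (Fin N) => IsBoundedMeasurable.of_continuous
    (continuous_finsetSum s fun i _ => continuous_operator_diagonal hL hu i)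
  induction s using Finset.induction_on with
  | empty =>
    have : ∀ t x, kernelMean (partialKernel (fun i => P i t) ∅) u x = u x := fun t x => by
      rw [partialKernel_empty, kernelMean, Kernel.id_apply]
      exact integral_dirac' _ _ hu.continuous.stronglyMeasurable
    simp [this]
  | insert k s hk ih =>
    have h0 := ((tendsto_eLpNorm_generator_singleton hL hP hu k).add
      (tendsto_eLpNorm_partialKernel_sub hP (continuous_operator_diagonal hL hu k) s)).add ih
    rw [add_zero, add_zero] at h0
    refine tendsto_of_tendsto_of_tendsto_of_le_of_le tendsto_const_nhds h0 (fun t => zero_le)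
      fun t => ?_
    have hb1 := (hub.kernelMean (partialKernel (fun i => P i t) {k})).sub hub
    have hb2 := (hb1.const_mul (t : ℝ)⁻¹).sub (hLb k)
    have hb3 := ((hLb k).kernelMean (partialKernel (fun i => P i t) s)).sub (hLb k)
    have hb4 := (((hub.kernelMean (partialKernel (fun i => P i t) s)).sub hub).const_mul
      (t : ℝ)⁻¹).sub (hSb s)
    -- The three terms are P^s of the error of the k-th generator, the defect of strong continuity
    -- of P^s at L_k u, and the error for the variables in s.
    have e : (fun x => (t : ℝ)⁻¹ *
          (kernelMean (partialKernel (fun i => P i t) (insert k s)) u x - u x) -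
          ∑ i ∈ insert k s, L i (slice u x i) (x i)) =
        ((kernelMean (partialKernel (fun i => P i t) s) fun x => (t : ℝ)⁻¹ *
            (kernelMean (partialKernel (fun i => P i t) {k}) u x - u x) -
            L k (slice u x k) (x k)) +
          (fun x => kernelMean (partialKernel (fun i => P i t) s)
            (fun x => L k (slice u x k) (x k)) x - L k (slice u x k) (x k))) +
        fun x => (t : ℝ)⁻¹ * (kernelMean (partialKernel (fun i => P i t) s) u x - u x) -
          ∑ i ∈ s, L i (slice u x i) (x i) := by
      funext x
      rw [partialKernel_insert _ hk, kernelMean_comp hub, Pi.add_apply, Pi.add_apply,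
        kernelMean_sub (hb1.const_mul _) (hLb k), kernelMean_const_mul,
        kernelMean_sub (hub.kernelMean _) hub, Finset.sum_insert hk]
      ring
    simp only
    rw [e]
    have m1 := (hb2.kernelMean (partialKernel (fun i => P i t) s)).measurable.aestronglyMeasurable
      (μ := Measure.pi μ)
    have m2 := hb3.measurable.aestronglyMeasurable (μ := Measure.pi μ)
    refine (eLpNorm_add_le (m1.add m2) hb4.measurable.aestronglyMeasurable one_le_two).trans ?_
    gcongr
    refine (eLpNorm_add_le m1 m2 one_le_two).trans ?_
    gcongr
    exact eLpNorm_kernelMean_le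
      (isReversible_partialKernel (fun i => (hP i).isReversible t) s).invariant hb2.measurable

/-- The product of Markov semigroups is a Markov semigroup, with generator `⊕ L_i`. -/
theorem isMarkovSemigroup_prodKernel (hL : ∀ i, IsDiffusion (n i) (μ i) (L i))
    (hP : ∀ i, IsMarkovSemigroup (𝓡 (n i)) (μ i) (L i) (P i)) :
    IsMarkovSemigroup (ModelWithCorners.pi fun i => 𝓡 (n i)) (Measure.pi μ) (sumOperator L)
      fun t => prodKernel fun i => P i t where
  markov t := inferInstance
  zero := by
    rw [← prodKernel_id]
    exact prodKernel_congr _ _ fun i => (hP i).zero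
  add s t := by
    rw [prodKernel_comp]
    exact prodKernel_congr _ _ fun i => (hP i).add s t
  reversible u v hu hv t := by
    obtain ⟨C, hC⟩ := (IsBoundedMeasurable.of_continuous hu.continuous).exists_bound
    obtain ⟨D, hD⟩ := (IsBoundedMeasurable.of_continuous hv.continuous).exists_bound
    exact IsReversible.integral_mul_act
      (isReversible_prodKernel fun i => (hP i).isReversible t) hu.continuous.measurable
      hv.continuous.measurable hC hD
  generator u hu := by
    refine ⟨(IsBoundedMeasurable.of_continuous (continuous_sumOperator hL hu)).memLp_two _, ?_⟩
    have := tendsto_eLpNorm_generator_partialKernel hL hP hu Finset.univ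
    simp only [partialKernel_univ] at this
    exact this

end ProductSemigroup

end

end MarkovTransport

/-! ### The tensorization proposition. -/

theorem mainTheorem11 {N : ℕ} (n : Fin N → ℕ) (E : Fin N → Type*)
    [∀ i, TopologicalSpace (E i)] [∀ i, T2Space (E i)] [∀ i, CompactSpace (E i)]
    [∀ i, ConnectedSpace (E i)]
    [∀ i, ChartedSpace (EuclideanSpace ℝ (Fin (n i))) (E i)] [∀ i, IsManifold (𝓡 (n i)) ∞ (E i)]
    [∀ i, MeasurableSpace (E i)] [∀ i, BorelSpace (E i)]
    (g : ∀ i, MarkovTransport.Metric (n i) (E i))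
    (V : ∀ i, E i → ℝ) (hV : ∀ i, ContMDiff (𝓡 (n i)) 𝓘(ℝ, ℝ) ∞ (V i))
    (hV1 : ∀ i, ∫ x, Real.exp (-V i x) ∂(MarkovTransport.riemannianVolume (g i)) = 1)
    (μ : ∀ i, Measure (E i)) (hμ : ∀ i, μ i = MarkovTransport.weightedMeasure (g i) (V i))
    (L : ∀ i, (E i → ℝ) → E i → ℝ)
    (hL : ∀ i, L i = MarkovTransport.diffusionGenerator (g i) (V i)) :
    -- the product semigroup
    (∀ P : ∀ i, ℝ≥0 → Kernel (E i) (E i),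
      (∀ i, MarkovTransport.IsMarkovSemigroup (𝓡 (n i)) (μ i) (L i) (P i)) →
      ∃ Q : ℝ≥0 → Kernel (∀ i, E i) (∀ i, E i),
        (∀ t x, Q t x = Measure.pi fun i => P i t (x i)) ∧
        MarkovTransport.IsMarkovSemigroup (ModelWithCorners.pi fun i => 𝓡 (n i)) (Measure.pi μ)
          (MarkovTransport.sumOperator L) Q) ∧
    -- its carré du champ
    (∀ u v : (∀ i, E i) → ℝ,
      ContMDiff (ModelWithCorners.pi fun i => 𝓡 (n i)) 𝓘(ℝ, ℝ) ∞ u →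
      ContMDiff (ModelWithCorners.pi fun i => 𝓡 (n i)) 𝓘(ℝ, ℝ) ∞ v →
      MarkovTransport.carreDuChamp (MarkovTransport.sumOperator L) u v =
        MarkovTransport.sumBilinear (fun i => MarkovTransport.carreDuChamp (L i)) u v) ∧
    -- tensorization
    (∀ f₁ g₁ : ∀ i, E i → ℝ,
      (∀ i, MarkovTransport.IsDensity (𝓡 (n i)) (μ i) (f₁ i)) →
      (∀ i, MarkovTransport.IsDensity (𝓡 (n i)) (μ i) (g₁ i)) →
      ∑ i, MarkovTransport.T2 (𝓡 (n i)) (μ i) (L i) (f₁ i) (g₁ i) ^ 2 ≤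
        MarkovTransport.T2 (ModelWithCorners.pi fun i => 𝓡 (n i)) (Measure.pi μ)
          (MarkovTransport.sumOperator L) (fun x => ∏ i, f₁ i (x i)) (fun x => ∏ i, g₁ i (x i))
          ^ 2) := by 
  have : ∀ i, SecondCountableTopology (E i) := fun i =>
    ChartedSpace.secondCountable_of_sigmaCompact (EuclideanSpace ℝ (Fin (n i))) (E i)
  have hprob : ∀ i, IsProbabilityMeasure (μ i) := fun i => by
    rw [hμ i]
    exact MarkovTransport.isProbabilityMeasure_weightedMeasure (g i) (hV1 i)
  -- From here on the Riemannian structure is used only through this property.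
  have hdiff : ∀ i, MarkovTransport.IsDiffusion (n i) (μ i) (L i) := fun i => by
    have := hprob i
    rw [hμ i] at this ⊢
    rw [hL i]
    exact MarkovTransport.isDiffusion_diffusionGenerator (hV i)
  refine ⟨fun P hP => ?_, fun u v _ _ => MarkovTransport.carreDuChamp_sumOperator L u v,
    fun f₁ g₁ hf hg => MarkovTransport.sum_T2_sq_le hdiff hf hg⟩
  have hm : ∀ i t, IsMarkovKernel (P i t) := fun i => (hP i).markov
  exact ⟨fun t => MarkovTransport.prodKernel fun i => P i t, fun t x => rfl,
    MarkovTransport.isMarkovSemigroup_prodKernel hdiff hP⟩
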